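/- Let $S$ be a closed connected orientable surface of genus at least $2$. A simple closed curve is the image of an injective continuous map from the circle to $S$; it is essential if it is not contractible. The fine curve graph $C^\dagger(S)$ has the essential simple closed curves of $S$ as vertices, two of them being joined by an edge if and only if they are disjoint; $d_{C^\dagger}$ is its graph distance. Two simple closed curves are isotopic if they are joined by a homotopy through simple closed curves. Let $c$ be a nonseparating simple closed curve of $S$, and let $p : S_c \to S$ be the infinite cyclic cover defined by the algebraic intersection number with $c$. Explicitly, let $\kappa$ be any two-sided collar of $c$, i.e. an embedded annulus $\kappa : S^1 \times [-1,1] \to S$ with core $\kappa(S^1 \times \{0\}) = c$ and such that $\kappa(S^1\times(-1,1))$ is open in $S$ (such collars exist since $S$ is orientable). Let $\theta : S \to \mathbb{R}/\mathbb{Z}$ be the map equal to $s/2$ at $\kappa(z,s)$ and to $1/2$ off the collar, and let $S_c = \{(x,t) \in S \times \mathbb{R} : \theta(x) = t \bmod 1\}$, with $p(x,t)=x$. A lift to $S_c$ of a simple closed curve $A$ of $S$ is a simple closed curve of $S_c$ that $p$ maps bijectively onto $A$. Let $\alpha$ be a simple closed curve of $S$ isotopic to $c$. (Both $c$ and $\alpha$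 are essential, so they are vertices of $C^\dagger(S)$.) Then $\alpha$ has a lift to $S_c$, and for every lift $\tilde\alpha$ of $\alpha$, if $\mathcal{C}_c(\alpha)$ denotes the number of lifts of $c$ to $S_c$ that $\tilde\alpha$ meets, then $$d_{C^\dagger}(\alpha, c) \le \mathcal{C}_c(\alpha) + 1 .$$ In particular this distance is finite. -/

import Mathlib

noncomputable section

namespace FineCurves

/-- A simple closed curve in a space `X`, seen as a subset of `X`: the image of an injective
continuous map from the circle. -/
def IsSimpleClosedCurve {X : Type*} [TopologicalSpace X] (A : Set X) : Prop :=
  ∃ γ : C(Circle, X), Function.Injective γ ∧ Set.range γ = A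

/-- An essential simple closed curve: one that is not contractible. (Two injective
parametrizations of the same curve differ by a homeomorphism of the circle, so the choice of
the parametrization does not matter.) -/
def IsEssentialCurve {X : Type*} [TopologicalSpace X] (A : Set X) : Prop :=
  ∃ γ : C(Circle, X), Function.Injective γ ∧ Set.range γ = A ∧ ¬ γ.Nullhomotopic

/-- Two simple closed curves are isotopic if they are joined by a homotopy all of whose
intermediate curves are simple. -/
def IsotopicCurves {X : Type*} [TopologicalSpace X] (A B : Set X) : Prop :=
  ∃ H : C(unitInterval × Circle, X),
    (∀ t, Function.Injective fun z => H (t, z)) ∧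
    (Set.range fun z => H (0, z)) = A ∧ (Set.range fun z => H (1, z)) = B

/-- The gluing `(0, t) ∼ (1, 1 - t)` that turns the square into a Möbius band. -/
def MobiusGlue (p q : unitInterval × unitInterval) : Prop :=
  p.1 = 0 ∧ q.1 = 1 ∧ q.2 = unitInterval.symm p.2

/-- A surface is orientable if it contains no Möbius band. An embedding of the (compact) Möbius
band into a Hausdorff space is a continuous map on the square whose fibres are exactly the
classes of the gluing. -/
def IsOrientableSurface (S : Type*) [TopologicalSpace S] : Prop :=
  ¬ ∃ f : C(unitInterval × unitInterval, S),
    ∀ p q, f p = f q ↔ p = q ∨ MobiusGlue p q ∨ MobiusGlue q p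

/-- The genus of a closed connected orientable surface is the largest number of pairwise disjoint
simple closed curves whose union does not separate it. `GenusAtLeast S g` says that there are
`g` such curves. -/
def GenusAtLeast (S : Type*) [TopologicalSpace S] (g : ℕ) : Prop :=
  ∃ a : Fin g → Set S, (∀ i, IsSimpleClosedCurve (a i)) ∧
    (∀ i j, i ≠ j → Disjoint (a i) (a j)) ∧ IsConnected (⋃ i, a i)ᶜ

/-- The vertices of the fine curve graph: the essential simple closed curves. -/
def EssentialCurve (S : Type*) [TopologicalSpace S] : Type _ :=
  {A : Set S // IsEssentialCurve A}

/-- The fine curve graph: two essential simple closed curves are joined by an edge if and only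
if they are disjoint. -/
def fineCurveGraph (S : Type*) [TopologicalSpace S] : SimpleGraph (EssentialCurve S) where
  Adj α β := Disjoint α.1 β.1
  symm := ⟨fun _ _ h => Disjoint.symm h⟩
  loopless := ⟨by
    rintro ⟨A, γ, hγ, rfl, hn⟩ h
    exact Set.disjoint_left.1 h (Set.mem_range_self 1) (Set.mem_range_self 1)⟩

/-- A closed two-sided collar of the simple closed curve `c`: an embedded annulus
`Circle × [-1, 1]` whose core is `c`. -/
structure Collar {S : Type*} [TopologicalSpace S] (c : Set S) where
  toMap : C(Circle × Set.Icc (-1 : ℝ) 1, S)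
  injective : Function.Injective toMap
  core : toMap '' {p | (p.2 : ℝ) = 0} = c
  isOpen_interior : IsOpen (toMap '' {p | (p.2 : ℝ) ∈ Set.Ioo (-1 : ℝ) 1})

namespace Collar

variable {S : Type*} [TopologicalSpace S] {c : Set S}

/-- The map `S → ℝ / ℤ` that is `s / 2` at the point with coordinates `(z, s)` of the collar and
`1 / 2` off the collar. It runs once around `ℝ / ℤ` when the curve `c` is crossed once, in the
positive direction of the collar, and `c` is its fibre over `0`. The morphism that it induces
from `H₁(S, ℤ)` to `ℤ = H₁(ℝ / ℤ, ℤ)` is the algebraic intersection number with `c` (suitably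
oriented). -/
def height (κ : Collar c) : S → UnitAddCircle :=
  Function.extend κ.toMap (fun p => (((p.2 : ℝ) / 2 : ℝ) : UnitAddCircle))
    (fun _ => ((1 / 2 : ℝ) : UnitAddCircle))

/-- The infinite cyclic cover `S_c` of `S` defined by the intersection number with `c`: the
pullback of the covering `ℝ → ℝ / ℤ` by `height`. The part with real coordinate in `[i, i + 1]`
is the `i`-th copy of the surface `S` cut along `c`; it is glued along the curve at level `i + 1`
to the next copy. -/
def Cover (κ : Collar c) : Type _ :=
  {q : S × ℝ // κ.height q.1 = (q.2 : UnitAddCircle)}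

instance (κ : Collar c) : TopologicalSpace κ.Cover :=
  inferInstanceAs (TopologicalSpace {q : S × ℝ // κ.height q.1 = (q.2 : UnitAddCircle)})

/-- The covering map `S_c → S`. -/
def proj (κ : Collar c) (q : κ.Cover) : S := q.1.1

/-- The simple closed curve `B` of `S_c` is a lift of the simple closed curve `A` of `S`: the
covering map sends `B` bijectively (hence homeomorphically) onto `A`. -/
def IsLift (κ : Collar c) (B : Set κ.Cover) (A : Set S) : Prop :=
  IsSimpleClosedCurve B ∧ Set.BijOn κ.proj B A

/-- The number of lifts of `c` that the subset `B` of `S_c` meets. If `B` is a lift of a curve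
`α` isotopic to `c`, this is the number `𝒞_c(α)`. -/
def liftsMet (κ : Collar c) (B : Set κ.Cover) : ℕ :=
  {C : Set κ.Cover | κ.IsLift C c ∧ (B ∩ C).Nonempty}.ncard

end Collar

end FineCurves

end

/-! Write θ : S → ℝ/ℤ for the height, whose zero set is c, and M for the number of lifts of c that
are met, plus one. A lift of α is compact, so it lies strictly between two integral levels a and a +
M (`Collar.exists_level_bounds`). The function a − level on it descends to α and extends, by Tietze,
to u : S → (−M, 0), with θ + u = 0 on α. The functions w_j = u − (j/M)(u + M) go from u to −M, so
the zero set of θ + w_j contains α for j = 0 and equals c for j = M. Consecutive w_j differ by (u +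
M)/M, whose values stay in a compact part of (0, 1), so thin neighbourhoods of consecutive zero sets
are disjoint. An essential simple closed curve in each intermediate neighbourhood therefore gives a
path of length M from α to c (`edist_le_of_interpolation`).

The heart of the matter is the existence of these curves (`exists_essentialCurve_near`). Every θ + w
is homotopic to θ, hence represents the class mod 2 dual to c. Since c does not separate, some class
ψ mod 2 takes the value 1 on c (`exists_dual_cocycle`). If ψ were a coboundary near the zero set of
θ + w, the cup product of the class of θ with ψ would vanish; but its value on the fundamental class
of S is ψ(c) = 1 (`dual_not_coboundary`). So ψ is nontrivial near the zero set. A shortest cyclic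
chain of small discs with odd ψ contains a simple closed curve with odd integral (`exists_loop`),
and such a curve is not contractible (`not_nullhomotopic_of_hasInt`).

The homology is elementary, in the style of Alexander and Spanier. A 1-cochain mod 2 is a function
of two points, closed if its coboundary vanishes on small triples (`IsCocycleOn`). A 2-chain is a
list of small triples. Its local degree at p is its pairing, near p, with the cochain that counts
crossings of a ray from p; it is locally constant and independent of the chart (`deg_eq_deg`).
Fundamental chains of any mesh are built one chart at a time (`HasFundamental.step`). The dual class
comes from linear algebra: if no ψ were odd on c, then c would bound a chain, whose local degree
changes by 1 across c and yet is constant along a path that joins the two sides of c in its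
complement. -/

namespace FineCurves

open Set Filter Topology Metric

/-! ### Cochains mod 2 on pairs of points -/

section Cochains

variable {X : Type*}

/-- The coboundary mod 2 of a cochain on pairs. -/
def cobd (k : X → X → ZMod 2) (a b c : X) : ZMod 2 := k a b + k b c + k a c

lemma zmod_two_add_self (x : ZMod 2) : x + x = 0 := CharTwo.add_self_eq_zero x

lemma zmod_two_eq_of_add_eq_zero {x y : ZMod 2} (h : x + y = 0) : x = y :=
  CharTwo.add_eq_zero.1 h

lemma zmod_two_cases (x : ZMod 2) : x = 0 ∨ x = 1 := by
  revert x; decide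

lemma zmod_two_ne_zero {x : ZMod 2} (h : x ≠ 0) : x = 1 := (zmod_two_cases x).resolve_left h

/-- A cochain is normalized if it is symmetric and vanishes on the diagonal. -/
structure SymNorm (k : X → X → ZMod 2) : Prop where
  symm : ∀ a b, k a b = k b a
  diag : ∀ a, k a a = 0

variable [PseudoMetricSpace X]

/-- The cochain `k` is closed on the triples of points of `A` with mutual distances less than
`ε`. -/
def IsCocycleOn (k : X → X → ZMod 2) (A : Set X) (ε : ℝ) : Prop :=
  ∀ a ∈ A, ∀ b ∈ A, ∀ c ∈ A, dist a b < ε → dist b c < ε → dist a c < ε → cobd k a b c = 0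

lemma IsCocycleOn.mono {k : X → X → ZMod 2} {A B : Set X} {ε δ : ℝ} (h : IsCocycleOn k A ε)
    (hB : B ⊆ A) (hδ : δ ≤ ε) : IsCocycleOn k B δ := fun a ha b hb c hc h1 h2 h3 =>
  h a (hB ha) b (hB hb) c (hB hc) (h1.trans_le hδ) (h2.trans_le hδ) (h3.trans_le hδ)

lemma IsCocycleOn.add {k l : X → X → ZMod 2} {A : Set X} {ε : ℝ} (h : IsCocycleOn k A ε)
    (h' : IsCocycleOn l A ε) : IsCocycleOn (fun a b => k a b + l a b) A ε := by
  intro a ha b hb c hc h1 h2 h3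
  have e1 := h a ha b hb c hc h1 h2 h3
  have e2 := h' a ha b hb c hc h1 h2 h3
  unfold cobd at *
  grind

lemma IsCocycleOn.diag {k : X → X → ZMod 2} {A : Set X} {ε : ℝ} (h : IsCocycleOn k A ε)
    (hε : 0 < ε) {a : X} (ha : a ∈ A) : k a a = 0 := by
  have e := h a ha a ha a ha (by simpa) (by simpa) (by simpa)
  unfold cobd at e
  grind

lemma IsCocycleOn.symm {k : X → X → ZMod 2} {A : Set X} {ε : ℝ} (h : IsCocycleOn k A ε)
    {a b : X} (ha : a ∈ A) (hb : b ∈ A) (hab : dist a b < ε) : k a b = k b a := by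
  have hε : 0 < ε := dist_nonneg.trans_lt hab
  have e := h a ha b hb a ha hab (by rwa [dist_comm]) (by simpa)
  have e' := h.diag hε ha
  unfold cobd at e
  grind

lemma IsCocycleOn.triangle {k : X → X → ZMod 2} {A : Set X} {ε : ℝ} (h : IsCocycleOn k A ε)
    {a b c : X} (ha : a ∈ A) (hb : b ∈ A) (hc : c ∈ A) (hab : dist a b < ε) (hbc : dist b c < ε)
    (hac : dist a c < ε) : k a c = k a b + k b c := by
  have e := h a ha b hb c hc hab hbc hac
  unfold cobd at e
  grind

lemma IsCocycleOn.comp {Y : Type*} [PseudoMetricSpace Y] {k : X → X → ZMod 2} {A : Set X}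
    {B : Set Y} {ε δ : ℝ} (h : IsCocycleOn k A ε) (q : Y → X) (hq : MapsTo q B A)
    (hqd : ∀ y ∈ B, ∀ y' ∈ B, dist y y' < δ → dist (q y) (q y') < ε) :
    IsCocycleOn (fun y y' => k (q y) (q y')) B δ := fun a ha b hb c hc h1 h2 h3 =>
  h _ (hq ha) _ (hq hb) _ (hq hc) (hqd a ha b hb h1) (hqd b hb c hc h2) (hqd a ha c hc h3)

end Cochains

/-! ### Triviality of cocycles on convex sets -/

section Potential

variable {E : Type*} [NormedAddCommGroup E] [NormedSpace ℝ E]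

/-- Boundedness lets one number of steps serve all segments of the set. The last clause says that
two segments from the same origin stay as close as their endpoints, so that they bound a ladder of
small triangles. -/
lemma exists_subdivision {Y : Set E} (hY : Convex ℝ Y) (hb : Bornology.IsBounded Y) {δ : ℝ}
    (hδ : 0 < δ) : ∃ n : ℕ, ∃ p : E → E → ℕ → E, ∀ x ∈ Y, ∀ y ∈ Y,
      p x y 0 = x ∧ p x y n = y ∧ (∀ i ≤ n, p x y i ∈ Y) ∧
      (∀ i, dist (p x y i) (p x y (i + 1)) < δ) ∧
      (∀ z ∈ Y, ∀ i ≤ n, dist (p x y i) (p x z i) ≤ dist y z) := by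
  obtain ⟨C, hC⟩ := hb.exists_norm_le
  obtain ⟨n, hn⟩ := exists_nat_gt ((2 * C) / δ)
  have hn1 : (0 : ℝ) < n + 1 := by positivity
  refine ⟨n + 1, fun x y i => x + ((i : ℝ) / (n + 1)) • (y - x), fun x hx y hy => ?_⟩
  have hn2 : 2 * C < δ * (n + 1) := by
    rw [div_lt_iff₀ hδ] at hn
    nlinarith
  refine ⟨by simp, ?_, ?_, ?_, ?_⟩
  · push_cast
    rw [div_self hn1.ne']; simp
  · intro i hi
    have hi' : (i : ℝ) ≤ n + 1 := by exact_mod_cast hi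
    exact hY.add_smul_sub_mem hx hy ⟨by positivity, (div_le_one hn1).2 hi'⟩
  · intro i
    rw [dist_eq_norm]
    have : (x + ((i : ℝ) / (n + 1)) • (y - x)) - (x + (((i + 1 : ℕ) : ℝ) / (n + 1)) • (y - x))
        = (-(1 / ((n : ℝ) + 1))) • (y - x) := by
      rw [add_sub_add_left_eq_sub, ← sub_smul]; congr 1; push_cast; field_simp; ring
    rw [this, norm_smul, norm_neg, Real.norm_of_nonneg (by positivity), one_div,
      inv_mul_lt_iff₀ hn1]
    calc ‖y - x‖ ≤ ‖y‖ + ‖x‖ := norm_sub_le _ _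
      _ ≤ C + C := add_le_add (hC y hy) (hC x hx)
      _ < (n + 1) * δ := by linarith
  · intro z hz i hi
    have hi' : (i : ℝ) ≤ n + 1 := by exact_mod_cast hi
    rw [dist_add_left, dist_eq_norm, ← smul_sub, sub_sub_sub_cancel_right, norm_smul,
      ← dist_eq_norm, Real.norm_of_nonneg (by positivity)]
    exact mul_le_of_le_one_left dist_nonneg ((div_le_one hn1).2 hi')

/-- A cocycle on a bounded convex set is a coboundary. -/
theorem exists_potential {Y : Set E} (hY : Convex ℝ Y) (hb : Bornology.IsBounded Y)
    {k : E → E → ZMod 2} {δ : ℝ} (hδ : 0 < δ) (hk : IsCocycleOn k Y δ) :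
    ∃ b : E → ZMod 2, ∀ y ∈ Y, ∀ z ∈ Y, dist y z < δ / 2 → k y z = b y + b z := by
  rcases Y.eq_empty_or_nonempty with rfl | ⟨x, hx⟩
  · exact ⟨0, by simp⟩
  obtain ⟨n, p, hp⟩ := exists_subdivision hY hb (half_pos hδ)
  refine ⟨fun y => ∑ i ∈ Finset.range n, k (p x y i) (p x y (i + 1)), fun y hy z hz hyz => ?_⟩
  obtain ⟨hy0, hyn, hyY, hyd, hyz'⟩ := hp x hx y hy
  obtain ⟨hz0, hzn, hzY, hzd, -⟩ := hp x hx z hz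
  -- The potential is the sum along the segment from the base point. Climbing the ladder between two
  -- such segments, each cell splits into two small triangles, on which `k` is closed; the steps and
  -- rungs are shorter than δ / 2 so that the diagonals are shorter than δ.
  have key : ∀ m ≤ n, k (p x y m) (p x z m) =
      ∑ i ∈ Finset.range m, k (p x y i) (p x y (i + 1)) +
      ∑ i ∈ Finset.range m, k (p x z i) (p x z (i + 1)) := by
    intro m
    induction m with
    | zero => intro _; rw [hy0, hz0, hk.diag hδ hx]; simp
    | succ m ih =>
      intro hm
      have hm' : m ≤ n := by omega
      have h1 := hyz' z hz m hm'
      have h2 := hyz' z hz (m + 1) hm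
      have h3 : dist (p x y m) (p x z (m + 1)) < δ := by
        have := dist_triangle (p x y m) (p x z m) (p x z (m + 1)); have := hzd m; linarith
      have e1 := hk.triangle (hyY m hm') (hzY m hm') (hzY _ hm) (by linarith)
        (by have := hzd m; linarith) h3
      have e2 := hk.triangle (hyY m hm') (hyY _ hm) (hzY _ hm) (by have := hyd m; linarith)
        (by linarith) h3
      rw [Finset.sum_range_succ, Finset.sum_range_succ]
      grind
  have := key n le_rfl
  rwa [hyn, hzn] at this

/-- The uniform form of connectedness used throughout: points of a convex set are joined by steps of
size less than δ. -/
theorem eq_of_locally_constant {F : Type*} {Y : Set E} (hY : Convex ℝ Y)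
    (hb : Bornology.IsBounded Y) {d : E → F} {δ : ℝ} (hδ : 0 < δ)
    (hd : ∀ y ∈ Y, ∀ z ∈ Y, dist y z < δ → d y = d z) {y z : E} (hy : y ∈ Y) (hz : z ∈ Y) :
    d y = d z := by
  obtain ⟨n, p, hp⟩ := exists_subdivision hY hb hδ
  obtain ⟨h0, hn, hpY, hpd, -⟩ := hp y hy z hz
  have : ∀ m ≤ n, d y = d (p y z m) := by
    intro m
    induction m with
    | zero => intro _; rw [h0]
    | succ m ih =>
      intro hm
      rw [ih (by omega)]
      exact hd _ (hpY _ (by omega)) _ (hpY _ hm) (hpd m)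
  rw [this n le_rfl, hn]

end Potential

/-! ### Integrals of cocycles along paths -/

section Integral

variable {X : Type*}

/-- `b` is a potential of the cochain `k` along the path `A`. -/
def IsPot (k : X → X → ZMod 2) (A : ℝ → X) (s t : ℝ) (b : ℝ → ZMod 2) : Prop :=
  ∃ δ > 0, ∀ x ∈ Icc s t, ∀ y ∈ Icc s t, dist x y < δ → k (A x) (A y) = b x + b y

/-- The integral of the cochain `k` along the path `A` between the times `s` and `t`. -/
def HasInt (k : X → X → ZMod 2) (A : ℝ → X) (s t : ℝ) (v : ZMod 2) : Prop :=
  ∃ b, IsPot k A s t b ∧ v = b s + b t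

lemma IsPot.mono {k : X → X → ZMod 2} {A : ℝ → X} {s t s' t' : ℝ} {b : ℝ → ZMod 2}
    (h : IsPot k A s t b) (hs : s ≤ s') (ht : t' ≤ t) : IsPot k A s' t' b := by
  obtain ⟨δ, hδ, h⟩ := h
  exact ⟨δ, hδ, fun x hx y hy => h x ⟨hs.trans hx.1, hx.2.trans ht⟩ y ⟨hs.trans hy.1, hy.2.trans ht⟩⟩

lemma IsPot.unique {k : X → X → ZMod 2} {A : ℝ → X} {s t : ℝ} {b b' : ℝ → ZMod 2}
    (h : IsPot k A s t b) (h' : IsPot k A s t b') {x y : ℝ} (hx : x ∈ Icc s t) (hy : y ∈ Icc s t) :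
    b x + b y = b' x + b' y := by
  obtain ⟨δ, hδ, h⟩ := h
  obtain ⟨δ', hδ', h'⟩ := h'
  have := eq_of_locally_constant (d := fun x => b x + b' x) (convex_Icc s t) (isBounded_Icc s t)
    (lt_min hδ hδ') (fun x hx y hy hxy => by
      have e1 := h x hx y hy (hxy.trans_le (min_le_left _ _))
      have e2 := h' x hx y hy (hxy.trans_le (min_le_right _ _))
      grind) hx hy
  grind

lemma HasInt.unique {k : X → X → ZMod 2} {A : ℝ → X} {s t : ℝ} {v w : ZMod 2}
    (hst : s ≤ t) (h : HasInt k A s t v) (h' : HasInt k A s t w) : v = w := by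
  obtain ⟨b, hb, rfl⟩ := h
  obtain ⟨b', hb', rfl⟩ := h'
  exact hb.unique hb' (left_mem_Icc.2 hst) (right_mem_Icc.2 hst)

lemma exists_isPot [PseudoMetricSpace X] {k : X → X → ZMod 2} {Z : Set X} {ε : ℝ} (hε : 0 < ε)
    (hk : IsCocycleOn k Z ε) {A : ℝ → X} {s t : ℝ} (hA : ContinuousOn A (Icc s t))
    (hAZ : MapsTo A (Icc s t) Z) : ∃ b, IsPot k A s t b := by
  obtain ⟨δ, hδ, h⟩ := Metric.uniformContinuousOn_iff.1
    (isCompact_Icc.uniformContinuousOn_of_continuous hA) ε hε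
  obtain ⟨b, hb⟩ := exists_potential (convex_Icc s t) (isBounded_Icc s t) hδ (hk.comp A hAZ h)
  exact ⟨b, δ / 2, half_pos hδ, hb⟩

lemma exists_hasInt [PseudoMetricSpace X] {k : X → X → ZMod 2} {Z : Set X} {ε : ℝ} (hε : 0 < ε)
    (hk : IsCocycleOn k Z ε) {A : ℝ → X} {s t : ℝ} (hA : ContinuousOn A (Icc s t))
    (hAZ : MapsTo A (Icc s t) Z) : ∃ v, HasInt k A s t v :=
  let ⟨b, hb⟩ := exists_isPot hε hk hA hAZ
  ⟨_, b, hb, rfl⟩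

/-- Additivity of the integral. -/
lemma HasInt.split {k : X → X → ZMod 2} {A : ℝ → X} {r s t : ℝ} {u v w : ZMod 2}
    (hrs : r ≤ s) (hst : s ≤ t) (h : HasInt k A r t u) (h1 : HasInt k A r s v)
    (h2 : HasInt k A s t w) : u = v + w := by
  obtain ⟨b, hb, rfl⟩ := h
  have e1 := h1.unique hrs ⟨b, hb.mono le_rfl hst, rfl⟩
  have e2 := h2.unique hst ⟨b, hb.mono hrs le_rfl, rfl⟩
  rw [e1, e2]
  grind

lemma HasInt.sub_left {k : X → X → ZMod 2} {A : ℝ → X} {r s t : ℝ} {u : ZMod 2}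
    (hrs : r ≤ s) (hst : s ≤ t) (h : HasInt k A r t u) :
    ∃ v w, HasInt k A r s v ∧ HasInt k A s t w ∧ u = v + w := by
  obtain ⟨b, hb, rfl⟩ := h
  exact ⟨_, _, ⟨b, hb.mono le_rfl hst, rfl⟩, ⟨b, hb.mono hrs le_rfl, rfl⟩,
    by grind⟩

lemma HasInt.congr {k : X → X → ZMod 2} {A B : ℝ → X} {s t : ℝ} {u : ZMod 2}
    (c : ℝ) (h : HasInt k A s t u) (hB : ∀ x ∈ Icc s t, B (x + c) = A x) :
    HasInt k B (s + c) (t + c) u := by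
  obtain ⟨b, ⟨δ, hδ, hb⟩, rfl⟩ := h
  refine ⟨fun x => b (x - c), ⟨δ, hδ, fun x hx y hy hxy => ?_⟩, by simp⟩
  have hx' : x - c ∈ Icc s t := ⟨by linarith [hx.1], by linarith [hx.2]⟩
  have hy' : y - c ∈ Icc s t := ⟨by linarith [hy.1], by linarith [hy.2]⟩
  have := hb _ hx' _ hy' (by simpa using hxy)
  rw [← hB _ hx', ← hB _ hy'] at this
  simpa using this

/-- The integral of a cocycle along a small path. -/
lemma hasInt_of_small [PseudoMetricSpace X] {k : X → X → ZMod 2} {Z : Set X} {ε : ℝ}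
    (hk : IsCocycleOn k Z ε) {A : ℝ → X} {s t : ℝ} (hst : s ≤ t) 
    (hAZ : MapsTo A (Icc s t) Z) (hsm : ∀ x ∈ Icc s t, ∀ y ∈ Icc s t, dist (A x) (A y) < ε) :
    HasInt k A s t (k (A s) (A t)) := by
  have hs := left_mem_Icc.2 hst
  have ht := right_mem_Icc.2 hst
  have hε : 0 < ε := dist_nonneg.trans_lt (hsm s hs s hs)
  refine ⟨fun x => k (A s) (A x), ⟨1, one_pos, fun x hx y hy _ => ?_⟩, ?_⟩
  · have := hk.triangle (hAZ hs) (hAZ hx) (hAZ hy) (hsm s hs x hx) (hsm x hx y hy) (hsm s hs y hy)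
    grind
  · simp only [hk.diag hε (hAZ hs), zero_add]

end Integral

/-! ### Cocycles on a round annulus -/

section Annulus

open Real

/-- The closed round annulus. -/
def annulus (p : ℂ) (r R : ℝ) : Set ℂ := {z | r ≤ dist z p ∧ dist z p ≤ R}

lemma dist_circleMap_le (p : ℂ) (r r' t t' : ℝ) :
    dist (circleMap p r t) (circleMap p r' t') ≤ |r - r'| + |r| * |t - t'| := by
  have h1 : dist (circleMap p r t) (circleMap p r t') ≤ |r| * |t - t'| := by
    have := (lipschitzWith_circleMap p r).dist_le_mul t t'
    simpa [Real.dist_eq] using this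
  have h2 : dist (circleMap p r t') (circleMap p r' t') = |r - r'| := by
    rw [dist_eq_norm]
    simp only [circleMap]
    rw [add_sub_add_left_eq_sub, ← sub_mul, norm_mul, Complex.norm_exp_ofReal_mul_I, mul_one,
      ← Complex.ofReal_sub, Complex.norm_real, Real.norm_eq_abs]
  linarith [dist_triangle (circleMap p r t) (circleMap p r t') (circleMap p r' t')]

lemma circleMap_dist_arg (p z : ℂ) : circleMap p (dist z p) (Complex.arg (z - p)) = z := by
  rw [circleMap, dist_eq_norm, Complex.norm_mul_exp_arg_mul_I]; ring

lemma circleMap_mem_annulus {p : ℂ} {r R s t : ℝ} (hr : 0 ≤ r) (hs : s ∈ Icc r R) :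
    circleMap p s t ∈ annulus p r R := by
  have : dist (circleMap p s t) p = s := by
    simp [dist_eq_norm, abs_of_nonneg (hr.trans hs.1)]
  exact ⟨by rw [this]; exact hs.1, by rw [this]; exact hs.2⟩

lemma exists_arg_bound {σ : ℝ} (hσ : 0 < σ) :
    ∃ η > 0, ∀ w : ℂ, dist w 1 < η → |Complex.arg w| < σ := by
  have h : ContinuousAt Complex.arg 1 := Complex.continuousAt_arg (by simp)
  obtain ⟨η, hη, h⟩ := Metric.continuousAt_iff.1 h σ hσ
  exact ⟨η, hη, fun w hw => by simpa using h hw⟩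

/-- A cocycle on a round annulus with vanishing integral on a circle is a coboundary. -/
theorem exists_potential_annulus {r R δ : ℝ} (hr : 0 < r) (hδ : 0 < δ) :
    ∃ δ' > 0, ∀ (p : ℂ) (k : ℂ → ℂ → ZMod 2), IsCocycleOn k (annulus p r R) δ →
      (∃ s ∈ Icc r R, HasInt k (circleMap p s) 0 (2 * π) 0) →
      ∃ b : ℂ → ZMod 2, ∀ z ∈ annulus p r R, ∀ z' ∈ annulus p r R, dist z z' < δ' →
        k z z' = b z + b z' := by
  rcases le_or_gt r R with hrR | hrR
  swap
  · refine ⟨1, one_pos, fun p k _ ⟨s, hs, _⟩ => ?_⟩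
    linarith [hs.1, hs.2]
  have hR : 0 < R := hr.trans_le hrR
  set σ : ℝ := δ / (1 + R) / 2 with hσdef
  have hσ : 0 < σ := by positivity
  obtain ⟨η, hη, harg⟩ := exists_arg_bound (lt_min hσ pi_pos)
  -- The bound depends only on the radii and δ, not on the centre or the cocycle; the comparison of
  -- charts needs this uniformity.
  refine ⟨min σ (η * r), by positivity, fun p k hk ⟨s, hs, hks⟩ => ?_⟩
  have hq : ∀ y ∈ Icc r R ×ˢ Icc (-(2 * π)) (2 * π), ∀ y' ∈ Icc r R ×ˢ Icc (-(2 * π)) (2 * π),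
      dist y y' < δ / (1 + R) → dist (circleMap p y.1 y.2) (circleMap p y'.1 y'.2) < δ := by
    intro y hy y' hy' hyy
    have h1 : |y.1 - y'.1| < δ / (1 + R) := by
      rw [← Real.dist_eq]; exact (le_max_left _ _).trans_lt hyy
    have h2 : |y.2 - y'.2| < δ / (1 + R) := by
      rw [← Real.dist_eq]; exact (le_max_right _ _).trans_lt hyy
    have h3 := dist_circleMap_le p y.1 y'.1 y.2 y'.2
    have h4 : |y.1| ≤ R := by rw [abs_of_nonneg (hr.le.trans hy.1.1)]; exact hy.1.2
    have h5 : |y.1| * |y.2 - y'.2| ≤ R * (δ / (1 + R)) :=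
      mul_le_mul h4 h2.le (abs_nonneg _) hR.le
    have h6 : δ = δ / (1 + R) + R * (δ / (1 + R)) := by field_simp
    linarith
  -- The annulus is unrolled to a convex strip. Its angles cover [−2π, 2π], so that an argument in
  -- (−π, π] changed by less than π stays in the strip.
  obtain ⟨b, hb⟩ := exists_potential ((convex_Icc r R).prod (convex_Icc (-(2 * π)) (2 * π)))
    ((isBounded_Icc r R).prod (isBounded_Icc (-(2 * π)) (2 * π))) (by positivity)
    (hk.comp (fun y : ℝ × ℝ => circleMap p y.1 y.2)
      (fun y hy => circleMap_mem_annulus hr.le hy.1) hq)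
  rw [← hσdef] at hb
  -- The difference of `b` over one full turn is constant on the strip, and on one circle it is the
  -- integral, which is 0; so `b` descends to the annulus.
  have hper : ∀ x ∈ Icc r R, ∀ t ∈ Icc (-(2 * π)) 0, b (x, t) = b (x, t + 2 * π) := by
    have hmem : ∀ y ∈ Icc r R ×ˢ Icc (-(2 * π)) 0, y ∈ Icc r R ×ˢ Icc (-(2 * π)) (2 * π) ∧
        (y.1, y.2 + 2 * π) ∈ Icc r R ×ˢ Icc (-(2 * π)) (2 * π) := fun y hy =>
      ⟨⟨hy.1, hy.2.1, by linarith [hy.2.2, pi_pos]⟩,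
        ⟨hy.1, by simp only; linarith [hy.2.1, pi_pos], by simp only; linarith [hy.2.2]⟩⟩
    have hconst : ∀ y ∈ Icc r R ×ˢ Icc (-(2 * π)) 0, ∀ y' ∈ Icc r R ×ˢ Icc (-(2 * π)) 0,
        b y + b (y.1, y.2 + 2 * π) = b y' + b (y'.1, y'.2 + 2 * π) := by
      intro y hy y' hy'
      refine eq_of_locally_constant (d := fun y : ℝ × ℝ => b y + b (y.1, y.2 + 2 * π))
        ((convex_Icc r R).prod (convex_Icc (-(2 * π)) 0))
        ((isBounded_Icc r R).prod (isBounded_Icc (-(2 * π)) 0)) hσ ?_ hy hy'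
      intro y hy y' hy' hyy
      have e1 := hb y (hmem y hy).1 y' (hmem y' hy').1 hyy
      have e2 := hb _ (hmem y hy).2 _ (hmem y' hy').2 (by
        simpa [Prod.dist_eq] using hyy)
      simp only [periodic_circleMap p _ _] at e2
      grind
    intro x hx t ht
    have e := hconst (x, t) ⟨hx, ht⟩ (s, 0) ⟨hs, by simp [pi_pos.le], le_rfl⟩
    have hpot : HasInt k (circleMap p s) 0 (2 * π) (b (s, 0) + b (s, 2 * π)) := by
      refine ⟨fun t => b (s, t), ⟨σ, hσ, fun x hx y hy hxy => ?_⟩, rfl⟩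
      refine hb (s, x) ⟨hs, ?_, hx.2⟩ (s, y) ⟨hs, ?_, hy.2⟩ ?_
      · exact le_trans (by linarith [pi_pos]) hx.1
      · exact le_trans (by linarith [pi_pos]) hy.1
      · rw [Prod.dist_eq]; simpa [hσ] using hxy
    have e' := hpot.unique (by positivity) hks
    simp only [zero_add] at e
    rw [e'] at e
    grind
  refine ⟨fun z => b (dist z p, Complex.arg (z - p)), fun z hz z' hz' hzz => ?_⟩
  have hzp : 0 < dist z p := hr.trans_le hz.1
  have hzp0 : z - p ≠ 0 := by
    rw [← norm_pos_iff, ← dist_eq_norm]; exact hzp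
  -- The argument of this ratio is the small change of angle from z to z'. Added to the argument of
  -- z it may leave (−π, π], which is where `hper` is used.
  set w : ℂ := (z' - p) / (z - p) with hw
  have hw1 : dist w 1 < η := by
    have : w - 1 = (z' - z) / (z - p) := by rw [hw]; field_simp; ring
    rw [dist_eq_norm, this, norm_div, ← dist_eq_norm, ← dist_eq_norm, div_lt_iff₀ hzp, dist_comm]
    calc dist z z' < η * r := hzz.trans_le (min_le_right _ _)
      _ ≤ η * dist z p := by gcongr; exact hz.1
  have hs' := harg w hw1
  have hs1 := abs_lt.1 (hs'.trans_le (min_le_right _ _))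
  have ht := Complex.neg_pi_lt_arg (z - p)
  have ht' := Complex.arg_le_pi (z - p)
  have hu := Complex.neg_pi_lt_arg (z' - p)
  have hu' := Complex.arg_le_pi (z' - p)
  set t := Complex.arg (z - p)
  set u := Complex.arg (z' - p)
  have hzeq : circleMap p (dist z p) t = z := circleMap_dist_arg p z
  have hzeq' : circleMap p (dist z' p) u = z' := circleMap_dist_arg p z'
  have hz2 : circleMap p (dist z' p) (t + Complex.arg w) = z' := by
    have h1 : (dist z p : ℂ) * Complex.exp (t * Complex.I) = z - p := by
      rw [dist_eq_norm, Complex.norm_mul_exp_arg_mul_I]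
    have h2 : (‖w‖ : ℂ) * Complex.exp (Complex.arg w * Complex.I) = w :=
      Complex.norm_mul_exp_arg_mul_I w
    have h3 : dist z' p = dist z p * ‖w‖ := by
      rw [hw, norm_div, ← dist_eq_norm, ← dist_eq_norm]; field_simp
    have h4 : z' - p = (z - p) * w := by rw [hw]; field_simp
    rw [circleMap, h3]
    push_cast
    rw [add_mul, Complex.exp_add]
    calc p + (dist z p : ℂ) * ‖w‖ * (Complex.exp (t * Complex.I) *
          Complex.exp (Complex.arg w * Complex.I))
        = p + ((dist z p : ℂ) * Complex.exp (t * Complex.I)) *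
          ((‖w‖ : ℂ) * Complex.exp (Complex.arg w * Complex.I)) := by ring
      _ = z' := by rw [h1, h2, ← h4]; ring
  have hz'0 : dist z' p ≠ 0 := (hr.trans_le hz'.1).ne'
  obtain ⟨n, hn⟩ : ∃ n : ℤ, t + Complex.arg w = u + n * (2 * π) := by
    have h := hz2.trans hzeq'.symm
    simp only [circleMap, add_right_inj] at h
    have h' := mul_left_cancel₀ (by exact_mod_cast hz'0) h
    obtain ⟨n, hn⟩ := Complex.exp_eq_exp_iff_exists_int.1 h'
    refine ⟨n, ?_⟩
    have h5 : ((t + Complex.arg w : ℝ) : ℂ) * Complex.I =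
        ((u + n * (2 * π) : ℝ) : ℂ) * Complex.I := by
      rw [hn]; push_cast; ring
    exact_mod_cast mul_right_cancel₀ Complex.I_ne_zero h5
  have hmain := hb (dist z p, t) ⟨hz, by simp only; constructor <;> linarith⟩
    (dist z' p, t + Complex.arg w) ⟨hz', by simp only; constructor <;> linarith⟩ (by
      rw [Prod.dist_eq]
      refine max_lt ?_ ?_
      · have := abs_dist_sub_le z z' p
        rw [Real.dist_eq]
        exact this.trans_lt (hzz.trans_le (min_le_left _ _))
      · simpa using hs'.trans_le (min_le_left _ _))
  simp only [hzeq, hz2] at hmain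
  rw [hmain]
  congr 1
  change _ = b (dist z' p, u)
  have hnb : -3 < (n : ℝ) * 2 ∧ (n : ℝ) * 2 < 3 := by
    constructor <;> nlinarith [pi_pos]
  have hn3 : n = -1 ∨ n = 0 ∨ n = 1 := by
    have h1 : (-3 : ℤ) < n * 2 := by exact_mod_cast hnb.1
    have h2 : n * 2 < (3 : ℤ) := by exact_mod_cast hnb.2
    omega
  rcases hn3 with rfl | rfl | rfl
  · have := hper (dist z' p) hz' (t + Complex.arg w) ⟨by linarith, by
      rw [hn]; push_cast; linarith⟩
    rw [this]
    congr 2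
    rw [hn]; push_cast; ring
  · rw [hn]; simp
  · have := hper (dist z' p) hz' u ⟨by linarith, by push_cast at hn; linarith⟩
    rw [this]
    congr 2
    rw [hn]; push_cast; ring

end Annulus

/-! ### Crossings of a ray -/

section Cross

open Real

/-- The parity of the crossing of the segment from `z` to `z'` with the horizontal ray from `p`
to the right, for nearby `z` and `z'` away from `p`. The position relative to the end of the ray
is tested at the lower endpoint. -/
noncomputable def cross (p z z' : ℂ) : ZMod 2 :=
  open Classical in
  if (z.im < p.im ∧ p.im ≤ z'.im ∧ p.re ≤ z.re) ∨ (z'.im < p.im ∧ p.im ≤ z.im ∧ p.re ≤ z'.re)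
  then 1 else 0

/-- A variant of `cross` that tests the position at the upper endpoint. -/
noncomputable def crossUp (p z z' : ℂ) : ZMod 2 :=
  open Classical in
  if (z.im < p.im ∧ p.im ≤ z'.im ∧ p.re ≤ z'.re) ∨ (z'.im < p.im ∧ p.im ≤ z.im ∧ p.re ≤ z.re)
  then 1 else 0

lemma symmNorm_cross (p : ℂ) : SymNorm (cross p) := by
  constructor
  · intro a b; unfold cross; simp only [or_comm]
  · intro a
    have : ¬ ((a.im < p.im ∧ p.im ≤ a.im ∧ p.re ≤ a.re) ∨
      (a.im < p.im ∧ p.im ≤ a.im ∧ p.re ≤ a.re)) := by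
      rintro (⟨h1, h2, -⟩ | ⟨h1, h2, -⟩) <;> linarith
    simp only [cross, this, if_false]

lemma symmNorm_crossUp (p : ℂ) : SymNorm (crossUp p) := by
  constructor
  · intro a b; unfold crossUp; simp only [or_comm]
  · intro a
    have : ¬ ((a.im < p.im ∧ p.im ≤ a.im ∧ p.re ≤ a.re) ∨
      (a.im < p.im ∧ p.im ≤ a.im ∧ p.re ≤ a.re)) := by
      rintro (⟨h1, h2, -⟩ | ⟨h1, h2, -⟩) <;> linarith
    simp only [crossUp, this, if_false]

lemma re_im_bounds {z w : ℂ} {d : ℝ} (h : dist z w < d) :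
    -d < z.re - w.re ∧ z.re - w.re < d ∧ -d < z.im - w.im ∧ z.im - w.im < d := by
  rw [dist_eq_norm] at h
  have h1 := abs_lt.1 ((Complex.abs_re_le_norm (z - w)).trans_lt h)
  have h2 := abs_lt.1 ((Complex.abs_im_le_norm (z - w)).trans_lt h)
  simp only [Complex.sub_re, Complex.sub_im] at h1 h2
  exact ⟨h1.1, h1.2, h2.1, h2.2⟩

lemma abs_re_add_abs_im {z w : ℂ} {d : ℝ} (h : d ≤ dist z w) :
    d ≤ |z.re - w.re| + |z.im - w.im| := by
  rw [dist_eq_norm] at h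
  simpa using h.trans (Complex.norm_le_abs_re_add_abs_im (z - w))

/-- If a short edge straddles the horizontal line through p while both ends are at distance at least
2r from p, then both ends are at horizontal distance more than r from p, hence on the same side. -/
lemma crossUp_eq_cross {p z z' : ℂ} {r : ℝ} (hz : 2 * r ≤ dist z p) (hz' : 2 * r ≤ dist z' p)
    (h : dist z z' < r) : crossUp p z z' = cross p z z' := by
  obtain ⟨h1, h2, h3, h4⟩ := re_im_bounds h
  have e1 := abs_re_add_abs_im hz
  have e2 := abs_re_add_abs_im hz'
  have : ((z.im < p.im ∧ p.im ≤ z'.im ∧ p.re ≤ z'.re) ∨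
      (z'.im < p.im ∧ p.im ≤ z.im ∧ p.re ≤ z.re)) ↔
      ((z.im < p.im ∧ p.im ≤ z'.im ∧ p.re ≤ z.re) ∨
      (z'.im < p.im ∧ p.im ≤ z.im ∧ p.re ≤ z'.re)) := by
    rcases abs_cases (z.re - p.re) with ⟨a1, a2⟩ | ⟨a1, a2⟩ <;>
    rcases abs_cases (z.im - p.im) with ⟨a3, a4⟩ | ⟨a3, a4⟩ <;>
    rcases abs_cases (z'.re - p.re) with ⟨a5, a6⟩ | ⟨a5, a6⟩ <;>
    rcases abs_cases (z'.im - p.im) with ⟨a7, a8⟩ | ⟨a7, a8⟩ <;>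
    constructor <;> rintro (⟨g1, g2, g3⟩ | ⟨g1, g2, g3⟩) <;>
    first
      | (exfalso; linarith)
      | (left; refine ⟨?_, ?_, ?_⟩ <;> linarith)
      | (right; refine ⟨?_, ?_, ?_⟩ <;> linarith)
  unfold crossUp cross
  simp only [this]

/-- Away from `p`, the crossing cochain is the coboundary of the indicator of the upper half plane
on the right of `p` and zero on the left. -/
lemma cross_eq {p z z' : ℂ} {r : ℝ} (hz : 2 * r ≤ dist z p) (h : dist z z' < r) :
    (open Classical in
    cross p z z' = if p.re ≤ z.re then (if p.im ≤ z.im then 1 else 0) +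
      (if p.im ≤ z'.im then 1 else 0) else 0) := by
  classical
  obtain ⟨h1, h2, h3, h4⟩ := re_im_bounds h
  have e1 := abs_re_add_abs_im hz
  have h11 : (1 : ZMod 2) + 1 = 0 := rfl
  unfold cross
  rcases abs_cases (z.re - p.re) with ⟨a1, a2⟩ | ⟨a1, a2⟩ <;>
  rcases abs_cases (z.im - p.im) with ⟨a3, a4⟩ | ⟨a3, a4⟩ <;>
  split_ifs with g1 g2 g3 g4 <;>
  first | rfl | skip
  all_goals exfalso
  all_goals
  first
    | linarith
    | (rcases g1 with ⟨g5, g6, g7⟩ | ⟨g5, g6, g7⟩ <;> linarith)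
    | (apply g1; left; refine ⟨?_, ?_, ?_⟩ <;> linarith)
    | (apply g1; right; refine ⟨?_, ?_, ?_⟩ <;> linarith)

/-- By `cross_eq` the cochain is a coboundary on the right of p and 0 on the left. If two vertices
of a small triple lie on different sides, the triple is well above or well below p, where both
descriptions give 0. -/
lemma isCocycleOn_cross (p : ℂ) (r : ℝ) : IsCocycleOn (cross p) {z | 2 * r ≤ dist z p} (r / 2) := by
  classical
  intro a ha b hb c hc h1 h2 h3
  have hr : 0 < r / 2 := dist_nonneg.trans_lt h1
  unfold cobd
  have k1 := re_im_bounds h1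
  have k2 := re_im_bounds h2
  have k3 := re_im_bounds h3
  have e1 := abs_re_add_abs_im (show 2 * r ≤ dist a p from ha)
  have e2 := abs_re_add_abs_im (show 2 * r ≤ dist b p from hb)
  rw [cross_eq ha (by linarith), cross_eq hb (by linarith), cross_eq ha (by linarith)]
  have h11 : (1 : ZMod 2) + 1 = 0 := rfl
  by_cases hre : p.re ≤ a.re <;> by_cases hre' : p.re ≤ b.re
  · simp only [hre, hre', if_true]; grind
  · have : (p.im ≤ b.im ↔ p.im ≤ a.im) ∧ (p.im ≤ c.im ↔ p.im ≤ a.im) := by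
      rcases abs_cases (a.re - p.re) with ⟨a1, a2⟩ | ⟨a1, a2⟩ <;>
      rcases abs_cases (a.im - p.im) with ⟨a3, a4⟩ | ⟨a3, a4⟩ <;>
      refine ⟨⟨fun _ => ?_, fun _ => ?_⟩, ⟨fun _ => ?_, fun _ => ?_⟩⟩ <;> linarith
    simp only [hre, hre', if_true, if_false, this.1, this.2]; grind
  · have : (p.im ≤ b.im ↔ p.im ≤ a.im) ∧ (p.im ≤ c.im ↔ p.im ≤ a.im) := by
      rcases abs_cases (a.re - p.re) with ⟨a1, a2⟩ | ⟨a1, a2⟩ <;>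
      rcases abs_cases (a.im - p.im) with ⟨a3, a4⟩ | ⟨a3, a4⟩ <;>
      refine ⟨⟨fun _ => ?_, fun _ => ?_⟩, ⟨fun _ => ?_, fun _ => ?_⟩⟩ <;> linarith
    simp only [hre, hre', if_true, if_false, this.1, this.2]; grind
  · simp only [hre, hre', if_false]; grind

/-- The crossing cochain has integral `1` on the circles centred at `p`. -/
lemma hasInt_cross_circleMap (p : ℂ) {r : ℝ} (hr : 0 < r) :
    HasInt (cross p) (circleMap p r) 0 (2 * π) 1 := by
  classical
  -- Points at the height of p count as upper, so t = 0 and t ≤ π are upper and the descent at π is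
  -- on the left, not counted. The only counted crossing occurs on arrival at 2π, where the
  -- potential jumps.
  refine ⟨fun t => if t = 2 * π then 1 else 0, ⟨1, one_pos, fun x hx y hy hxy => ?_⟩, ?_⟩
  · have him : ∀ t, (circleMap p r t).im = p.im + r * sin t := fun t => by
      simp [circleMap, Complex.exp_ofReal_mul_I_im]
    have hre : ∀ t, (circleMap p r t).re = p.re + r * cos t := fun t => by
      simp [circleMap, Complex.exp_ofReal_mul_I_re]
    have hpi := Real.pi_gt_three
    have hup : ∀ t ∈ Icc 0 (2 * π), (p.im ≤ p.im + r * sin t ↔ (t ≤ π ∨ t = 2 * π)) := by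
      intro t ht
      constructor
      · intro h
        by_contra! hc
        have : sin (t - 2 * π) < 0 := Real.sin_neg_of_neg_of_neg_pi_lt
          (by have := lt_of_le_of_ne ht.2 hc.2; linarith) (by linarith [hc.1])
        rw [Real.sin_sub_two_pi] at this
        nlinarith
      · rintro (h | rfl)
        · have := Real.sin_nonneg_of_nonneg_of_le_pi ht.1 h
          have := mul_nonneg hr.le this
          linarith
        · simp
    have hlow : ∀ t ∈ Icc 0 (2 * π), (p.im + r * sin t < p.im ↔ ¬ (t ≤ π ∨ t = 2 * π)) := by
      intro t ht
      rw [← hup t ht, not_le]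
    have hcneg : ∀ t, π < t → t < π + 1 → ¬ (p.re ≤ p.re + r * cos t) := by
      intro t h1 h2 h3
      have : cos t < 0 := Real.cos_neg_of_pi_div_two_lt_of_lt (by linarith) (by linarith)
      nlinarith
    have hcpos : ∀ t, 2 * π - 1 < t → t ≤ 2 * π → p.re ≤ p.re + r * cos t := by
      intro t h1 h2
      have : 0 < cos (t - 2 * π) := Real.cos_pos_of_mem_Ioo ⟨by linarith, by linarith⟩
      rw [Real.cos_sub_two_pi] at this
      nlinarith
    unfold cross
    simp only [him, hre, hup x hx, hup y hy, hlow x hx, hlow y hy]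
    rw [Real.dist_eq, abs_lt] at hxy
    have h11 : (1 : ZMod 2) + 1 = 0 := rfl
    by_cases hx2 : x = 2 * π <;> by_cases hy2 : y = 2 * π
    · simp [hx2, hy2, h11]
    · have : ¬ y ≤ π := by linarith
      have h5 : y ≤ 2 * π := hy.2
      simp [hx2, hy2, this, hcpos y (by linarith) h5]
    · have : ¬ x ≤ π := by linarith
      have h5 : x ≤ 2 * π := hx.2
      simp [hx2, hy2, this, hcpos x (by linarith) h5]
    · simp only [hx2, hy2, or_false, if_false, add_zero]
      rw [if_neg]
      rintro (⟨g1, g2, g3⟩ | ⟨g1, g2, g3⟩)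
      · exact hcneg x (not_le.1 g1) (by linarith) g3
      · exact hcneg y (not_le.1 g1) (by linarith) g3
  · have : (0 : ℝ) ≠ 2 * π := by positivity
    simp [this]

end Cross

/-! ### Chains of triples and their pairing with cochains near a hole -/

section Chains

variable {X : Type*}

/-- The value of the coboundary of a cochain on a 2-chain (a list of triples of points). -/
def pairing (Q : List (X × X × X)) (k : X → X → ZMod 2) : ZMod 2 :=
  (Q.map fun T => cobd k T.1 T.2.1 T.2.2).sum

/-- The triple `T` has a vertex in `A`. -/
def Meets (T : X × X × X) (A : Set X) : Prop := T.1 ∈ A ∨ T.2.1 ∈ A ∨ T.2.2 ∈ A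

open Classical in
/-- The part of `pairing` that comes from the triples with a vertex in `A`. -/
noncomputable def holePairing (Q : List (X × X × X)) (k : X → X → ZMod 2) (A : Set X) : ZMod 2 :=
  (Q.map fun T => if Meets T A then cobd k T.1 T.2.1 T.2.2 else 0).sum

/-- The boundary mod 2 of the chain `Q` has no edge inside `A`. -/
def NoBdry (Q : List (X × X × X)) (A : Set X) : Prop :=
  ∀ k, SymNorm k → (∀ a b, k a b ≠ 0 → a ∈ A ∧ b ∈ A) → pairing Q k = 0

lemma NoBdry.mono {Q : List (X × X × X)} {A B : Set X} (h : NoBdry Q B) (hAB : A ⊆ B) :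
    NoBdry Q A := fun k hk hs => h k hk fun a b hab => ⟨hAB (hs a b hab).1, hAB (hs a b hab).2⟩

lemma SymNorm.add {k l : X → X → ZMod 2} (hk : SymNorm k) (hl : SymNorm l) :
    SymNorm (fun a b => k a b + l a b) :=
  ⟨fun a b => by simp only [hk.symm a b, hl.symm a b], fun a => by
    simp only [hk.diag a, hl.diag a, add_zero]⟩

lemma SymNorm.comp {Y : Type*} {k : X → X → ZMod 2} (hk : SymNorm k) (q : Y → X) :
    SymNorm (fun a b => k (q a) (q b)) :=
  ⟨fun _ _ => hk.symm _ _, fun _ => hk.diag _⟩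

open Classical in
lemma SymNorm.ite {k : X → X → ZMod 2} (hk : SymNorm k) {P : X → X → Prop}
    (hP : ∀ a b, P a b ↔ P b a) : SymNorm (fun a b => if P a b then k a b else 0) :=
  ⟨fun a b => by simp only [hk.symm a b, hP a b], fun a => by
    simp only [hk.diag a, ite_self]⟩

lemma pairing_add (Q : List (X × X × X)) (k l : X → X → ZMod 2) :
    pairing Q (fun a b => k a b + l a b) = pairing Q k + pairing Q l := by
  unfold pairing
  rw [← List.sum_map_add]
  congr 1
  refine List.map_congr_left fun T _ => ?_
  simp only [cobd]; ring

lemma pairing_append (P Q : List (X × X × X)) (k : X → X → ZMod 2) :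
    pairing (P ++ Q) k = pairing P k + pairing Q k := by
  simp [pairing]

lemma holePairing_append (P Q : List (X × X × X)) (k : X → X → ZMod 2) (A : Set X) :
    holePairing (P ++ Q) k A = holePairing P k A + holePairing Q k A := by
  simp [holePairing]

/-- The image of a chain under a map on the vertices. -/
def pushChain {Y : Type*} (q : X → Y) (P : List (X × X × X)) : List (Y × Y × Y) :=
  P.map fun T => (q T.1, q T.2.1, q T.2.2)

lemma pairing_pushChain {Y : Type*} (q : X → Y) (P : List (X × X × X)) (k : Y → Y → ZMod 2) :
    pairing (pushChain q P) k = pairing P (fun a b => k (q a) (q b)) := by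
  simp [pairing, pushChain, cobd, Function.comp_def]

lemma holePairing_pushChain {Y : Type*} (q : X → Y) (P : List (X × X × X)) (k : Y → Y → ZMod 2)
    (A : Set Y) :
    holePairing (pushChain q P) k A = holePairing P (fun a b => k (q a) (q b)) (q ⁻¹' A) := by
  simp [holePairing, pushChain, cobd, Meets, Function.comp_def, mem_preimage]
  rfl

lemma pairing_congr {Q : List (X × X × X)} {k l : X → X → ZMod 2}
    (h : ∀ T ∈ Q, cobd k T.1 T.2.1 T.2.2 = cobd l T.1 T.2.1 T.2.2) : pairing Q k = pairing Q l := by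
  unfold pairing
  rw [List.map_congr_left h]

lemma list_sum_eq_zero {ι : Type*} {l : List ι} {f : ι → ZMod 2} (h : ∀ x ∈ l, f x = 0) :
    (l.map f).sum = 0 := by
  refine List.sum_eq_zero fun x hx => ?_
  obtain ⟨y, hy, rfl⟩ := List.mem_map.1 hx
  exact h y hy

/-- This allows the hole to be enlarged or shrunk across a region where the cochain is closed. -/
lemma holePairing_mono {Q : List (X × X × X)} {k : X → X → ZMod 2} {A B : Set X}
    (h : ∀ T ∈ Q, Meets T A → ¬ Meets T B → cobd k T.1 T.2.1 T.2.2 = 0)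
    (h' : ∀ T ∈ Q, Meets T B → ¬ Meets T A → cobd k T.1 T.2.1 T.2.2 = 0) :
    holePairing Q k A = holePairing Q k B := by
  classical
  unfold holePairing
  congr 1
  refine List.map_congr_left fun T hT => ?_
  by_cases hA : Meets T A <;> by_cases hB : Meets T B
  · simp only [hA, hB]
  · simp only [hA, hB, if_true, if_false, h T hT hA hB]
  · simp only [hA, hB, if_true, if_false, h' T hT hB hA]
  · simp only [hA, hB]

variable [PseudoMetricSpace X]

/-- The vertices of each triple of the chain have mutual distances less than `ε`. -/
def FineChain (Q : List (X × X × X)) (ε : ℝ) : Prop :=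
  ∀ T ∈ Q, dist T.1 T.2.1 < ε ∧ dist T.2.1 T.2.2 < ε ∧ dist T.1 T.2.2 < ε

lemma FineChain.mono {Q : List (X × X × X)} {ε δ : ℝ} (h : FineChain Q ε) (hδ : ε ≤ δ) :
    FineChain Q δ := fun T hT =>
  ⟨(h T hT).1.trans_le hδ, (h T hT).2.1.trans_le hδ, (h T hT).2.2.trans_le hδ⟩

lemma fineChain_append {P Q : List (X × X × X)} {ε : ℝ} (hP : FineChain P ε)
    (hQ : FineChain Q ε) : FineChain (P ++ Q) ε := fun T hT =>
  (List.mem_append.1 hT).elim (hP T) (hQ T)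

/-- The vertices of a fine triple that meets a set are close to the set. -/
lemma Meets.near {T : X × X × X} {A : Set X} {ε : ℝ} (h : Meets T A)
    (hT : dist T.1 T.2.1 < ε ∧ dist T.2.1 T.2.2 < ε ∧ dist T.1 T.2.2 < ε) :
    ∃ x ∈ A, dist T.1 x < ε ∧ dist T.2.1 x < ε ∧ dist T.2.2 x < ε := by
  have hε : 0 < ε := dist_nonneg.trans_lt hT.1
  obtain ⟨h1, h2, h3⟩ := hT
  rcases h with h | h | h
  · exact ⟨_, h, by simpa, by rwa [dist_comm], by rwa [dist_comm]⟩
  · exact ⟨_, h, h1, by simpa, by rwa [dist_comm]⟩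
  · exact ⟨_, h, h3, h2, by simpa⟩

/-- The contribution of a hole is invariant under changes of the cochain by a coboundary around
the hole. -/
theorem holePairing_eq {Q : List (X × X × X)} {k l : X → X → ZMod 2} {A B : Set X} {ε : ℝ}
    (hQ : FineChain Q ε) (hN : NoBdry Q B) (hk : SymNorm k) (hl : SymNorm l) (b : X → ZMod 2)
    (hb : ∀ x ∈ B, ∀ y ∈ B, x ∉ A → y ∉ A → dist x y < ε → k x y + l x y = b x + b y)
    (hAB : ∀ x ∈ A, ∀ y, dist x y < ε → y ∈ B) : holePairing Q k A = holePairing Q l A := by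
  classical
  -- `ν` is k + l corrected by the coboundary of `b` and cut down to short edges that touch A. It is
  -- supported in B, so it pairs to 0 with the chain. On a triple that meets A its coboundary is
  -- that of k + l, because on an edge of the triple away from A the correction already cancels k +
  -- l; on the other triples it is 0.
  set ν : X → X → ZMod 2 := fun x y =>
    if (x ∈ A ∨ y ∈ A) ∧ dist x y < ε then k x y + l x y + (b x + b y) else 0 with hν
  have hνs : SymNorm ν := by
    have := ((hk.add hl).add ⟨fun x y => add_comm (b x) (b y), fun x => zmod_two_add_self (b x)⟩).ite
      (P := fun x y => (x ∈ A ∨ y ∈ A) ∧ dist x y < ε) (fun x y => by rw [or_comm, dist_comm])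
    convert this
  have h0 := hN ν hνs (fun x y hxy => by
    rw [hν] at hxy
    simp only [ne_eq, ite_eq_right_iff, Classical.not_imp] at hxy
    obtain ⟨⟨h | h, hd⟩, -⟩ := hxy
    · exact ⟨hAB x h x (by simpa using dist_nonneg.trans_lt hd), hAB x h y hd⟩
    · exact ⟨hAB y h x (by rwa [dist_comm]), hAB y h y (by simpa using dist_nonneg.trans_lt hd)⟩)
  have key : pairing Q ν = holePairing Q k A + holePairing Q l A := by
    unfold pairing holePairing
    rw [← List.sum_map_add]
    congr 1
    refine List.map_congr_left fun T hT => ?_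
    obtain ⟨d1, d2, d3⟩ := hQ T hT
    by_cases hm : Meets T A
    · simp only [hm, if_true]
      obtain ⟨x, hx, e1, e2, e3⟩ := hm.near (hQ T hT)
      rw [dist_comm] at e1 e2 e3
      have m1 := hAB x hx _ e1
      have m2 := hAB x hx _ e2
      have m3 := hAB x hx _ e3
      have hpair : ∀ y ∈ B, ∀ z ∈ B, dist y z < ε → ν y z = k y z + l y z + (b y + b z) := by
        intro y hy z hz hyz
        by_cases h : y ∈ A ∨ z ∈ A
        · simp only [hν, h, hyz, true_and, if_true]
        · simp only [hν, h, false_and, if_false]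
          push Not at h
          rw [hb y hy z hz h.1 h.2 hyz, zmod_two_add_self]
      unfold cobd
      rw [hpair _ m1 _ m2 d1, hpair _ m2 _ m3 d2, hpair _ m1 _ m3 d3]
      grind
    · simp only [hm, if_false, add_zero]
      unfold Meets at hm
      push Not at hm
      simp only [cobd, hν, hm.1, hm.2.1, hm.2.2, or_self, false_and, if_false, add_zero]
  rw [h0] at key
  exact zmod_two_eq_of_add_eq_zero key.symm

end Chains

/-! ### Crossing cochains in charts and their comparison -/

section Charts

variable {X : Type*} [MetricSpace X]

/-- The inverse of a parametrization `f : ℂ → X` of an open set of `X`. -/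
noncomputable def coord (f : ℂ → X) : X → ℂ := Function.invFun f

lemma coord_apply {f : ℂ → X} (hf : IsOpenEmbedding f) (z : ℂ) : coord f (f z) = z :=
  Function.leftInverse_invFun hf.injective z

lemma exists_modulus {f : ℂ → X} (hf : IsOpenEmbedding f) (R : ℝ) {η : ℝ} (hη : 0 < η) :
    ∃ δ > 0, ∀ z ∈ closedBall (0 : ℂ) R, ∀ w ∈ closedBall (0 : ℂ) R, dist z w < δ →
      dist (f z) (f w) < η :=
  Metric.uniformContinuousOn_iff.1 ((isCompact_closedBall (0 : ℂ) R).uniformContinuousOn_of_continuous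
    hf.continuous.continuousOn) η hη

/-- A Lebesgue number for the images of small discs makes the inverse chart uniformly continuous
near a compact disc, and guarantees that nearby points do lie in the image of the chart. -/
lemma exists_modulus_inv {f : ℂ → X} (hf : IsOpenEmbedding f) (R : ℝ) {η : ℝ} (hη : 0 < η) :
    ∃ δ > 0, ∀ z ∈ closedBall (0 : ℂ) R, ∀ y, dist y (f z) < δ → ∃ w, f w = y ∧ dist w z < η := by
  obtain ⟨δ, hδ, h⟩ := lebesgue_number_lemma_of_metric
    ((isCompact_closedBall (0 : ℂ) R).image hf.continuous)
    (c := fun z : ℂ => f '' ball z (η / 2)) (fun z => hf.isOpenMap _ isOpen_ball) (by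
      rintro _ ⟨z, -, rfl⟩
      exact mem_iUnion.2 ⟨z, z, mem_ball_self (half_pos hη), rfl⟩)
  refine ⟨δ, hδ, fun z hz y hy => ?_⟩
  obtain ⟨z₀, h0⟩ := h (f z) ⟨z, hz, rfl⟩
  obtain ⟨z', hz', e⟩ := h0 (mem_ball_self hδ)
  obtain rfl := hf.injective e
  obtain ⟨w, hw, rfl⟩ := h0 hy
  exact ⟨w, rfl, by
    have := dist_triangle_right w z' z₀
    have h1 := mem_ball.1 hz'
    have h2 := mem_ball.1 hw
    linarith⟩

/-- The crossing cochain of the point `p` in the chart `f`. -/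
noncomputable def chi (f : ℂ → X) (p : ℂ) (x y : X) : ZMod 2 := cross p (coord f x) (coord f y)

omit [MetricSpace X] in
lemma symmNorm_chi (f : ℂ → X) (p : ℂ) : SymNorm (chi f p) := (symmNorm_cross p).comp _

lemma mem_closedBall_add_one {R : ℝ} {p z : ℂ} (hp : p ∈ closedBall (0 : ℂ) R) (hz : dist z p ≤ 1) :
    z ∈ closedBall (0 : ℂ) (R + 1) := by
  rw [mem_closedBall] at *
  linarith [dist_triangle z p 0]

/-- The crossing cochains are cocycles away from their poles. -/
lemma isCocycleOn_chi {f : ℂ → X} (hf : IsOpenEmbedding f) (R : ℝ) :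
    ∃ r₀ > 0, ∀ r > 0, ∃ ε > 0, ∀ p ∈ closedBall (0 : ℂ) R,
      IsCocycleOn (chi f p) {x | dist x (f p) < r₀ ∧ r ≤ dist x (f p)} ε ∧
      ∀ x y, dist x (f p) < r₀ → r ≤ dist x (f p) → dist y (f p) < r₀ → r ≤ dist y (f p) →
        dist x y < ε → crossUp p (coord f x) (coord f y) = chi f p x y := by
  obtain ⟨r₀, hr₀, h0⟩ := exists_modulus_inv hf R one_pos
  refine ⟨r₀, hr₀, fun r hr => ?_⟩
  obtain ⟨ρ, hρ, h1⟩ := exists_modulus hf (R + 1) hr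
  obtain ⟨ε, hε, h2⟩ := exists_modulus_inv hf (R + 1) (show 0 < ρ / 4 by positivity)
  refine ⟨ε, hε, fun p hp => ?_⟩
  have hco : ∀ x, dist x (f p) < r₀ → r ≤ dist x (f p) →
      ∃ z, f z = x ∧ ρ ≤ dist z p ∧ z ∈ closedBall (0 : ℂ) (R + 1) := by
    intro x hx hx'
    obtain ⟨z, rfl, hz⟩ := h0 p hp x hx
    have hzR := mem_closedBall_add_one hp hz.le
    refine ⟨z, rfl, ?_, hzR⟩
    by_contra! hc
    exact absurd (h1 z hzR p (mem_closedBall_add_one hp (by simp)) hc) (not_lt.2 hx')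
  have hcd : ∀ z w, w ∈ closedBall (0 : ℂ) (R + 1) → dist (f z) (f w) < ε → dist z w < ρ / 4 := by
    intro z w hw hzw
    obtain ⟨z', e, hz'⟩ := h2 w hw (f z) hzw
    rwa [hf.injective e] at hz'
  refine ⟨?_, ?_⟩
  · refine (isCocycleOn_cross p (ρ / 2)).comp (coord f) (fun x hx => ?_) ?_
    · obtain ⟨z, rfl, hz, -⟩ := hco x hx.1 hx.2
      rw [coord_apply hf]
      simp only [mem_ofPred_eq]; linarith
    · intro x hx y hy hxy
      obtain ⟨z, rfl, -, hz⟩ := hco x hx.1 hx.2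
      obtain ⟨w, rfl, -, hw⟩ := hco y hy.1 hy.2
      rw [coord_apply hf, coord_apply hf]
      linarith [hcd z w hw hxy]
  · intro x y hx hx' hy hy' hxy
    obtain ⟨z, rfl, hz', hz⟩ := hco x hx hx'
    obtain ⟨w, rfl, hw', hw⟩ := hco y hy hy'
    rw [chi, coord_apply hf, coord_apply hf]
    exact crossUp_eq_cross (r := ρ / 2) (by linarith) (by linarith) (by linarith [hcd z w hw hxy])

omit [MetricSpace X] in
lemma HasInt.add {k l : X → X → ZMod 2} {A : ℝ → X} {s t : ℝ} {u v : ZMod 2}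
    (h : HasInt k A s t u) (h' : HasInt l A s t v) :
    HasInt (fun a b => k a b + l a b) A s t (u + v) := by
  obtain ⟨b, ⟨δ, hδ, hb⟩, rfl⟩ := h
  obtain ⟨b', ⟨δ', hδ', hb'⟩, rfl⟩ := h'
  refine ⟨fun x => b x + b' x, ⟨min δ δ', lt_min hδ hδ', fun x hx y hy hxy => ?_⟩, by ring⟩
  simp only
  rw [hb x hx y hy (hxy.trans_le (min_le_left _ _)),
    hb' x hx y hy (hxy.trans_le (min_le_right _ _))]
  ring

open Real in
/-- The crossing cochains of nearby points in two charts are cohomologous around these points. -/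
theorem exists_potential_chi_add_chi {f g : ℂ → X} (hf : IsOpenEmbedding f)
    (hg : IsOpenEmbedding g) (R : ℝ) :
    ∃ r₀ > 0, ∀ r > 0, ∃ ε > 0, ∀ p ∈ closedBall (0 : ℂ) R, ∀ q ∈ closedBall (0 : ℂ) R,
      dist (f p) (g q) < ε → ∃ b : X → ZMod 2, ∀ x y, dist x (f p) < r₀ → r ≤ dist x (f p) →
        dist y (f p) < r₀ → r ≤ dist y (f p) → dist x y < ε →
        chi f p x y + chi g q x y = b x + b y := by
  obtain ⟨lg, hlg, hlg'⟩ := exists_modulus_inv hg R one_pos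
  obtain ⟨ρ₀, hρ₀, hρ₀'⟩ := exists_modulus hf (R + 1) (half_pos hlg)
  obtain ⟨ρ₂, hρ₂, hρ₂1, hρ₂0⟩ : ∃ ρ₂ > 0, ρ₂ ≤ 1 ∧ ρ₂ < ρ₀ :=
    ⟨min 1 (ρ₀ / 2), by positivity, min_le_left _ _, (min_le_right _ _).trans_lt (by linarith)⟩
  obtain ⟨r₀, hr₀, hr₀'⟩ := exists_modulus_inv hf R hρ₂
  obtain ⟨σ₀, hσ₀, hσ₀'⟩ := exists_modulus hg (R + 1) (half_pos hr₀)
  obtain ⟨σ, hσ, hσ1, hσ0⟩ : ∃ σ > 0, σ ≤ 1 ∧ σ < σ₀ :=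
    ⟨min 1 (σ₀ / 2), by positivity, min_le_left _ _, (min_le_right _ _).trans_lt (by linarith)⟩
  obtain ⟨l₁, hl₁, hl₁'⟩ := exists_modulus_inv hg R hσ
  refine ⟨r₀, hr₀, fun r hr => ?_⟩
  -- The inner radius is so small that the `f`-disc about p goes into the ball of radius r about f p
  -- and into the `g`-disc of radius σ about q. The `g`-circle of radius σ then lies in the image of
  -- the annulus.
  obtain ⟨ρ₃, hρ₃, hρ₃'⟩ := exists_modulus hf (R + 1) (lt_min hr (half_pos hl₁))
  obtain ⟨ρ₁, hρ₁, hρ₁2, hρ₁3⟩ : ∃ ρ₁ > 0, ρ₁ ≤ ρ₂ ∧ ρ₁ ≤ ρ₃ :=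
    ⟨min ρ₂ ρ₃, by positivity, min_le_left _ _, min_le_right _ _⟩
  obtain ⟨l₃, hl₃, hl₃'⟩ := exists_modulus_inv hf R hρ₁
  obtain ⟨τ, hτ, hτ'⟩ := exists_modulus hg (R + 1) (half_pos hl₃)
  obtain ⟨δg, hδg, hδg'⟩ := exists_modulus_inv hg (R + 1) (show 0 < τ / 4 by positivity)
  obtain ⟨δ₅, hδ₅, hδ₅'⟩ := exists_modulus hf (R + 1) hδg
  have hδ : 0 < min (ρ₁ / 4) δ₅ := by positivity
  obtain ⟨δ', hδ', hann⟩ := exists_potential_annulus (R := ρ₂) hρ₁ hδ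
  obtain ⟨δ₆, hδ₆, hδ₆'⟩ := exists_modulus_inv hf (R + 1) hδ'
  obtain ⟨δ₇, hδ₇, hδ₇'⟩ := exists_modulus hg (R + 1) hδ₆
  refine ⟨min (min (lg / 2) (r₀ / 2)) (min (l₁ / 2) (min (l₃ / 2) δ₆)), by positivity,
    fun p hp q hq hpq => ?_⟩
  simp only [lt_min_iff] at hpq
  obtain ⟨⟨hpq1, hpq2⟩, hpq3, hpq4, -⟩ := hpq
  have hpR := mem_closedBall_add_one hp (z := p) (by simp)
  have hqR := mem_closedBall_add_one hq (z := q) (by simp)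
  have hannR : ∀ z, dist z p ≤ ρ₂ → z ∈ closedBall (0 : ℂ) (R + 1) := fun z hz =>
    mem_closedBall_add_one hp (hz.trans hρ₂1)
  -- coordinates in the second chart of points of the annulus
  have hcg : ∀ z ∈ annulus p ρ₁ ρ₂, ∃ w ∈ closedBall (0 : ℂ) (R + 1), g w = f z ∧ τ ≤ dist w q := by
    intro z hz
    have h1 : dist (f z) (f p) < lg / 2 := hρ₀' z (hannR z hz.2) p hpR (hz.2.trans_lt hρ₂0)
    obtain ⟨w, hw, hwq⟩ := hlg' q hq (f z) (by linarith [dist_triangle (f z) (f p) (g q)])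
    have hwR := mem_closedBall_add_one hq hwq.le
    refine ⟨w, hwR, hw, ?_⟩
    by_contra! hc
    have h2 := hτ' w hwR q hqR hc
    rw [hw] at h2
    have h3 : dist (f z) (f p) < l₃ := by
      have := dist_triangle_right (f z) (f p) (g q); linarith
    obtain ⟨z', e, hz'⟩ := hl₃' p hp (f z) h3
    rw [hf.injective e] at hz'
    exact absurd hz.1 (not_le.2 hz')
  have hcoc1 : IsCocycleOn (cross p) (annulus p ρ₁ ρ₂) (min (ρ₁ / 4) δ₅) := by
    refine (isCocycleOn_cross p (ρ₁ / 2)).mono (fun z hz => ?_) ?_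
    · have := hz.1; simp only [mem_ofPred_eq]; linarith
    · exact (min_le_left _ _).trans (by linarith)
  set k₂ : ℂ → ℂ → ZMod 2 := fun z z' => cross q (coord g (f z)) (coord g (f z')) with hk₂
  have hcoc2 : IsCocycleOn k₂ (annulus p ρ₁ ρ₂) (min (ρ₁ / 4) δ₅) := by
    refine (isCocycleOn_cross q (τ / 2)).comp (fun z => coord g (f z)) (fun z hz => ?_) ?_
    · obtain ⟨w, -, hw, hw'⟩ := hcg z hz
      simp only [← hw, coord_apply hg, mem_ofPred_eq]; linarith
    · intro z hz z' hz' hzz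
      obtain ⟨w, hwR, hw, -⟩ := hcg z hz
      obtain ⟨w', hwR', hw', -⟩ := hcg z' hz'
      simp only [← hw, ← hw', coord_apply hg]
      have h1 := hδ₅' z (hannR z hz.2) z' (hannR z' hz'.2) (hzz.trans_le (min_le_right _ _))
      rw [← hw, ← hw'] at h1
      obtain ⟨w₂, e, hw₂⟩ := hδg' w' hwR' (g w) h1
      rw [hg.injective e] at hw₂
      linarith
  have hρ₂mem : ρ₂ ∈ Icc ρ₁ ρ₂ := ⟨hρ₁2, le_rfl⟩
  have hint1 := hasInt_cross_circleMap p hρ₂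
  obtain ⟨v, hv⟩ := exists_hasInt hδ hcoc2 (A := circleMap p ρ₂) (s := 0) (t := 2 * π)
    (continuous_circleMap p ρ₂).continuousOn (fun t _ => circleMap_mem_annulus hρ₁.le hρ₂mem)
  -- If the crossing cochain of q had integral 0 on the outer circle about p, it would be a
  -- coboundary on the annulus, hence have integral 0 on the `g`-circle about q; but there its
  -- integral is 1.
  have hv1 : v = 1 := by
    by_contra hv0
    obtain rfl : v = 0 := (zmod_two_cases v).resolve_right hv0
    obtain ⟨b, hb⟩ := hann p k₂ hcoc2 ⟨ρ₂, hρ₂mem, hv⟩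
    -- the circle of radius `σ` in the second chart lies in the annulus
    have hcir : ∀ t, ∃ z ∈ annulus p ρ₁ ρ₂, f z = g (circleMap q σ t) := by
      intro t
      have hd : dist (circleMap q σ t) q = σ := by simp [dist_eq_norm, abs_of_pos hσ]
      have hR := mem_closedBall_add_one hq (hd.le.trans hσ1)
      have h1 := hσ₀' _ hR q hqR (by rw [hd]; exact hσ0)
      obtain ⟨z, hz, hz'⟩ := hr₀' p hp (g (circleMap q σ t)) (by
        linarith [dist_triangle_right (g (circleMap q σ t)) (f p) (g q)])
      refine ⟨z, ⟨?_, hz'.le⟩, hz⟩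
      by_contra! hc
      have h2 := hρ₃' z (hannR z hz'.le) p hpR (hc.trans_le hρ₁3)
      obtain ⟨w, hw, hw'⟩ := hl₁' q hq (f z) (by
        linarith [dist_triangle (f z) (f p) (g q), (lt_min_iff.1 h2).2])
      rw [hz] at hw
      rw [hg.injective hw, hd] at hw'
      exact lt_irrefl _ hw'
    choose z hz hzg using hcir
    have h1 := hasInt_cross_circleMap q hσ
    have h2 : HasInt (cross q) (circleMap q σ) 0 (2 * π) (b (z 0) + b (z (2 * π))) := by
      refine ⟨fun t => b (z t), ⟨δ₇, hδ₇, fun x _ y _ hxy => ?_⟩, rfl⟩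
      have hR : ∀ t, circleMap q σ t ∈ closedBall (0 : ℂ) (R + 1) := fun t =>
        mem_closedBall_add_one hq (by simpa [dist_eq_norm, abs_of_pos hσ] using hσ1)
      have hd : dist (circleMap q σ x) (circleMap q σ y) < δ₇ := by
        have := dist_circleMap_le q σ σ x y
        rw [sub_self, abs_zero, zero_add, abs_of_pos hσ] at this
        calc _ ≤ σ * |x - y| := this
          _ ≤ 1 * |x - y| := by gcongr
          _ < δ₇ := by rwa [one_mul, ← Real.dist_eq]
      have h3 := hδ₇' _ (hR x) _ (hR y) hd
      rw [← hzg, ← hzg] at h3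
      obtain ⟨z', e, hz'⟩ := hδ₆' (z y) (hannR _ (hz y).2) (f (z x)) h3
      rw [hf.injective e] at hz'
      have := hb (z x) (hz x) (z y) (hz y) hz'
      rw [← this]
      simp only [hk₂, hzg, coord_apply hg]
    have h3 := h1.unique (by positivity) h2
    have h4 : z (2 * π) = z 0 := hf.injective (by
      rw [hzg, hzg]; congr 1; simpa using (periodic_circleMap q σ) 0)
    rw [h4, zmod_two_add_self] at h3
    exact one_ne_zero h3
  subst hv1
  -- Both cocycles have integral 1 and 1 + 1 = 0, so their sum has a potential.
  obtain ⟨b, hb⟩ := hann p _ (hcoc1.add hcoc2) ⟨ρ₂, hρ₂mem, hint1.add hv⟩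
  refine ⟨fun x => b (coord f x), fun x y hx hx' hy hy' hxy => ?_⟩
  have hco : ∀ x, dist x (f p) < r₀ → r ≤ dist x (f p) → ∃ z ∈ annulus p ρ₁ ρ₂, f z = x := by
    intro x hx hx'
    obtain ⟨z, rfl, hz⟩ := hr₀' p hp x hx
    refine ⟨z, ⟨?_, hz.le⟩, rfl⟩
    by_contra! hc
    have := hρ₃' z (hannR z hz.le) p hpR (hc.trans_le hρ₁3)
    linarith [(lt_min_iff.1 this).1]
  obtain ⟨z, hz, rfl⟩ := hco x hx hx'
  obtain ⟨w, hw, rfl⟩ := hco y hy hy'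
  obtain ⟨z', e, hz'⟩ := hδ₆' w (hannR _ hw.2) (f z) (hxy.trans_le
    ((min_le_right _ _).trans ((min_le_right _ _).trans (min_le_right _ _))))
  rw [hf.injective e] at hz'
  have := hb z hz w hw hz'
  simp only [coord_apply hf, chi, hk₂] at this ⊢
  exact this

end Charts

/-! ### Local degree of a chain -/

section Degree

variable {X : Type*} [MetricSpace X]

/-- The local degree mod 2 of the chain `Q` at the point `f p`, measured in the chart `f`. -/
noncomputable def deg (f : ℂ → X) (p : ℂ) (r : ℝ) (Q : List (X × X × X)) : ZMod 2 :=
  holePairing Q (chi f p) (ball (f p) r)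

/-- The local degree is locally constant and does not depend on the chart. -/
theorem deg_eq_deg {f g : ℂ → X} (hf : IsOpenEmbedding f) (hg : IsOpenEmbedding g) (R : ℝ) :
    ∃ r₀ > 0, ∀ r > 0, r < r₀ → ∃ ε > 0, ∀ p ∈ closedBall (0 : ℂ) R, ∀ q ∈ closedBall (0 : ℂ) R,
      dist (f p) (g q) < ε → ∀ Q, FineChain Q ε → NoBdry Q (ball (f p) r) →
        deg f p r Q = deg g q r Q := by
  obtain ⟨r₁, hr₁, h1⟩ := exists_potential_chi_add_chi hf hg R
  obtain ⟨r₂, hr₂, h2⟩ := isCocycleOn_chi hf R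
  obtain ⟨r₃, hr₃, h3⟩ := isCocycleOn_chi hg R
  refine ⟨min r₁ (min r₂ r₃) / 2, by positivity, fun r hr hr0 => ?_⟩
  have hm1 : min r₁ (min r₂ r₃) ≤ r₁ := min_le_left _ _
  have hm2 : min r₁ (min r₂ r₃) ≤ r₂ := (min_le_right _ _).trans (min_le_left _ _)
  have hm3 : min r₁ (min r₂ r₃) ≤ r₃ := (min_le_right _ _).trans (min_le_right _ _)
  obtain ⟨ε₁, hε₁, h1⟩ := h1 (r / 2) (by positivity)
  obtain ⟨ε₂, hε₂, h2⟩ := h2 (r / 2) (by positivity)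
  obtain ⟨ε₃, hε₃, h3⟩ := h3 (r / 4) (by positivity)
  refine ⟨min (min ε₁ ε₂) (min ε₃ (r / 8)), by positivity, fun p hp q hq hpq Q hQ hN => ?_⟩
  set ε := min (min ε₁ ε₂) (min ε₃ (r / 8))
  have he1 : ε ≤ ε₁ := (min_le_left _ _).trans (min_le_left _ _)
  have he2 : ε ≤ ε₂ := (min_le_left _ _).trans (min_le_right _ _)
  have he3 : ε ≤ ε₃ := (min_le_right _ _).trans (min_le_left _ _)
  have he4 : ε ≤ r / 8 := (min_le_right _ _).trans (min_le_right _ _)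
  obtain ⟨b, hb⟩ := h1 p hp q hq (hpq.trans_le he1)
  unfold deg
  -- The hole is first halved, to leave room around it for the change of cochain inside the ball
  -- where the chain has no boundary, and is then enlarged to the ball about the other centre.
  calc holePairing Q (chi f p) (ball (f p) r)
      = holePairing Q (chi f p) (ball (f p) (r / 2)) := by
        refine holePairing_mono (fun T hT hm hn => ?_) (fun T hT hm hn => ?_)
        · obtain ⟨x, hx, e1, e2, e3⟩ := hm.near (hQ T hT)
          simp only [Meets, mem_ball, not_or, not_lt] at hn
          rw [mem_ball] at hx
          obtain ⟨d1, d2, d3⟩ := hQ T hT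
          exact (h2 p hp).1 _ ⟨by linarith [dist_triangle T.1 x (f p)], hn.1⟩ _
            ⟨by linarith [dist_triangle T.2.1 x (f p)], hn.2.1⟩ _
            ⟨by linarith [dist_triangle T.2.2 x (f p)], hn.2.2⟩ (by linarith) (by linarith)
            (by linarith)
        · refine absurd ?_ hn
          have : ball (f p) (r / 2) ⊆ ball (f p) r := ball_subset_ball (by linarith)
          exact hm.imp (fun h => this h) (fun h => h.imp (fun h => this h) (fun h => this h))
    _ = holePairing Q (chi g q) (ball (f p) (r / 2)) := by
        refine holePairing_eq hQ hN (symmNorm_chi f p) (symmNorm_chi g q) b ?_ ?_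
        · intro x hx y hy hx' hy' hxy
          rw [mem_ball] at *
          exact hb x y (by linarith) (not_lt.1 hx') (by linarith) (not_lt.1 hy') (by linarith)
        · intro x hx y hxy
          rw [mem_ball] at *
          rw [dist_comm] at hxy
          linarith [dist_triangle y x (f p)]
    _ = holePairing Q (chi g q) (ball (g q) r) := by
        refine holePairing_mono (fun T hT hm hn => ?_) (fun T hT hm hn => ?_)
        · obtain ⟨x, hx, e1, e2, e3⟩ := hm.near (hQ T hT)
          refine absurd (Or.inl ?_) hn
          rw [mem_ball] at *
          linarith [dist_triangle T.1 x (f p), dist_triangle T.1 (f p) (g q)]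
        · obtain ⟨x, hx, e1, e2, e3⟩ := hm.near (hQ T hT)
          simp only [Meets, mem_ball, not_or, not_lt] at hn
          rw [mem_ball] at hx
          obtain ⟨d1, d2, d3⟩ := hQ T hT
          have key : ∀ y, dist y x < ε → r / 2 ≤ dist y (f p) →
              y ∈ {x | dist x (g q) < r₃ ∧ r / 4 ≤ dist x (g q)} := fun y hy hy' =>
            ⟨by linarith [dist_triangle y x (g q)],
              by linarith [dist_triangle_right y (f p) (g q)]⟩
          exact (h3 q hq).1 _ (key _ e1 hn.1) _ (key _ e2 hn.2.1) _ (key _ e3 hn.2.2)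
            (by linarith) (by linarith) (by linarith)

end Degree

/-! ### The brick tiling and its triangulated nerve -/

section Lattice

/-- The label of the brick that contains `y`, in the tiling of the plane by unit squares in rows,
each row being shifted by `1 / 2` from the row below. -/
noncomputable def brick (y : ℂ) : ℤ × ℤ := (⌊y.re - ⌊y.im⌋ / 2⌋, ⌊y.im⌋)

/-- The centre of a brick. -/
noncomputable def brickCenter (v : ℤ × ℤ) : ℂ := ⟨v.1 + v.2 / 2 + 1 / 2, v.2 + 1 / 2⟩

/-- The bricks `v` and `w` are equal or adjacent. -/
def BrickAdj (v w : ℤ × ℤ) : Prop :=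
  -1 ≤ w.1 - v.1 ∧ w.1 - v.1 ≤ 1 ∧ -1 ≤ w.2 - v.2 ∧ w.2 - v.2 ≤ 1 ∧
    -1 ≤ w.1 - v.1 + (w.2 - v.2) ∧ w.1 - v.1 + (w.2 - v.2) ≤ 1

/-- The triples of pairwise adjacent bricks. -/
def brickTriangle : ℤ × ℤ × Bool → (ℤ × ℤ) × (ℤ × ℤ) × (ℤ × ℤ)
  | (i, j, false) => ((i, j), (i + 1, j), (i, j + 1))
  | (i, j, true) => ((i + 1, j), (i, j + 1), (i + 1, j + 1))

/-- The common point of three pairwise adjacent bricks. -/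
noncomputable def triplePoint : ℤ × ℤ × Bool → ℂ
  | (i, j, false) => ⟨i + 1 + j / 2, j + 1⟩
  | (i, j, true) => ⟨i + 1 + (j + 1) / 2, j + 1⟩

/-- `u`, `v`, `w` are the vertices of the triangle `t` in some order. -/
def IsTriangle (t : ℤ × ℤ × Bool) (u v w : ℤ × ℤ) : Prop :=
  let T := brickTriangle t
  (u = T.1 ∧ v = T.2.1 ∧ w = T.2.2) ∨ (u = T.1 ∧ w = T.2.1 ∧ v = T.2.2) ∨
  (v = T.1 ∧ u = T.2.1 ∧ w = T.2.2) ∨ (v = T.1 ∧ w = T.2.1 ∧ u = T.2.2) ∨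
  (w = T.1 ∧ u = T.2.1 ∧ v = T.2.2) ∨ (w = T.1 ∧ v = T.2.1 ∧ u = T.2.2)

open Classical in
/-- The indicator of the triangle `t`. -/
noncomputable def triangleInd (t : ℤ × ℤ × Bool) (u v w : ℤ × ℤ) : ZMod 2 :=
  if IsTriangle t u v w then 1 else 0

/-- The combinatorial version of `cross` and `crossUp` at the triple point of `t`. -/
def latticeCross : ℤ × ℤ × Bool → ℤ × ℤ → ℤ × ℤ → ZMod 2
  | (i, j, false), v, w =>
    if (v.2 = j ∧ w.2 = j + 1 ∧ i + 1 ≤ v.1) ∨ (w.2 = j ∧ v.2 = j + 1 ∧ i + 1 ≤ w.1) then 1 else 0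
  | (i, j, true), v, w =>
    if (v.2 = j ∧ w.2 = j + 1 ∧ i + 1 ≤ w.1) ∨ (w.2 = j ∧ v.2 = j + 1 ∧ i + 1 ≤ v.1) then 1 else 0

lemma IsTriangle.unique {t t' : ℤ × ℤ × Bool} {u v w : ℤ × ℤ} (h : IsTriangle t u v w)
    (h' : IsTriangle t' u v w) : t = t' := by
  obtain ⟨i, j, s⟩ := t
  obtain ⟨i', j', s'⟩ := t'
  obtain ⟨u1, u2⟩ := u
  obtain ⟨v1, v2⟩ := v
  obtain ⟨w1, w2⟩ := w
  cases s <;> cases s' <;>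
  simp only [IsTriangle, brickTriangle, Prod.mk.injEq, Bool.false_eq_true, Bool.true_eq_false,
    and_true, and_false] at * <;> omega

lemma BrickAdj.cases {u v : ℤ × ℤ} (h : BrickAdj u v) (hne : u ≠ v) :
    v = (u.1 + 1, u.2) ∨ v = (u.1, u.2 + 1) ∨ v = (u.1 - 1, u.2 + 1) ∨ v = (u.1 - 1, u.2) ∨
      v = (u.1, u.2 - 1) ∨ v = (u.1 + 1, u.2 - 1) := by
  obtain ⟨u1, u2⟩ := u
  obtain ⟨v1, v2⟩ := v
  simp only [BrickAdj, ne_eq, Prod.mk.injEq] at *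
  have h1 : v1 = u1 - 1 ∨ v1 = u1 ∨ v1 = u1 + 1 := by omega
  have h2 : v2 = u2 - 1 ∨ v2 = u2 ∨ v2 = u2 + 1 := by omega
  rcases h1 with rfl | rfl | rfl <;> rcases h2 with rfl | rfl | rfl <;> omega

lemma exists_isTriangle {u v w : ℤ × ℤ} (h1 : BrickAdj u v) (h2 : BrickAdj v w)
    (h3 : BrickAdj u w) (h4 : u ≠ v) (h5 : v ≠ w) (h6 : u ≠ w) : ∃ t, IsTriangle t u v w := by
  obtain ⟨u1, u2⟩ := u
  rcases h1.cases h4 with rfl | rfl | rfl | rfl | rfl | rfl <;>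
  rcases h3.cases h6 with rfl | rfl | rfl | rfl | rfl | rfl <;>
  first
  | exact absurd rfl h5
  | (exfalso; simp only [BrickAdj] at h2; omega)
  | (refine ⟨(u1, u2, false), ?_⟩; simp [IsTriangle, brickTriangle]; done)
  | (refine ⟨(u1 - 1, u2, false), ?_⟩; simp [IsTriangle, brickTriangle]; done)
  | (refine ⟨(u1, u2 - 1, false), ?_⟩; simp [IsTriangle, brickTriangle]; done)
  | (refine ⟨(u1 - 1, u2 - 1, true), ?_⟩; simp [IsTriangle, brickTriangle]; done)
  | (refine ⟨(u1 - 1, u2, true), ?_⟩; simp [IsTriangle, brickTriangle]; done)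
  | (refine ⟨(u1, u2 - 1, true), ?_⟩; simp [IsTriangle, brickTriangle])

lemma IsTriangle.cobd_eq {k : ℤ × ℤ → ℤ × ℤ → ZMod 2} (hk : SymNorm k) {t : ℤ × ℤ × Bool}
    {u v w : ℤ × ℤ} (h : IsTriangle t u v w) :
    cobd k u v w = cobd k (brickTriangle t).1 (brickTriangle t).2.1 (brickTriangle t).2.2 := by
  have := hk.symm
  unfold cobd
  rcases h with ⟨rfl, rfl, rfl⟩ | ⟨rfl, rfl, rfl⟩ | ⟨rfl, rfl, rfl⟩ | ⟨rfl, rfl, rfl⟩ |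
    ⟨rfl, rfl, rfl⟩ | ⟨rfl, rfl, rfl⟩ <;> grind

lemma symmNorm_latticeCross (t : ℤ × ℤ × Bool) : SymNorm (latticeCross t) := by
  obtain ⟨i, j, s⟩ := t
  constructor
  · intro v w
    cases s <;> simp only [latticeCross] <;> congr 1 <;> exact propext or_comm
  · intro v
    cases s <;> simp only [latticeCross] <;> rw [if_neg] <;> omega

open Classical in
lemma latticeCross_false (i j a b c d : ℤ) : latticeCross (i, j, false) (a, b) (c, d) =
    if (b = j ∧ d = j + 1 ∧ i + 1 ≤ a) ∨ (d = j ∧ b = j + 1 ∧ i + 1 ≤ c) then 1 else 0 := by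
  simp only [latticeCross]

open Classical in
lemma latticeCross_true (i j a b c d : ℤ) : latticeCross (i, j, true) (a, b) (c, d) =
    if (b = j ∧ d = j + 1 ∧ i + 1 ≤ c) ∨ (d = j ∧ b = j + 1 ∧ i + 1 ≤ a) then 1 else 0 := by
  simp only [latticeCross]

/-- The combinatorial ray from the triple point of t crosses one side of t, and an even number of
sides of any other triangle. Hence the coboundary detects t alone. -/
lemma cobd_latticeCross_brickTriangle (t t' : ℤ × ℤ × Bool) :
    cobd (latticeCross t) (brickTriangle t').1 (brickTriangle t').2.1 (brickTriangle t').2.2 =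
      if t = t' then 1 else 0 := by
  obtain ⟨i, j, s⟩ := t
  obtain ⟨i', j', s'⟩ := t'
  have h11 : (1 : ZMod 2) + 1 = 0 := rfl
  cases s <;> cases s' <;>
  simp only [cobd, latticeCross_false, latticeCross_true, brickTriangle, Prod.mk.injEq,
    Bool.false_eq_true, Bool.true_eq_false, and_true, and_false, if_false] <;>
  split_ifs <;> first | omega | (simp only [add_zero, zero_add, h11]; done) | skip

/-- Degenerate triples contribute nothing, by symmetry and normalization; the others are triangles
in some order. -/
lemma cobd_latticeCross (t : ℤ × ℤ × Bool) {u v w : ℤ × ℤ} (h1 : BrickAdj u v)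
    (h2 : BrickAdj v w) (h3 : BrickAdj u w) :
    cobd (latticeCross t) u v w = triangleInd t u v w := by
  have hk := symmNorm_latticeCross t
  by_cases h : ∃ t', IsTriangle t' u v w
  · obtain ⟨t', ht'⟩ := h
    rw [ht'.cobd_eq hk, cobd_latticeCross_brickTriangle, triangleInd]
    congr 1
    exact propext ⟨fun h => by rw [h]; exact ht', fun h => h.unique ht'⟩
  · rw [triangleInd, if_neg (not_exists.1 h t)]
    have hd : u = v ∨ v = w ∨ u = w := by
      by_contra! hc
      exact h (exists_isTriangle h1 h2 h3 hc.1 hc.2.1 hc.2.2)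
    have := hk.symm
    have := hk.diag
    unfold cobd
    rcases hd with rfl | rfl | rfl <;> grind

/-- At most one triangle is spanned by the triple, so the sum has at most one nonzero term. This
form lets the triples of a chain be sorted by triangle; s may omit triangles on which the coboundary
vanishes. -/
lemma cobd_eq_sum_triangles {k : ℤ × ℤ → ℤ × ℤ → ZMod 2} (hk : SymNorm k)
    (s : Finset (ℤ × ℤ × Bool)) {u v w : ℤ × ℤ} (h1 : BrickAdj u v) (h2 : BrickAdj v w)
    (h3 : BrickAdj u w) (hs : ∀ t, IsTriangle t u v w → t ∉ s →
      cobd k (brickTriangle t).1 (brickTriangle t).2.1 (brickTriangle t).2.2 = 0) :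
    cobd k u v w = ∑ t ∈ s, triangleInd t u v w *
      cobd k (brickTriangle t).1 (brickTriangle t).2.1 (brickTriangle t).2.2 := by
  classical
  by_cases h : ∃ t, IsTriangle t u v w
  · obtain ⟨t, ht⟩ := h
    rw [ht.cobd_eq hk]
    by_cases hts : t ∈ s
    · rw [Finset.sum_eq_single_of_mem t hts]
      · simp [triangleInd, ht]
      · intro t' _ hne
        have : ¬ IsTriangle t' u v w := fun h' => hne (h'.unique ht)
        simp [triangleInd, this]
    · rw [hs t ht hts, eq_comm]
      refine Finset.sum_eq_zero fun t' ht' => ?_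
      have : ¬ IsTriangle t' u v w := fun h' => hts (h'.unique ht ▸ ht')
      simp [triangleInd, this]
  · rw [Finset.sum_eq_zero (fun t _ => by simp [triangleInd, not_exists.1 h t])]
    have hd : u = v ∨ v = w ∨ u = w := by
      by_contra! hc
      exact h (exists_isTriangle h1 h2 h3 hc.1 hc.2.1 hc.2.2)
    have := hk.symm
    have := hk.diag
    unfold cobd
    rcases hd with rfl | rfl | rfl <;> grind

lemma sum_Ico_telescope (h : ℤ → ZMod 2) (c : ℤ) (n : ℕ) :
    ∑ j ∈ Finset.Ico c (c + n), (h j + h (j + 1)) = h c + h (c + n) := by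
  induction n with
  | zero => simp [zmod_two_add_self]
  | succ n ih =>
    have : Finset.Ico c (c + (n + 1 : ℕ)) = insert (c + n) (Finset.Ico c (c + n)) := by
      ext x; simp only [Finset.mem_Ico, Finset.mem_insert]; omega
    rw [this, Finset.sum_insert (by simp), ih]
    push_cast
    rw [← add_assoc]
    grind

/-- The sum of all the triangles of the plane is a cycle. -/
lemma sum_triangles_eq_zero {k : ℤ × ℤ → ℤ × ℤ → ZMod 2} (n : ℕ)
    (hk : ∀ u v, k u v ≠ 0 → (-n : ℤ) < u.1 ∧ (-n : ℤ) < u.2 ∧ u.1 < n ∧ u.2 < n) :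
    ∑ t ∈ (Finset.Ico (-n : ℤ) (-n + (2 * n : ℕ))) ×ˢ ((Finset.Ico (-n : ℤ) (-n + (2 * n : ℕ))) ×ˢ
      (Finset.univ : Finset Bool)),
      cobd k (brickTriangle t).1 (brickTriangle t).2.1 (brickTriangle t).2.2 = 0 := by
  have h0 : ∀ u v : ℤ × ℤ, ¬ ((-n : ℤ) < u.1 ∧ (-n : ℤ) < u.2 ∧ u.1 < n ∧ u.2 < n) → k u v = 0 := fun u v h => by
    by_contra hc; exact h (hk u v hc)
  rw [Finset.sum_product]
  simp_rw [Finset.sum_product, Fintype.sum_bool]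
  -- Two triangles form a parallelogram and their common diagonal cancels. The pairs of opposite
  -- sides that remain telescope, vertically or horizontally.
  have e : ∀ i j : ℤ, cobd k (brickTriangle (i, j, true)).1 (brickTriangle (i, j, true)).2.1
      (brickTriangle (i, j, true)).2.2 + cobd k (brickTriangle (i, j, false)).1
      (brickTriangle (i, j, false)).2.1 (brickTriangle (i, j, false)).2.2 =
      (k (i, j) (i + 1, j) + k (i, j + 1) (i + 1, j + 1)) +
      (k (i, j) (i, j + 1) + k (i + 1, j) (i + 1, j + 1)) := by
    intro i j
    simp only [brickTriangle, cobd]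
    grind
  simp_rw [e, Finset.sum_add_distrib]
  have e1 : ∀ i : ℤ, ∑ j ∈ Finset.Ico (-n : ℤ) (-n + (2 * n : ℕ)), k (i, j) (i + 1, j) +
      ∑ j ∈ Finset.Ico (-n : ℤ) (-n + (2 * n : ℕ)), k (i, j + 1) (i + 1, j + 1) = 0 := by
    intro i
    rw [← Finset.sum_add_distrib, sum_Ico_telescope (fun j => k (i, j) (i + 1, j)), h0, h0, add_zero]
    · push_cast; omega
    · omega
  have e2 : ∑ i ∈ Finset.Ico (-n : ℤ) (-n + (2 * n : ℕ)),
      ∑ j ∈ Finset.Ico (-n : ℤ) (-n + (2 * n : ℕ)), k (i, j) (i, j + 1) +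
      ∑ i ∈ Finset.Ico (-n : ℤ) (-n + (2 * n : ℕ)),
      ∑ j ∈ Finset.Ico (-n : ℤ) (-n + (2 * n : ℕ)), k (i + 1, j) (i + 1, j + 1) = 0 := by
    rw [Finset.sum_comm, Finset.sum_comm (f := fun i j => k (i + 1, j) (i + 1, j + 1)),
      ← Finset.sum_add_distrib]
    refine Finset.sum_eq_zero fun j _ => ?_
    rw [← Finset.sum_add_distrib, sum_Ico_telescope (fun i => k (i, j) (i, j + 1)), h0, h0, add_zero]
    · push_cast; omega
    · omega
  rw [e2, add_zero, ← Finset.sum_add_distrib]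
  exact Finset.sum_eq_zero fun i _ => e1 i

lemma brick_bounds (y : ℂ) : ((brick y).1 : ℝ) + (brick y).2 / 2 ≤ y.re ∧
    y.re < (brick y).1 + (brick y).2 / 2 + 1 ∧ ((brick y).2 : ℝ) ≤ y.im ∧
    y.im < (brick y).2 + 1 := by
  have h1 := Int.floor_le (y.re - ⌊y.im⌋ / 2)
  have h2 := Int.lt_floor_add_one (y.re - ⌊y.im⌋ / 2)
  have h3 := Int.floor_le y.im
  have h4 := Int.lt_floor_add_one y.im
  simp only [brick]
  refine ⟨?_, ?_, ?_, ?_⟩ <;> linarith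

/-- The shift by half a brick leaves a gap of at least 1 / 2 between any two bricks that do not
touch. -/
lemma brickAdj_brick {y z : ℂ} (h : dist y z < 1 / 2) : BrickAdj (brick y) (brick z) := by
  obtain ⟨h1, h2, h3, h4⟩ := re_im_bounds h
  obtain ⟨a1, a2, a3, a4⟩ := brick_bounds y
  obtain ⟨b1, b2, b3, b4⟩ := brick_bounds z
  generalize (brick y) = u at *
  generalize (brick z) = v at *
  obtain ⟨u1, u2⟩ := u
  obtain ⟨v1, v2⟩ := v
  unfold BrickAdj
  simp only at *
  have c1 : (v2 : ℝ) - u2 < 2 := by linarith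
  have c2 : (u2 : ℝ) - v2 < 2 := by linarith
  have c3 : (v1 : ℝ) + v2 / 2 - (u1 + u2 / 2) < 3 / 2 := by linarith
  have c4 : (u1 : ℝ) + u2 / 2 - (v1 + v2 / 2) < 3 / 2 := by linarith
  have d1 : v2 - u2 < 2 := by exact_mod_cast c1
  have d2 : u2 - v2 < 2 := by exact_mod_cast c2
  have d3 : 2 * v1 + v2 - (2 * u1 + u2) < 3 := by
    have : (2 * v1 + v2 - (2 * u1 + u2) : ℝ) < 3 := by linarith
    exact_mod_cast this
  have d4 : 2 * u1 + u2 - (2 * v1 + v2) < 3 := by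
    have : (2 * u1 + u2 - (2 * v1 + v2) : ℝ) < 3 := by linarith
    exact_mod_cast this
  omega

lemma dist_le_of_re_im {z w : ℂ} {a b : ℝ} (h1 : |z.re - w.re| ≤ a) (h2 : |z.im - w.im| ≤ b) :
    dist z w ≤ a + b := by
  rw [dist_eq_norm]
  refine (Complex.norm_le_abs_re_add_abs_im _).trans ?_
  simp only [Complex.sub_re, Complex.sub_im]
  linarith

lemma dist_brickCenter_brick (y : ℂ) : dist y (brickCenter (brick y)) ≤ 1 := by
  obtain ⟨a1, a2, a3, a4⟩ := brick_bounds y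
  have : (1 : ℝ) = 1 / 2 + 1 / 2 := by norm_num
  rw [this]
  refine dist_le_of_re_im ?_ ?_ <;> rw [abs_le] <;> simp only [brickCenter] <;>
    constructor <;> linarith

lemma dist_brickCenter_triplePoint {t : ℤ × ℤ × Bool} {u v w : ℤ × ℤ} (h : IsTriangle t u v w) :
    dist (brickCenter u) (triplePoint t) ≤ 1 := by
  have h1 : (1 : ℝ) = 1 / 2 + 1 / 2 := by norm_num
  rw [h1]
  obtain ⟨i, j, s⟩ := t
  cases s <;> simp only [IsTriangle, brickTriangle] at h <;>
  rcases h with ⟨rfl, -, -⟩ | ⟨rfl, -, -⟩ | ⟨-, rfl, -⟩ | ⟨-, -, rfl⟩ | ⟨-, rfl, -⟩ | ⟨-, -, rfl⟩ <;>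
  refine dist_le_of_re_im ?_ ?_ <;> rw [abs_le] <;> simp only [brickCenter, triplePoint] <;>
  push_cast <;> constructor <;> linarith

lemma IsTriangle.perm {t : ℤ × ℤ × Bool} {u v w : ℤ × ℤ} (h : IsTriangle t u v w) :
    IsTriangle t v w u := by
  unfold IsTriangle at *; tauto

lemma isTriangle_self (t : ℤ × ℤ × Bool) :
    IsTriangle t (brickTriangle t).1 (brickTriangle t).2.1 (brickTriangle t).2.2 :=
  Or.inl ⟨rfl, rfl, rfl⟩

lemma brickAdj_triangle (t : ℤ × ℤ × Bool) :
    BrickAdj (brickTriangle t).1 (brickTriangle t).2.1 ∧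
    BrickAdj (brickTriangle t).2.1 (brickTriangle t).2.2 ∧
    BrickAdj (brickTriangle t).1 (brickTriangle t).2.2 := by
  obtain ⟨i, j, s⟩ := t
  cases s <;> simp only [BrickAdj, brickTriangle] <;> omega

lemma cross_brick_aux {y z : ℂ} (h : dist y z < 1 / 2) (j : ℤ) :
    (y.im < j + 1 ∧ (j : ℝ) + 1 ≤ z.im) ↔ ((brick y).2 = j ∧ (brick z).2 = j + 1) := by
  obtain ⟨h1, h2, h3, h4⟩ := re_im_bounds h
  obtain ⟨a1, a2, a3, a4⟩ := brick_bounds y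
  obtain ⟨b1, b2, b3, b4⟩ := brick_bounds z
  generalize (brick y) = u at *
  generalize (brick z) = v at *
  constructor
  · rintro ⟨c1, c2⟩
    have d1 : (u.2 : ℝ) < j + 1 := by linarith
    have d2 : (j : ℝ) < v.2 := by linarith
    have d3 : (j : ℝ) - 1 < u.2 := by linarith
    have d4 : (v.2 : ℝ) < j + 2 := by linarith
    have f1 : u.2 < j + 1 := by exact_mod_cast d1
    have f2 : j < v.2 := by exact_mod_cast d2
    have f3 : j - 1 < u.2 := by exact_mod_cast d3
    have f4 : v.2 < j + 2 := by exact_mod_cast d4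
    omega
  · rintro ⟨c1, c2⟩
    rw [c1] at a4
    rw [c2] at b3
    push_cast at b3
    exact ⟨a4, b3⟩

lemma le_brick_iff (y : ℂ) (i : ℤ) : i ≤ (brick y).1 ↔ (i : ℝ) + (brick y).2 / 2 ≤ y.re := by
  simp only [brick]
  rw [Int.le_floor]
  constructor <;> intro h <;> linarith

/-- The crossing cochain at the triple point of `t`, or its upper variant, according to the type
of `t`. -/
noncomputable def crossAt : ℤ × ℤ × Bool → ℂ → ℂ → ZMod 2
  | (i, j, false) => cross (triplePoint (i, j, false))
  | (i, j, true) => crossUp (triplePoint (i, j, true))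

/-- At a triple point of type `false` the vertical wall lies below, so the label of the lower
endpoint decides on which side of it that endpoint is; for type `true` the wall lies above and the
upper endpoint must be tested. This is why both `cross` and `crossUp` are needed. -/
lemma crossAt_eq_latticeCross (t : ℤ × ℤ × Bool) {y z : ℂ} (h : dist y z < 1 / 2) :
    crossAt t y z = latticeCross t (brick y) (brick z) := by
  obtain ⟨i, j, s⟩ := t
  have h' : dist z y < 1 / 2 := by rwa [dist_comm]
  have e1 := cross_brick_aux h j
  have e2 := cross_brick_aux h' j
  cases s
  · simp only [crossAt, cross, latticeCross, triplePoint]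
    congr 1
    rw [← and_assoc, ← and_assoc, e1, e2, le_brick_iff, le_brick_iff, ← and_assoc, ← and_assoc]
    refine propext (or_congr (and_congr_right fun h => ?_) (and_congr_right fun h => ?_)) <;>
    rw [h.1] <;> push_cast <;> rfl
  · simp only [crossAt, crossUp, latticeCross, triplePoint]
    congr 1
    rw [← and_assoc, ← and_assoc, e1, e2, le_brick_iff, le_brick_iff, ← and_assoc, ← and_assoc]
    refine propext (or_congr (and_congr_right fun h => ?_) (and_congr_right fun h => ?_)) <;>
    rw [h.2] <;> push_cast <;> rfl

lemma cobd_crossAt (t : ℤ × ℤ × Bool) {x y z : ℂ} (h1 : dist x y < 1 / 2) (h2 : dist y z < 1 / 2)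
    (h3 : dist x z < 1 / 2) :
    cobd (crossAt t) x y z = triangleInd t (brick x) (brick y) (brick z) := by
  rw [← cobd_latticeCross t (brickAdj_brick h1) (brickAdj_brick h2) (brickAdj_brick h3)]
  simp only [cobd, crossAt_eq_latticeCross t h1, crossAt_eq_latticeCross t h2,
    crossAt_eq_latticeCross t h3]

/-- Used for chains whose vertices are brick centres. Triple points of type `false` suffice there,
since every point is near one of them (`exists_triplePoint_near`). -/
lemma cross_brickCenter (i j : ℤ) {v w : ℤ × ℤ} (h : BrickAdj v w) :
    cross (triplePoint (i, j, false)) (brickCenter v) (brickCenter w) =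
      latticeCross (i, j, false) v w := by
  obtain ⟨a, b⟩ := v
  obtain ⟨c, d⟩ := w
  unfold BrickAdj at h
  simp only [cross, latticeCross, triplePoint, brickCenter] at *
  congr 1
  have e1 : ∀ x y : ℤ, ((x : ℝ) + 1 / 2 < y + 1) ↔ x ≤ y := fun x y => by
    constructor
    · intro h
      have : (x : ℝ) < y + 1 := by linarith
      have : x < y + 1 := by exact_mod_cast this
      omega
    · intro h
      have : (x : ℝ) ≤ y := by exact_mod_cast h
      linarith
  have e2 : ∀ x y : ℤ, ((y : ℝ) + 1 ≤ x + 1 / 2) ↔ y + 1 ≤ x := fun x y => by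
    rw [← not_lt, e1]; omega
  rw [e1, e2, e1, e2]
  have e3 : ∀ x y z : ℤ, ((x : ℝ) + 1 + z / 2 ≤ y + z / 2 + 1 / 2) ↔ x + 1 ≤ y := fun x y z => by
    rw [← e2]; constructor <;> intro h <;> linarith
  refine propext (or_congr ⟨fun ⟨h1, h2, h3⟩ => ?_, fun ⟨h1, h2, h3⟩ => ?_⟩
    ⟨fun ⟨h1, h2, h3⟩ => ?_, fun ⟨h1, h2, h3⟩ => ?_⟩)
  · obtain rfl : b = j := by omega
    exact ⟨rfl, by omega, (e3 _ _ _).1 h3⟩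
  · subst h1
    exact ⟨le_rfl, by omega, (e3 _ _ _).2 h3⟩
  · obtain rfl : d = j := by omega
    exact ⟨rfl, by omega, (e3 _ _ _).1 h3⟩
  · subst h1
    exact ⟨le_rfl, by omega, (e3 _ _ _).2 h3⟩

lemma cobd_cross_brickCenter (i j : ℤ) {u v w : ℤ × ℤ} (h1 : BrickAdj u v) (h2 : BrickAdj v w)
    (h3 : BrickAdj u w) :
    cobd (cross (triplePoint (i, j, false))) (brickCenter u) (brickCenter v) (brickCenter w) =
      triangleInd (i, j, false) u v w := by
  rw [← cobd_latticeCross _ h1 h2 h3]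
  simp only [cobd, cross_brickCenter i j h1, cross_brickCenter i j h2, cross_brickCenter i j h3]

lemma cross_smul {h : ℝ} (hh : 0 < h) (p z w : ℂ) :
    cross (h • p) (h • z) (h • w) = cross p z w := by
  simp only [cross, Complex.smul_re, Complex.smul_im, smul_eq_mul, mul_lt_mul_iff_right₀ hh,
    mul_le_mul_iff_right₀ hh]

lemma crossUp_smul {h : ℝ} (hh : 0 < h) (p z w : ℂ) :
    crossUp (h • p) (h • z) (h • w) = crossUp p z w := by
  simp only [crossUp, Complex.smul_re, Complex.smul_im, smul_eq_mul, mul_lt_mul_iff_right₀ hh,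
    mul_le_mul_iff_right₀ hh]

lemma exists_triplePoint_near (y : ℂ) :
    dist (triplePoint ((brick y).1, (brick y).2, false)) y ≤ 2 := by
  obtain ⟨a1, a2, a3, a4⟩ := brick_bounds y
  have : (2 : ℝ) = 1 + 1 := by norm_num
  rw [this]
  refine dist_le_of_re_im ?_ ?_ <;> rw [abs_le] <;> simp only [triplePoint] <;>
    constructor <;> linarith

end Lattice

/-! ### Pushing a chain onto the lattice of a chart and completing it -/

section Push

variable {X : Type*} [MetricSpace X]

/-- The image in the chart `g` of the centre of the brick `v`, the mesh of the tiling being `h`. -/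
noncomputable def node (g : ℂ → X) (h : ℝ) (v : ℤ × ℤ) : X := g (h • brickCenter v)

/-- The label of the brick of mesh `h` that contains a point in the chart `g`. -/
noncomputable def label (g : ℂ → X) (h : ℝ) (x : X) : ℤ × ℤ := brick (h⁻¹ • coord g x)

/-- The image of the triangle `t` in the chart `g`. -/
noncomputable def nodeTriangle (g : ℂ → X) (h : ℝ) (t : ℤ × ℤ × Bool) : X × X × X :=
  (node g h (brickTriangle t).1, node g h (brickTriangle t).2.1, node g h (brickTriangle t).2.2)

open Classical in
/-- The map that moves each point of a disc of the chart `g` to the centre of its brick. -/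
noncomputable def pushMap (g : ℂ → X) (h : ℝ) (x : X) : X :=
  if x ∈ g '' closedBall 0 3 then node g h (label g h x) else x

/-- The three vertices of `T` belong to `A`. -/
def Inside (T : X × X × X) (A : Set X) : Prop := T.1 ∈ A ∧ T.2.1 ∈ A ∧ T.2.2 ∈ A

open Classical in
/-- The number mod 2 of triples of `P` that are pushed to the triangle `t`. -/
noncomputable def triCount (g : ℂ → X) (h : ℝ) (P : List (X × X × X)) (t : ℤ × ℤ × Bool) : ZMod 2 :=
  (P.map fun T => if Inside T (g '' closedBall 0 3) then
    triangleInd t (label g h T.1) (label g h T.2.1) (label g h T.2.2) else 0).sum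

/-- A large square of indices of triangles. -/
noncomputable def box (n : ℕ) : Finset (ℤ × ℤ × Bool) :=
  (Finset.Ico (-n : ℤ) (-n + (2 * n : ℕ))) ×ˢ ((Finset.Ico (-n : ℤ) (-n + (2 * n : ℕ))) ×ˢ
    (Finset.univ : Finset Bool))

open Classical in
/-- The triangles of the part of the chart to be filled. -/
noncomputable def window (h : ℝ) (n : ℕ) : Finset (ℤ × ℤ × Bool) :=
  (box n).filter fun t => h • triplePoint t ∈ closedBall (0 : ℂ) (5 / 2)

open Classical in
/-- The triangles missing in the pushed chain. -/
noncomputable def missing (g : ℂ → X) (h : ℝ) (n : ℕ) (P : List (X × X × X)) :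
    List (X × X × X) :=
  (((window h n).filter fun t => triCount g h P t = 0).toList).map (nodeTriangle g h)

/-- The pushed chain, completed by the missing triangles. -/
noncomputable def fillChain (g : ℂ → X) (h : ℝ) (n : ℕ) (P : List (X × X × X)) :
    List (X × X × X) :=
  pushChain (pushMap g h) P ++ missing g h n P

variable {g : ℂ → X} {h : ℝ} {n : ℕ} {P : List (X × X × X)}

omit [MetricSpace X] in
lemma mem_missing {T : X × X × X} (hT : T ∈ missing g h n P) :
    ∃ t ∈ window h n, triCount g h P t = 0 ∧ T = nodeTriangle g h t := by
  obtain ⟨t, ht, rfl⟩ := List.mem_map.1 hT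
  rw [Finset.mem_toList, Finset.mem_filter] at ht
  exact ⟨t, ht.1, ht.2, rfl⟩

omit [MetricSpace X] in
lemma sum_missing (f : X × X × X → ZMod 2) :
    ((missing g h n P).map f).sum =
      ∑ t ∈ window h n, (1 + triCount g h P t) * f (nodeTriangle g h t) := by
  classical
  rw [missing, List.map_map, Finset.sum_map_toList, Finset.sum_filter]
  refine Finset.sum_congr rfl fun t _ => ?_
  rcases zmod_two_cases (triCount g h P t) with e | e
  · simp [e]
  · have : (1 : ZMod 2) + 1 = 0 := rfl
    simp [e, this]

omit [MetricSpace X] in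
lemma pushMap_of_mem {x : X} (hx : x ∈ g '' closedBall 0 3) :
    pushMap g h x = node g h (label g h x) := if_pos hx

omit [MetricSpace X] in
lemma dist_coord_triplePoint (hh : 0 < h) {t : ℤ × ℤ × Bool} {x : X} {v w : ℤ × ℤ}
    (ht : IsTriangle t (label g h x) v w) : dist (coord g x) (h • triplePoint t) ≤ 2 * h := by
  have h1 := dist_brickCenter_triplePoint ht
  have h2 := dist_brickCenter_brick (h⁻¹ • coord g x)
  have h3 : dist (h⁻¹ • coord g x) (triplePoint t) ≤ 2 := by
    have := dist_triangle (h⁻¹ • coord g x) (brickCenter (brick (h⁻¹ • coord g x))) (triplePoint t)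
    unfold label at h1
    linarith
  calc dist (coord g x) (h • triplePoint t)
      = dist (h • (h⁻¹ • coord g x)) (h • triplePoint t) := by rw [smul_inv_smul₀ hh.ne']
    _ = h * dist (h⁻¹ • coord g x) (triplePoint t) := by
        rw [dist_smul₀, Real.norm_of_nonneg hh.le]
    _ ≤ 2 * h := by nlinarith

lemma dist_node_triplePoint (hh : 0 < h) {t : ℤ × ℤ × Bool} {u v w : ℤ × ℤ}
    (ht : IsTriangle t u v w) : dist (h • brickCenter u) (h • triplePoint t) ≤ 2 * h := by
  have h1 := dist_brickCenter_triplePoint ht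
  rw [dist_smul₀, Real.norm_of_nonneg hh.le]
  nlinarith

omit [MetricSpace X] in
lemma brickAdj_label (hh : 0 < h) {x y : X} (hxy : dist (coord g x) (coord g y) < h / 2) :
    dist (h⁻¹ • coord g x) (h⁻¹ • coord g y) < 1 / 2 := by
  rw [dist_smul₀, norm_inv, Real.norm_of_nonneg hh.le, inv_mul_lt_iff₀ hh]
  linarith

/-- The local degree at a triple point is the number of triples that are pushed to the triangle. -/
lemma deg_eq_triCount (hg : IsOpenEmbedding g) (hh : 0 < h) {ε r : ℝ} (hP : FineChain P ε)
    {t : ℤ × ℤ × Bool} (hN : NoBdry P (ball (g (h • triplePoint t)) (2 * r)))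
    (hεr : ε ≤ r) (H1 : ∀ x, dist x (g (h • triplePoint t)) < 2 * r → x ∈ g '' closedBall 0 3)
    (H2 : ∀ x ∈ g '' closedBall 0 3, ∀ y ∈ g '' closedBall 0 3, dist x y < ε →
      dist (coord g x) (coord g y) < h / 2)
    (H3 : ∀ z, dist z (h • triplePoint t) ≤ 2 * h → dist (g z) (g (h • triplePoint t)) < r)
    (H4 : ∀ x y, dist x (g (h • triplePoint t)) < 2 * r → r ≤ dist x (g (h • triplePoint t)) →
      dist y (g (h • triplePoint t)) < 2 * r → r ≤ dist y (g (h • triplePoint t)) → dist x y < ε →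
      crossUp (h • triplePoint t) (coord g x) (coord g y) = chi g (h • triplePoint t) x y) :
    deg g (h • triplePoint t) r P = triCount g h P t := by
  classical
  have e1 : deg g (h • triplePoint t) r P = holePairing P
      (fun x y => crossAt t (h⁻¹ • coord g x) (h⁻¹ • coord g y))
      (ball (g (h • triplePoint t)) r) := by
    obtain ⟨i, j, s⟩ := t
    cases s
    · have : chi g (h • triplePoint (i, j, false)) = 
          fun x y => crossAt (i, j, false) (h⁻¹ • coord g x) (h⁻¹ • coord g y) := by
        funext x y
        simp only [chi, crossAt]
        conv_lhs => rw [← smul_inv_smul₀ hh.ne' (coord g x), ← smul_inv_smul₀ hh.ne' (coord g y)]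
        rw [cross_smul hh]
      rw [deg, this]
    -- For the upper type the two variants of the crossing cochain agree around the hole, so they
    -- may be exchanged with zero potential.
    · have : (fun x y => crossAt (i, j, true) (h⁻¹ • coord g x) (h⁻¹ • coord g y)) = 
          fun x y => crossUp (h • triplePoint (i, j, true)) (coord g x) (coord g y) := by
        funext x y
        simp only [crossAt]
        conv_rhs => rw [← smul_inv_smul₀ hh.ne' (coord g x), ← smul_inv_smul₀ hh.ne' (coord g y)]
        rw [crossUp_smul hh]
      rw [deg, this]
      refine holePairing_eq hP hN (symmNorm_chi _ _) ((symmNorm_crossUp _).comp (coord g))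
        (fun _ => 0) (fun x hx y hy hx' hy' hxy => ?_) (fun x hx y hxy => ?_)
      · rw [H4 x y hx (not_lt.1 hx') hy (not_lt.1 hy') hxy, zmod_two_add_self, add_zero]
      · rw [mem_ball] at *
        rw [dist_comm] at hxy
        linarith [dist_triangle y x (g (h • triplePoint (i, j, true)))]
  rw [e1, holePairing, triCount]
  congr 1
  refine List.map_congr_left fun T hT => ?_
  obtain ⟨d1, d2, d3⟩ := hP T hT
  by_cases hm : Meets T (ball (g (h • triplePoint t)) r)
  · obtain ⟨x, hx, f1, f2, f3⟩ := hm.near (hP T hT)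
    rw [mem_ball] at hx
    have m1 := H1 T.1 (by linarith [dist_triangle T.1 x (g (h • triplePoint t))])
    have m2 := H1 T.2.1 (by linarith [dist_triangle T.2.1 x (g (h • triplePoint t))])
    have m3 := H1 T.2.2 (by linarith [dist_triangle T.2.2 x (g (h • triplePoint t))])
    rw [if_pos hm, if_pos ⟨m1, m2, m3⟩]
    exact cobd_crossAt t (brickAdj_label hh (H2 _ m1 _ m2 d1)) (brickAdj_label hh (H2 _ m2 _ m3 d2))
      (brickAdj_label hh (H2 _ m1 _ m3 d3))
  -- A triple that is pushed to t has its vertices within two meshes of the triple point, hence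
  -- meets the ball; so a triple off the ball is not counted on either side.
  · rw [if_neg hm, eq_comm]
    refine ite_eq_right_iff.2 fun hI => ?_
    refine if_neg fun hc => hm (Or.inl ?_)
    have := H3 _ (dist_coord_triplePoint hh hc)
    obtain ⟨z, -, hz⟩ := hI.1
    rw [← hz, coord_apply hg] at this
    rwa [← hz]

/-- The local degree of the completed chain at a triple point of its window. -/
lemma deg_fillChain (hg : IsOpenEmbedding g) (hh : 0 < h) {ε η r : ℝ} (hP : FineChain P ε)
    {i j : ℤ} (ht : (i, j, false) ∈ window h n) (hεr : ε ≤ r) (hηr : η ≤ r)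
    (Hπ : ∀ x, dist (pushMap g h x) x < η)
    (H1 : ∀ x, dist x (g (h • triplePoint (i, j, false))) < 3 * r → x ∈ g '' closedBall 0 3)
    (H2 : ∀ x ∈ g '' closedBall 0 3, ∀ y ∈ g '' closedBall 0 3, dist x y < ε →
      dist (coord g x) (coord g y) < h / 2)
    (H3 : ∀ z, dist z (h • triplePoint (i, j, false)) ≤ 2 * h →
      dist (g z) (g (h • triplePoint (i, j, false))) < r) :
    deg g (h • triplePoint (i, j, false)) r (fillChain g h n P) = 1 := by
  classical
  set t : ℤ × ℤ × Bool := (i, j, false) with htdef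
  have hchi : ∀ u v w, BrickAdj u v → BrickAdj v w → BrickAdj u w →
      cobd (chi g (h • triplePoint t)) (node g h u) (node g h v) (node g h w) =
        triangleInd t u v w := by
    intro u v w h1 h2 h3
    rw [htdef, ← cobd_cross_brickCenter i j h1 h2 h3]
    simp only [cobd, chi, node, coord_apply hg, cross_smul hh]
  have hnear : ∀ u v w, IsTriangle t u v w → node g h u ∈ ball (g (h • triplePoint t)) r :=
    fun u v w hu => H3 _ (dist_node_triplePoint hh hu)
  have e1 : deg g (h • triplePoint t) r (pushChain (pushMap g h) P) = triCount g h P t := by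
    rw [deg, holePairing, triCount, pushChain, List.map_map]
    congr 1
    refine List.map_congr_left fun T hT => ?_
    obtain ⟨d1, d2, d3⟩ := hP T hT
    simp only [Function.comp_apply]
    by_cases hI : Inside T (g '' closedBall 0 3)
    · rw [if_pos hI, pushMap_of_mem hI.1, pushMap_of_mem hI.2.1, pushMap_of_mem hI.2.2]
      have a1 : BrickAdj (label g h T.1) (label g h T.2.1) :=
        brickAdj_brick (brickAdj_label hh (H2 _ hI.1 _ hI.2.1 d1))
      have a2 : BrickAdj (label g h T.2.1) (label g h T.2.2) :=
        brickAdj_brick (brickAdj_label hh (H2 _ hI.2.1 _ hI.2.2 d2))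
      have a3 : BrickAdj (label g h T.1) (label g h T.2.2) :=
        brickAdj_brick (brickAdj_label hh (H2 _ hI.1 _ hI.2.2 d3))
      rw [hchi _ _ _ a1 a2 a3]
      refine ite_eq_left_iff.2 fun hm => ?_
      rw [eq_comm, triangleInd]
      exact if_neg fun hc => hm (Or.inl (hnear _ _ _ hc))
    · rw [if_neg hI]
      refine if_neg fun hm => hI ?_
      have key : ∀ x, pushMap g h x ∈ ball (g (h • triplePoint t)) r → ∀ y, dist y x < ε →
          y ∈ g '' closedBall 0 3 := by
        intro x hx y hy
        refine H1 y ?_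
        rw [mem_ball] at hx
        have h1 := Hπ x
        linarith [dist_triangle y x (g (h • triplePoint t)),
          dist_triangle_left x (g (h • triplePoint t)) (pushMap g h x)]
      have hε : 0 < ε := dist_nonneg.trans_lt d1
      rcases hm with hm | hm | hm
      · exact ⟨key _ hm _ (by simpa), key _ hm _ (by rwa [dist_comm]),
          key _ hm _ (by rwa [dist_comm])⟩
      · exact ⟨key _ hm _ d1, key _ hm _ (by simpa), key _ hm _ (by rwa [dist_comm])⟩
      · exact ⟨key _ hm _ d3, key _ hm _ d2, key _ hm _ (by simpa)⟩
  have e2 : deg g (h • triplePoint t) r (missing g h n P) = 1 + triCount g h P t := by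
    classical
    rw [deg, holePairing, sum_missing, Finset.sum_eq_single_of_mem t ht]
    · rw [if_pos (show Meets (nodeTriangle g h t) _ from
        Or.inl (hnear _ _ _ (isTriangle_self t)))]
      have := brickAdj_triangle t
      simp only [nodeTriangle]
      rw [hchi _ _ _ this.1 this.2.1 this.2.2, triangleInd, if_pos (isTriangle_self t), mul_one]
    · intro t' _ hne
      have := brickAdj_triangle t'
      have e : cobd (chi g (h • triplePoint t)) (nodeTriangle g h t').1 (nodeTriangle g h t').2.1
          (nodeTriangle g h t').2.2 = 0 := by
        simp only [nodeTriangle]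
        rw [hchi _ _ _ this.1 this.2.1 this.2.2, triangleInd,
          if_neg (fun hc => hne ((isTriangle_self t').unique hc))]
      rw [e, ite_self, mul_zero]
  unfold deg at e1 e2 ⊢
  -- The pushed chain contributes the count of t, and the added triangles contribute 1 plus that
  -- count.
  rw [fillChain, holePairing_append, e1, e2]
  grind

lemma fillChain_fine {ε η : ℝ} (hε : 0 < ε) (hP : FineChain P ε) (Hπ : ∀ x, dist (pushMap g h x) x < η)
    (H3 : ∀ t ∈ window h n, ∀ u v w, IsTriangle t u v w →
      dist (node g h u) (g (h • triplePoint t)) < η) :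
    FineChain (fillChain g h n P) (ε + 2 * η) := by
  refine fineChain_append ?_ ?_
  · intro T hT
    obtain ⟨T', hT', rfl⟩ := List.mem_map.1 hT
    have key : ∀ x y, dist x y < ε → dist (pushMap g h x) (pushMap g h y) < ε + 2 * η := by
      intro x y hxy
      have h1 := Hπ x
      have h2 := Hπ y
      rw [dist_comm] at h2
      linarith [dist_triangle4 (pushMap g h x) x y (pushMap g h y)]
    obtain ⟨d1, d2, d3⟩ := hP T' hT'
    exact ⟨key _ _ d1, key _ _ d2, key _ _ d3⟩
  · intro T hT
    obtain ⟨t, ht, -, rfl⟩ := mem_missing hT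
    have h1 := H3 t ht _ _ _ (isTriangle_self t)
    have h2 := H3 t ht _ _ _ (isTriangle_self t).perm
    have h3 := H3 t ht _ _ _ (isTriangle_self t).perm.perm
    simp only [nodeTriangle]
    refine ⟨?_, ?_, ?_⟩
    · linarith [dist_triangle_right (node g h (brickTriangle t).1) (node g h (brickTriangle t).2.1)
        (g (h • triplePoint t))]
    · linarith [dist_triangle_right (node g h (brickTriangle t).2.1)
        (node g h (brickTriangle t).2.2) (g (h • triplePoint t))]
    · linarith [dist_triangle_right (node g h (brickTriangle t).1) (node g h (brickTriangle t).2.2)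
        (g (h • triplePoint t))]

/-- Inside the window the completed chain has no boundary. -/
lemma pairing_fillChain (hg : IsOpenEmbedding g) (hh : 0 < h) (hh' : h < 1 / 16) {ε η : ℝ}
    (hn : 3 / h ≤ n) (hP : FineChain P ε)
    (Hπ : ∀ x, dist (pushMap g h x) x < η)
    (H1 : ∀ z ∈ closedBall (0 : ℂ) (7 / 4), ∀ x, dist x (g z) < ε + η → x ∈ g '' closedBall 0 3)
    (H2 : ∀ x ∈ g '' closedBall 0 3, ∀ y ∈ g '' closedBall 0 3, dist x y < ε →
      dist (coord g x) (coord g y) < h / 2) {k : X → X → ZMod 2} (hk : SymNorm k)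
    (hks : ∀ a b, k a b ≠ 0 → a ∈ g '' closedBall 0 (7 / 4) ∧ b ∈ g '' closedBall 0 (7 / 4)) :
    pairing (fillChain g h n P) k = 0 := by
  classical
  set κ : ℤ × ℤ → ℤ × ℤ → ZMod 2 := fun u v => k (node g h u) (node g h v) with hκ
  have hκs : SymNorm κ := hk.comp (node g h)
  set c : ℤ × ℤ × Bool → ZMod 2 := fun t =>
    cobd κ (brickTriangle t).1 (brickTriangle t).2.1 (brickTriangle t).2.2 with hc
  have hnode : ∀ u, node g h u ∈ g '' closedBall 0 (7 / 4) →
      h • brickCenter u ∈ closedBall (0 : ℂ) (7 / 4) := by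
    rintro u ⟨z, hz, e⟩
    rwa [← hg.injective e]
  have hκb : ∀ u v, κ u v ≠ 0 → h • brickCenter u ∈ closedBall (0 : ℂ) (7 / 4) ∧
      h • brickCenter v ∈ closedBall (0 : ℂ) (7 / 4) := fun u v huv =>
    ⟨hnode _ (hks _ _ huv).1, hnode _ (hks _ _ huv).2⟩
  have hbox : ∀ u, h • brickCenter u ∈ closedBall (0 : ℂ) (7 / 4) →
      (-n : ℤ) < u.1 ∧ (-n : ℤ) < u.2 ∧ u.1 < n ∧ u.2 < n := by
    intro u hu
    rw [mem_closedBall_zero_iff, norm_smul, Real.norm_of_nonneg hh.le] at hu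
    have h1 : ‖brickCenter u‖ ≤ 7 / 4 / h := by rw [le_div_iff₀ hh]; linarith
    have h2 := (Complex.abs_re_le_norm (brickCenter u)).trans h1
    have h3 := (Complex.abs_im_le_norm (brickCenter u)).trans h1
    rw [abs_le] at h2 h3
    simp only [brickCenter] at h2 h3
    have h4 : 16 ≤ 1 / h := by rw [le_div_iff₀ hh]; linarith
    have h5 : 3 * (1 / h) ≤ n := by rw [← div_eq_mul_one_div]; exact hn
    have h6 : 7 / 4 / h = 7 / 4 * (1 / h) := by ring
    rw [h6] at h2 h3
    have f1 : -(n : ℝ) < u.1 := by linarith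
    have f2 : -(n : ℝ) < u.2 := by linarith
    have f3 : (u.1 : ℝ) < n := by linarith
    have f4 : (u.2 : ℝ) < n := by linarith
    exact ⟨by exact_mod_cast f1, by exact_mod_cast f2, by exact_mod_cast f3, by exact_mod_cast f4⟩
  have hzero : ∑ t ∈ box n, c t = 0 := sum_triangles_eq_zero n fun u v huv => hbox u (hκb u v huv).1
  have htri : ∀ t, c t ≠ 0 → ∃ u v w, IsTriangle t u v w ∧ κ u v ≠ 0 := by
    intro t ht
    by_contra! hcon
    have h1 := hcon _ _ _ (isTriangle_self t)
    have h2 := hcon _ _ _ (isTriangle_self t).perm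
    have h3 := hcon _ _ _ (isTriangle_self t).perm.perm
    rw [hκs.symm] at h3
    exact ht (by simp only [hc, cobd, h1, h2, h3, add_zero])
  have hcw : ∀ t, c t ≠ 0 → h • triplePoint t ∈ closedBall (0 : ℂ) (5 / 2) := by
    intro t ht
    obtain ⟨u, v, w, huvw, hne⟩ := htri t ht
    have h1 := (hκb u v hne).1
    have h2 := dist_node_triplePoint hh huvw
    rw [mem_closedBall] at *
    linarith [dist_triangle_left (h • triplePoint t) 0 (h • brickCenter u)]
  have hsum : ∑ t ∈ window h n, c t = 0 := by
    rw [← hzero, window, Finset.sum_filter]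
    refine Finset.sum_congr rfl fun t _ => ?_
    refine ite_eq_left_iff.2 fun h' => ?_
    by_contra hne
    exact h' (hcw t fun h0 => hne h0.symm)
  have hmem : ∀ t, c t ≠ 0 → t ∈ window h n := by
    intro t ht
    refine Finset.mem_filter.2 ⟨?_, hcw t ht⟩
    obtain ⟨u, v, w, huvw, hne⟩ := htri t ht
    have b1 := hbox u (hκb u v hne).1
    obtain ⟨i, j, s⟩ := t
    simp only [box, Finset.mem_product, Finset.mem_Ico, Finset.mem_univ, and_true]
    have hu : (u.1 = i ∨ u.1 = i + 1) ∧ (u.2 = j ∨ u.2 = j + 1) := by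
      cases s <;> simp only [IsTriangle, brickTriangle] at huvw <;>
      rcases huvw with ⟨rfl, -, -⟩ | ⟨rfl, -, -⟩ | ⟨-, rfl, -⟩ | ⟨-, -, rfl⟩ | ⟨-, rfl, -⟩ |
        ⟨-, -, rfl⟩ <;> simp
    push_cast
    omega
  have e1 : pairing (pushChain (pushMap g h) P) k = ∑ t ∈ window h n, triCount g h P t * c t := by
    have e : ∀ T ∈ P, cobd k (pushMap g h T.1) (pushMap g h T.2.1) (pushMap g h T.2.2) =
        ∑ t ∈ window h n, (if Inside T (g '' closedBall 0 3) then
          triangleInd t (label g h T.1) (label g h T.2.1) (label g h T.2.2) else 0) * c t := by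
      intro T hT
      obtain ⟨d1, d2, d3⟩ := hP T hT
      by_cases hI : Inside T (g '' closedBall 0 3)
      · simp only [if_pos hI]
        rw [pushMap_of_mem hI.1, pushMap_of_mem hI.2.1, pushMap_of_mem hI.2.2]
        have a1 : BrickAdj (label g h T.1) (label g h T.2.1) :=
        brickAdj_brick (brickAdj_label hh (H2 _ hI.1 _ hI.2.1 d1))
        have a2 : BrickAdj (label g h T.2.1) (label g h T.2.2) :=
        brickAdj_brick (brickAdj_label hh (H2 _ hI.2.1 _ hI.2.2 d2))
        have a3 : BrickAdj (label g h T.1) (label g h T.2.2) :=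
        brickAdj_brick (brickAdj_label hh (H2 _ hI.1 _ hI.2.2 d3))
        refine cobd_eq_sum_triangles hκs (window h n) a1 a2 a3 fun t _ ht => ?_
        by_contra hne
        exact ht (hmem t hne)
      · simp only [if_neg hI, zero_mul, Finset.sum_const_zero]
        have key : ∀ x, pushMap g h x ∈ g '' closedBall 0 (7 / 4) → ∀ y, dist y x < ε →
            y ∈ g '' closedBall 0 3 := by
          rintro x ⟨z, hz, e⟩ y hy
          refine H1 z hz y ?_
          have h1 := Hπ x
          rw [← e] at h1
          linarith [dist_triangle y x (g z), dist_comm (g z) x]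
        have hε : 0 < ε := dist_nonneg.trans_lt d1
        have z1 : k (pushMap g h T.1) (pushMap g h T.2.1) = 0 := by
          by_contra hne
          have hm := (hks _ _ hne).1
          exact hI ⟨key _ hm _ (by simpa), key _ hm _ (by rwa [dist_comm]),
            key _ hm _ (by rwa [dist_comm])⟩
        have z2 : k (pushMap g h T.2.1) (pushMap g h T.2.2) = 0 := by
          by_contra hne
          have hm := (hks _ _ hne).1
          exact hI ⟨key _ hm _ d1, key _ hm _ (by simpa), key _ hm _ (by rwa [dist_comm])⟩
        have z3 : k (pushMap g h T.1) (pushMap g h T.2.2) = 0 := by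
          by_contra hne
          have hm := (hks _ _ hne).1
          exact hI ⟨key _ hm _ (by simpa), key _ hm _ (by rwa [dist_comm]),
            key _ hm _ (by rwa [dist_comm])⟩
        simp only [cobd, z1, z2, z3, add_zero]
    rw [pairing, pushChain, List.map_map]
    have : ((P.map (fun T => ∑ t ∈ window h n, (if Inside T (g '' closedBall 0 3) then
          triangleInd t (label g h T.1) (label g h T.2.1) (label g h T.2.2) else 0) * c t)).sum) =
          ∑ t ∈ window h n, triCount g h P t * c t := by
      simp only [triCount]
      clear e hP hmem hsum
      induction P with
      | nil => simp
      | cons T P ih =>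
        simp only [List.map_cons, List.sum_cons, ih, add_mul, Finset.sum_add_distrib]
    rw [← this]
    congr 1
    exact List.map_congr_left e
  have e2 : pairing (missing g h n P) k = ∑ t ∈ window h n, (1 + triCount g h P t) * c t := by
    rw [pairing, sum_missing]
    rfl
  -- After completion each triangle of the window occurs an odd number of times, so the pairing is
  -- the sum of `c` over the window. All nonzero terms of the closed sum over the box lie in the
  -- window, so this sum is 0.
  rw [fillChain, pairing_append, e1, e2, ← Finset.sum_add_distrib, ← hsum]
  refine Finset.sum_congr rfl fun t _ => ?_
  grind

end Push

lemma exists_pos_forall_le {ι : Type*} [Finite ι] {f : ι → ℝ} (hf : ∀ i, 0 < f i) :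
    ∃ r > 0, ∀ i, r ≤ f i := by
  cases isEmpty_or_nonempty ι
  · exact ⟨1, one_pos, fun i => isEmptyElim i⟩
  · obtain ⟨i, hi⟩ := Finite.exists_min f
    exact ⟨f i, hf i, hi⟩

lemma mem_window {h : ℝ} (hh : 0 < h) (hh' : h < 1 / 16) {n : ℕ} (hn : 5 / h ≤ n)
    {t : ℤ × ℤ × Bool} (ht : h • triplePoint t ∈ closedBall (0 : ℂ) (5 / 2)) : t ∈ window h n := by
  classical
  refine Finset.mem_filter.2 ⟨?_, ht⟩
  rw [mem_closedBall_zero_iff, norm_smul, Real.norm_of_nonneg hh.le] at ht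
  have h1 : ‖triplePoint t‖ ≤ 5 / 2 / h := by rw [le_div_iff₀ hh]; linarith
  have h2 := (Complex.abs_re_le_norm (triplePoint t)).trans h1
  have h3 := (Complex.abs_im_le_norm (triplePoint t)).trans h1
  rw [abs_le] at h2 h3
  have h4 : 16 ≤ 1 / h := by rw [le_div_iff₀ hh]; linarith
  have h5 : 5 * (1 / h) ≤ n := by rw [← div_eq_mul_one_div]; exact hn
  have h6 : 5 / 2 / h = 5 / 2 * (1 / h) := by ring
  rw [h6] at h2 h3
  obtain ⟨i, j, s⟩ := t
  simp only [box, Finset.mem_product, Finset.mem_Ico, Finset.mem_univ, and_true]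
  have key : -(n : ℝ) ≤ i ∧ (i : ℝ) < n ∧ -(n : ℝ) ≤ j ∧ (j : ℝ) < n := by
    cases s <;> simp only [triplePoint] at h2 h3 <;> refine ⟨?_, ?_, ?_, ?_⟩ <;> linarith
  obtain ⟨k1, k2, k3, k4⟩ := key
  have l1 : -(n : ℤ) ≤ i := by exact_mod_cast k1
  have l2 : i < n := by exact_mod_cast k2
  have l3 : -(n : ℤ) ≤ j := by exact_mod_cast k3
  have l4 : j < n := by exact_mod_cast k4
  push_cast
  omega

/-! ### Fundamental chains of small mesh -/

section Fundamental

variable {X ι : Type*} [MetricSpace X]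

/-- There are arbitrarily fine 2-chains without boundary in the open set `O` whose local degree
at each point of `O` is one. -/
def HasFundamental (F : ι → ℂ → X) (O : Set X) : Prop :=
  ∃ r₁ > 0, ∀ r > 0, r < r₁ → ∀ ε > 0, ∃ P : List (X × X × X), FineChain P ε ∧ NoBdry P O ∧
    ∀ i, ∀ p ∈ closedBall (0 : ℂ) 3, ball (F i p) (2 * r) ⊆ O → deg (F i) p r P = 1

/-- Local degrees do not change when the vertices are moved a little. -/
lemma deg_pushChain {f : ℂ → X} {p : ℂ} {r e ε : ℝ} {P : List (X × X × X)} {π : X → X}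
    (he : e ≤ r / 8) (hε : ε ≤ e / 8)
    (hcoc : IsCocycleOn (chi f p) {x | dist x (f p) < 4 * r ∧ r / 4 ≤ dist x (f p)} e)
    (hπ : ∀ x, dist (π x) x < e / 8) (hP : FineChain P ε) (hN : NoBdry P (ball (f p) (2 * r))) :
    deg f p r (pushChain π P) = deg f p r P := by
  have hd : ∀ x y, dist x y < ε → dist (π x) (π y) < e / 2 := fun x y hxy => by
    have h1 := hπ x
    have h2 := hπ y
    have h3 := dist_nonneg.trans_lt h1
    rw [dist_comm] at h2
    linarith [dist_triangle4 (π x) x y (π y)]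
  have hx0 : ∀ x, dist (π x) (f p) ≤ dist x (f p) + e / 8 ∧
      dist x (f p) ≤ dist (π x) (f p) + e / 8 := fun x =>
    ⟨by linarith [dist_triangle (π x) x (f p), hπ x],
      by linarith [dist_triangle_left x (f p) (π x), hπ x]⟩
  rw [deg, holePairing_pushChain]
  -- First the hole pulled back by π is replaced by the ball itself, the two differing only where
  -- the cochain is closed; then the pulled-back cochain is replaced by the original one.
  trans holePairing P (fun a b => chi f p (π a) (π b)) (ball (f p) r)
  · have key : ∀ T ∈ P, (∃ x, dist x (f p) < 2 * r ∧ dist T.1 x < ε ∧ dist T.2.1 x < ε ∧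
        dist T.2.2 x < ε) → (r / 4 ≤ dist (π T.1) (f p)) → (r / 4 ≤ dist (π T.2.1) (f p)) →
        (r / 4 ≤ dist (π T.2.2) (f p)) →
        cobd (fun a b => chi f p (π a) (π b)) T.1 T.2.1 T.2.2 = 0 := by
      rintro T hT ⟨x, hx, e1, e2, e3⟩ g1 g2 g3
      obtain ⟨d1, d2, d3⟩ := hP T hT
      have hr : 0 < e := by linarith [dist_nonneg.trans_lt (hπ x)]
      refine hcoc (π T.1) ⟨?_, g1⟩ (π T.2.1) ⟨?_, g2⟩ (π T.2.2) ⟨?_, g3⟩ ?_ ?_ ?_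
      · linarith [(hx0 T.1).1, dist_triangle T.1 x (f p)]
      · linarith [(hx0 T.2.1).1, dist_triangle T.2.1 x (f p)]
      · linarith [(hx0 T.2.2).1, dist_triangle T.2.2 x (f p)]
      · linarith [hd _ _ d1]
      · linarith [hd _ _ d2]
      · linarith [hd _ _ d3]
    refine holePairing_mono (fun T hT hm hn => ?_) (fun T hT hm hn => ?_)
    · obtain ⟨x, hx, e1, e2, e3⟩ := hm.near (hP T hT)
      simp only [Meets, mem_ball, not_or, not_lt] at hn
      rw [mem_preimage, mem_ball] at hx
      have h0 := hπ x
      have := dist_nonneg.trans_lt h0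
      refine key T hT ⟨x, ?_, e1, e2, e3⟩ ?_ ?_ ?_
      · linarith [(hx0 x).2]
      · linarith [(hx0 T.1).2]
      · linarith [(hx0 T.2.1).2]
      · linarith [(hx0 T.2.2).2]
    · obtain ⟨x, hx, e1, e2, e3⟩ := hm.near (hP T hT)
      simp only [Meets, mem_preimage, mem_ball, not_or, not_lt] at hn
      rw [mem_ball] at hx
      have := dist_nonneg.trans_lt hx
      exact key T hT ⟨x, by linarith, e1, e2, e3⟩ (by linarith) (by linarith) (by linarith)
  -- The potential is the prism operator between the identity and π: two small triangles fill the
  -- quadrilateral x, y, π y, π x.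
  · refine holePairing_eq hP hN ((symmNorm_chi f p).comp π) (symmNorm_chi f p)
      (fun x => chi f p x (π x)) (fun x hx y hy hx' hy' hxy => ?_) (fun x hx y hxy => ?_)
    · rw [mem_ball] at *
      rw [not_lt] at hx' hy'
      have p1 := hπ x
      have p2 := hπ y
      have he0 : 0 < e := by linarith [dist_nonneg.trans_lt p1]
      rw [dist_comm] at p1 p2
      have m1 : x ∈ {x | dist x (f p) < 4 * r ∧ r / 4 ≤ dist x (f p)} := ⟨by linarith, by linarith⟩
      have m2 : y ∈ {x | dist x (f p) < 4 * r ∧ r / 4 ≤ dist x (f p)} := ⟨by linarith, by linarith⟩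
      have m3 : π x ∈ {x | dist x (f p) < 4 * r ∧ r / 4 ≤ dist x (f p)} :=
        ⟨by linarith [(hx0 x).1], by linarith [(hx0 x).2]⟩
      have m4 : π y ∈ {x | dist x (f p) < 4 * r ∧ r / 4 ≤ dist x (f p)} :=
        ⟨by linarith [(hx0 y).1], by linarith [(hx0 y).2]⟩
      have hxy' := hd x y hxy
      have c1 := hcoc x m1 y m2 (π y) m4 (by linarith) (by linarith)
        (by linarith [dist_triangle x y (π y)])
      have c2 := hcoc x m1 (π x) m3 (π y) m4 (by linarith) (by linarith)
        (by linarith [dist_triangle x y (π y)])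
      unfold cobd at c1 c2
      grind
    · rw [mem_ball] at *
      have := dist_nonneg.trans_lt hx
      rw [dist_comm] at hxy
      linarith [dist_triangle y x (f p)]

/-- A chain that is fundamental on O is pushed to brick centres in the disc of radius 3 of the
chart, then completed by the triangles hit an even number of times. Over O all triangles are already
hit an odd number of times, because the count is the local degree; so nothing is added near K. Well
inside the disc all triangles become odd, so there the chain has no boundary and degree 1. -/
theorem HasFundamental.step [Finite ι] {F : ι → ℂ → X} (hF : ∀ i, IsOpenEmbedding (F i))
    {O K : Set X} (hO : IsOpen O) (hK : IsCompact K) (hKO : K ⊆ O) (h : HasFundamental F O)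
    (a : ι) : ∃ O', IsOpen O' ∧ K ⊆ O' ∧ F a '' closedBall 0 1 ⊆ O' ∧ HasFundamental F O' := by
  classical
  obtain ⟨r₁, hr₁, hfund⟩ := h
  set g := F a with hgdef
  have hg : IsOpenEmbedding g := hF a
  obtain ⟨δ', hδ', hδO⟩ := hK.exists_thickening_subset_open hO hKO
  -- Three nested neighbourhoods: the new open set uses radius δ about K, added triangles stay
  -- outside radius 2δ, and radius 3δ is inside O.
  obtain ⟨δ, hδ, hδ3⟩ : ∃ δ > 0, 3 * δ ≤ δ' := ⟨δ' / 3, by positivity, by linarith⟩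
  replace hδO : thickening (3 * δ) K ⊆ O := (thickening_mono hδ3 K).trans hδO
  have hthick : ∀ {s t : ℝ} {x y : X}, x ∈ thickening s K → dist y x < t → y ∈ thickening (s + t) K := by
    intro s t x y hx hy
    rw [mem_thickening_iff] at *
    obtain ⟨z, hz, hxz⟩ := hx
    exact ⟨z, hz, by linarith [dist_triangle y x z]⟩
  obtain ⟨lam, hlam, Hlam⟩ := exists_modulus_inv hg 3 (show (0 : ℝ) < 1 / 4 by norm_num)
  choose ρ hρ Hρ using fun i => deg_eq_deg (hF i) hg 3
  obtain ⟨r₂, hr₂, hr₂'⟩ := exists_pos_forall_le hρ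
  choose σ hσ Hσ using fun i => isCocycleOn_chi (hF i) 3
  obtain ⟨r₃, hr₃, hr₃'⟩ := exists_pos_forall_le hσ
  refine ⟨thickening δ K ∪ g '' ball 0 (3 / 2), isOpen_thickening.union (hg.isOpenMap _ isOpen_ball),
    (self_subset_thickening hδ K).trans subset_union_left,
    (image_mono (closedBall_subset_ball (by norm_num))).trans subset_union_right,
    min (min r₁ r₂) (min (r₃ / 8) (min (lam / 8) (δ / 8))), by positivity, fun r hr hr' ε hε => ?_⟩
  simp only [lt_min_iff] at hr'
  obtain ⟨⟨hrr1, hrr2⟩, hrr3, hrrl, hrrd⟩ := hr'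
  choose e1 he1 He1 using fun i => Hρ i r hr (hrr2.trans_le (hr₂' i))
  obtain ⟨ε₁, hε₁, hε₁'⟩ := exists_pos_forall_le he1
  choose e2 he2 He2 using fun i => Hσ i (r / 4) (by positivity)
  obtain ⟨ε₂', hε₂', hε₂''⟩ := exists_pos_forall_le he2
  obtain ⟨ε₂, hε₂, hε₂i, hε₂r⟩ : ∃ ε₂ > 0, (∀ i, ε₂ ≤ e2 i) ∧ ε₂ ≤ r / 8 :=
    ⟨min ε₂' (r / 8), by positivity, fun i => (min_le_left _ _).trans (hε₂'' i), min_le_right _ _⟩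
  obtain ⟨η, hη, hηε, hηr, hηd, hηl, hη1, hη2⟩ : ∃ η > 0, η ≤ ε / 4 ∧ η ≤ r ∧ η ≤ δ / 8 ∧
      η ≤ lam / 8 ∧ η ≤ ε₁ / 4 ∧ η ≤ ε₂ / 8 :=
    ⟨min (min (min (ε / 4) r) (min (δ / 8) (lam / 8))) (min (ε₁ / 4) (ε₂ / 8)), by positivity,
      (min_le_left _ _).trans ((min_le_left _ _).trans (min_le_left _ _)),
      (min_le_left _ _).trans ((min_le_left _ _).trans (min_le_right _ _)),
      (min_le_left _ _).trans ((min_le_right _ _).trans (min_le_left _ _)),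
      (min_le_left _ _).trans ((min_le_right _ _).trans (min_le_right _ _)),
      (min_le_right _ _).trans (min_le_left _ _), (min_le_right _ _).trans (min_le_right _ _)⟩
  obtain ⟨h₀, hh₀, Hh₀⟩ := exists_modulus hg 4 hη
  obtain ⟨m, hm, hm1, hm2⟩ : ∃ m > 0, m < 1 / 16 ∧ 4 * m ≤ h₀ :=
    ⟨min (1 / 32) (h₀ / 4), by positivity, (min_le_left _ _).trans_lt (by norm_num),
      by linarith [min_le_right (1 / 32) (h₀ / 4)]⟩
  obtain ⟨ε₀, hε₀, Hε₀⟩ := exists_modulus_inv hg 4 (half_pos hm)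
  obtain ⟨ε', hε', hε'0, hε'η⟩ : ∃ ε' > 0, ε' ≤ ε₀ ∧ ε' ≤ η :=
    ⟨min ε₀ η, by positivity, min_le_left _ _, min_le_right _ _⟩
  obtain ⟨n, hn⟩ := exists_nat_ge (5 / m)
  obtain ⟨P, hPf, hPN, hPd⟩ := hfund r hr hrr1 ε' hε'
  have hball : ∀ {s : ℝ} {z w : ℂ} {d : ℝ}, z ∈ closedBall (0 : ℂ) s → dist w z ≤ d →
      w ∈ closedBall (0 : ℂ) (s + d) := by
    intro s z w d hz hw
    rw [mem_closedBall] at *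
    linarith [dist_triangle w z 0]
  have hball4 : ∀ {s : ℝ}, s ≤ 4 → closedBall (0 : ℂ) s ⊆ closedBall 0 4 :=
    fun hs => closedBall_subset_closedBall hs
  have Hπ : ∀ x, dist (pushMap g m x) x < η := by
    intro x
    by_cases hx : x ∈ g '' closedBall 0 3
    · rw [pushMap_of_mem hx]
      obtain ⟨z, hz, rfl⟩ := hx
      have h1 : dist (m • brickCenter (label g m (g z))) z ≤ m := by
        have h2 := dist_brickCenter_brick (m⁻¹ • z)
        rw [label, coord_apply hg]
        calc dist (m • brickCenter (brick (m⁻¹ • z))) z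
            = dist (m • brickCenter (brick (m⁻¹ • z))) (m • m⁻¹ • z) := by
              rw [smul_inv_smul₀ hm.ne']
          _ = m * dist (m⁻¹ • z) (brickCenter (brick (m⁻¹ • z))) := by
              rw [dist_smul₀, Real.norm_of_nonneg hm.le, dist_comm]
          _ ≤ m * 1 := by gcongr
          _ = m := mul_one m
      exact Hh₀ _ (hball4 (by linarith) (hball hz h1)) _ (hball4 (by norm_num) hz) (by linarith)
    · rw [pushMap, if_neg hx, dist_self]; exact hη
  have H3 : ∀ t, m • triplePoint t ∈ closedBall (0 : ℂ) (5 / 2) →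
      ∀ z, dist z (m • triplePoint t) ≤ 2 * m → dist (g z) (g (m • triplePoint t)) < η :=
    fun t ht z hz => Hh₀ _ (hball4 (by linarith) (hball ht hz)) _ (hball4 (by norm_num) ht)
      (by linarith)
  have H1 : ∀ z ∈ closedBall (0 : ℂ) (5 / 2), ∀ x, dist x (g z) < lam → x ∈ g '' closedBall 0 3 := by
    intro z hz x hx
    obtain ⟨w, rfl, hw⟩ := Hlam z (closedBall_subset_closedBall (by norm_num) hz) x hx
    exact ⟨w, closedBall_subset_closedBall (by norm_num) (hball hz hw.le), rfl⟩
  have H2 : ∀ x ∈ g '' closedBall 0 3, ∀ y ∈ g '' closedBall 0 3, dist x y < ε' →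
      dist (coord g x) (coord g y) < m / 2 := by
    rintro _ ⟨z, hz, rfl⟩ _ ⟨w, hw, rfl⟩ hzw
    obtain ⟨z', e, hz'⟩ := Hε₀ w (hball4 (by norm_num) hw) (g z) (by linarith)
    rw [hg.injective e] at hz'
    rwa [coord_apply hg, coord_apply hg]
  have hwin : ∀ t ∈ window m n, m • triplePoint t ∈ closedBall (0 : ℂ) (5 / 2) :=
    fun t ht => (Finset.mem_filter.1 ht).2
  have h53 : closedBall (0 : ℂ) (5 / 2) ⊆ closedBall 0 3 := closedBall_subset_closedBall (by norm_num)
  -- The count of a triangle is the local degree at its triple point, which is 1 over O.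
  have hcount : ∀ t ∈ window m n, ball (g (m • triplePoint t)) (2 * r) ⊆ O →
      triCount g m P t = 1 := by
    intro t ht htO
    have ht' := hwin t ht
    rw [← hPd a (m • triplePoint t) (h53 ht') htO]
    refine (deg_eq_triCount hg hm hPf (hPN.mono htO) (by linarith)
      (fun x hx => H1 _ ht' x (by linarith)) H2
      (fun z hz => (H3 t ht' z hz).trans_le hηr) ?_).symm
    intro x y hx hx' hy hy' hxy
    exact (He2 a _ (h53 ht')).2 x y (by linarith [hr₃' a]) (by linarith) (by linarith [hr₃' a])
      (by linarith) (by linarith [hε₂i a])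
  have hfar : ∀ t ∈ window m n, triCount g m P t = 0 → ∀ u v w, IsTriangle t u v w →
      node g m u ∉ thickening (2 * δ) K := by
    intro t ht h0 u v w huvw hu
    have h1 := H3 t (hwin t ht) _ (dist_node_triplePoint hm huvw)
    rw [dist_comm] at h1
    have h2 := hcount t ht fun y hy => hδO (thickening_mono (by linarith) K
      (hthick (hthick hu h1) hy))
    rw [h0] at h2
    exact zero_ne_one h2
  have hfine : FineChain (fillChain g m n P) (ε' + 2 * η) :=
    fillChain_fine hε' hPf Hπ fun t ht u v w huvw =>
      H3 t (hwin t ht) _ (dist_node_triplePoint hm huvw)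
  have hNo : NoBdry (fillChain g m n P) (thickening δ K ∪ g '' ball 0 (3 / 2)) := by
    intro k hk hks
    set G := g '' closedBall 0 (7 / 4) with hG
    -- A test cochain is split into its part on the disc of radius 7 / 4, which pairs to 0 because
    -- the lattice is full there, and the rest on short edges. Such an edge with an end in the disc
    -- of radius 3 / 2 belongs to the first part, so the rest lives near K, where no triangle was
    -- added and the old chain has no boundary.
    set k1 : X → X → ZMod 2 := fun x y => if x ∈ G ∧ y ∈ G then k x y else 0 with hk1
    set k2 : X → X → ZMod 2 := fun x y => if dist x y < ε' + 2 * η ∧ ¬ (x ∈ G ∧ y ∈ G) then k x y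
      else 0 with hk2
    have hk1s : SymNorm k1 := by
      convert hk.ite (P := fun x y => x ∈ G ∧ y ∈ G) (fun x y => and_comm)
    have hk2s : SymNorm k2 := by
      convert hk.ite (P := fun x y => dist x y < ε' + 2 * η ∧ ¬ (x ∈ G ∧ y ∈ G))
        (fun x y => by rw [dist_comm, and_comm (a := x ∈ G)])
    have e : pairing (fillChain g m n P) k =
        pairing (fillChain g m n P) (fun x y => k1 x y + k2 x y) := by
      refine pairing_congr fun T hT => ?_
      obtain ⟨d1, d2, d3⟩ := hfine T hT
      have : ∀ x y, dist x y < ε' + 2 * η → k x y = k1 x y + k2 x y := by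
        intro x y hxy
        by_cases hxyG : x ∈ G ∧ y ∈ G
        · simp only [hk1, hk2, hxyG, and_self, not_true, and_false, if_true, if_false, add_zero]
        · simp only [hk1, hk2, hxyG, hxy, not_false_iff, and_self, if_true, if_false, zero_add]
      simp only [cobd, ← this _ _ d1, ← this _ _ d2, ← this _ _ d3]
    have hk2K : ∀ x y, k2 x y ≠ 0 → x ∈ thickening δ K ∧ y ∈ thickening δ K := by
      have key : ∀ x y, dist x y < ε' + 2 * η → ¬ (x ∈ G ∧ y ∈ G) →
          x ∈ thickening δ K ∪ g '' ball 0 (3 / 2) → x ∈ thickening δ K := by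
        rintro x y hxy hn (hx | ⟨z, hz, rfl⟩)
        · exact hx
        · refine absurd ⟨⟨z, ball_subset_closedBall (ball_subset_ball (by norm_num) hz), rfl⟩, ?_⟩ hn
          rw [dist_comm] at hxy
          have hz' := ball_subset_closedBall hz
          obtain ⟨w, rfl, hw⟩ := Hlam z (closedBall_subset_closedBall (by norm_num) hz') y
            (by linarith)
          exact ⟨w, closedBall_subset_closedBall (by norm_num) (hball hz' hw.le), rfl⟩
      intro x y hxy
      simp only [hk2, ne_eq, ite_eq_right_iff, Classical.not_imp] at hxy
      obtain ⟨⟨hd, hn⟩, hne⟩ := hxy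
      have := hks x y hne
      exact ⟨key x y hd hn this.1, key y x (by rwa [dist_comm]) (fun h => hn h.symm) this.2⟩
    rw [e, pairing_add, pairing_fillChain hg hm hm1 ((by gcongr; norm_num : 3 / m ≤ 5 / m).trans hn)
      hPf Hπ (fun z hz x hx => H1 z (closedBall_subset_closedBall (by norm_num) hz) x (by linarith))
      H2 hk1s ?_, zero_add, fillChain, pairing_append, pairing_pushChain, hPN _ (hk2s.comp _) ?_,
      zero_add]
    · refine list_sum_eq_zero fun T hT => ?_
      obtain ⟨t, ht, h0, rfl⟩ := mem_missing hT
      have hz : ∀ u v w y, IsTriangle t u v w → k2 (node g m u) y = 0 := fun u v w y huvw => by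
        by_contra hne
        exact hfar t ht h0 u v w huvw (thickening_mono (by linarith) K (hk2K _ _ hne).1)
      simp only [nodeTriangle, cobd]
      rw [hz _ _ _ _ (isTriangle_self t), hz _ _ _ _ (isTriangle_self t).perm,
        hz _ _ _ _ (isTriangle_self t), add_zero, add_zero]
    · intro x y hxy
      have := hk2K _ _ hxy
      have hπ' : ∀ x, dist x (pushMap g m x) < η := fun x => by rw [dist_comm]; exact Hπ x
      exact ⟨hδO (thickening_mono (by linarith) K (hthick this.1 (hπ' x))),
        hδO (thickening_mono (by linarith) K (hthick this.2 (hπ' y)))⟩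
    · intro x y hxy
      simp only [hk1, ne_eq, ite_eq_right_iff, Classical.not_imp] at hxy
      exact hxy.1
  refine ⟨fillChain g m n P, hfine.mono (by linarith), hNo, fun i p hp hpO => ?_⟩
  have hpO' := hpO (mem_ball_self (by positivity))
  rcases hpO' with hpK | ⟨q, hq, hqp⟩
  -- Near K the added triangles do not meet the hole, and pushing does not change the degree.
  · have hbO : ball (F i p) (2 * r) ⊆ O := fun y hy =>
      hδO (thickening_mono (by linarith) K (hthick hpK hy))
    have e1 : deg (F i) p r (missing g m n P) = 0 := by
      refine list_sum_eq_zero fun T hT => if_neg fun hm => ?_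
      obtain ⟨t, ht, h0, rfl⟩ := mem_missing hT
      have key : ∀ u v w, IsTriangle t u v w → node g m u ∉ ball (F i p) r := fun u v w huvw hu =>
        hfar t ht h0 u v w huvw (thickening_mono (by linarith) K (hthick hpK hu))
      rcases hm with hm | hm | hm
      · exact key _ _ _ (isTriangle_self t) hm
      · exact key _ _ _ (isTriangle_self t).perm hm
      · exact key _ _ _ (isTriangle_self t).perm.perm hm
    have e2 : deg (F i) p r (pushChain (pushMap g m) P) = 1 := by
      rw [deg_pushChain hε₂r (hε'η.trans hη2) (((He2 i p hp).1).mono ?_ (hε₂i i))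
        (fun x => (Hπ x).trans_le hη2) hPf (hPN.mono hbO), hPd i p hp hbO]
      exact fun x hx => ⟨hx.1.trans (by linarith [hr₃' i]), hx.2⟩
    unfold deg at *
    rw [fillChain, holePairing_append, e1, e2, add_zero]
  -- In the disc the degree is compared with the degree at a nearby triple point, where it was
  -- computed to be 1.
  · obtain ⟨ii, jj, hij⟩ : ∃ i j : ℤ, dist (m • triplePoint (i, j, false)) q ≤ 2 * m := by
      refine ⟨(brick (m⁻¹ • q)).1, (brick (m⁻¹ • q)).2, ?_⟩
      have h2 := exists_triplePoint_near (m⁻¹ • q)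
      calc dist (m • triplePoint ((brick (m⁻¹ • q)).1, (brick (m⁻¹ • q)).2, false)) q
          = dist (m • triplePoint ((brick (m⁻¹ • q)).1, (brick (m⁻¹ • q)).2, false))
            (m • m⁻¹ • q) := by rw [smul_inv_smul₀ hm.ne']
        _ ≤ 2 * m := by
          rw [dist_smul₀, Real.norm_of_nonneg hm.le]
          nlinarith
    have hq' := ball_subset_closedBall hq
    have htw : m • triplePoint (ii, jj, false) ∈ closedBall (0 : ℂ) (5 / 2) :=
      closedBall_subset_closedBall (by linarith) (hball hq' hij)
    have htW := mem_window hm hm1 hn htw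
    have hd : dist (F i p) (g (m • triplePoint (ii, jj, false))) < η := by
      rw [← hqp]
      refine H3 _ htw q ?_
      rwa [dist_comm]
    rw [He1 i p hp _ (h53 htw) (by linarith [hε₁' i]) _ (hfine.mono (by linarith [hε₁' i]))
      (hNo.mono ((ball_subset_ball (by linarith)).trans hpO))]
    exact deg_fillChain hg hm hPf htW (by linarith) hηr Hπ
      (fun x hx => H1 _ htw x (by linarith)) H2 (fun z hz => (H3 _ htw z hz).trans_le hηr)

/-- A compact surface has fundamental cycles mod 2 of arbitrarily small mesh. -/
theorem hasFundamental_univ [Finite ι] {F : ι → ℂ → X} (hF : ∀ i, IsOpenEmbedding (F i))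
    (hcov : ⋃ i, F i '' closedBall 0 1 = univ) : HasFundamental F univ := by
  classical
  have := Fintype.ofFinite ι
  have key : ∀ s : Finset ι, ∃ O, IsOpen O ∧ (∀ j ∈ s, F j '' closedBall 0 1 ⊆ O) ∧
      HasFundamental F O := by
    intro s
    induction s using Finset.induction_on with
    | empty =>
      refine ⟨∅, isOpen_empty, by simp, 1, one_pos, fun r hr _ ε hε => ⟨[], ?_, ?_, ?_⟩⟩
      · intro T hT; simp at hT
      · intro k _ _; simp [pairing]
      · intro i p _ h
        exact absurd (h (mem_ball_self (by positivity))) (notMem_empty _)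
    | insert a s _ ih =>
      obtain ⟨O, hO, hs, hO'⟩ := ih
      obtain ⟨O₁, h1, h2, h3, h4⟩ := hO'.step hF hO
        (K := ⋃ j ∈ s, F j '' closedBall 0 1)
        (s.isCompact_biUnion fun j _ => (isCompact_closedBall 0 1).image (hF j).continuous)
        (iUnion₂_subset hs) a
      refine ⟨O₁, h1, fun j hj => ?_, h4⟩
      rcases Finset.mem_insert.1 hj with rfl | hj
      · exact h3
      · exact (subset_biUnion_of_mem (u := fun j => F j '' closedBall 0 1) hj).trans h2
  obtain ⟨O, -, h1, h2⟩ := key Finset.univ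
  have : O = univ := univ_subset_iff.1 (hcov ▸ iUnion_subset fun j => h1 j (Finset.mem_univ j))
  rwa [this] at h2

end Fundamental

/-! ### Linear duality between cycles and cocycles -/

section Duality

variable {X : Type*} [PseudoMetricSpace X]

/-- A 1-cycle pairs nontrivially with a cocycle unless it bounds. -/
theorem exists_cocycle_or_chain (ε : ℝ) (Z : List (X × X)) :
    (∃ ψ : X → X → ZMod 2, SymNorm ψ ∧ IsCocycleOn ψ univ ε ∧ (Z.map fun e => ψ e.1 e.2).sum = 1) ∨
    ∃ Q, FineChain Q ε ∧ ∀ k : X → X → ZMod 2, SymNorm k →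
      pairing Q k = (Z.map fun e => k e.1 e.2).sum := by
  classical
  have : Fact (Nat.Prime 2) := ⟨Nat.prime_two⟩
  set e : X → X → (X × X →₀ ZMod 2) := fun a b => Finsupp.single (a, b) 1 with he
  -- `B` is spanned by the boundaries of small triples, together with the relations that symmetric
  -- normalized cochains satisfy. A 1-cycle in `B` bounds a fine chain; otherwise a linear
  -- functional kills `B` but not the cycle, and its values on edges form the cocycle.
  set B : Submodule (ZMod 2) (X × X →₀ ZMod 2) := Submodule.span (ZMod 2)
    ({m | ∃ a b c, dist a b < ε ∧ dist b c < ε ∧ dist a c < ε ∧ m = e a b + e b c + e a c} ∪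
      ({m | ∃ a b, m = e a b + e b a} ∪ {m | ∃ a, m = e a a})) with hB
  set z : X × X →₀ ZMod 2 := (Z.map fun p => e p.1 p.2).sum with hz
  by_cases hzB : z ∈ B
  · right
    let lin : (X → X → ZMod 2) → (X × X →₀ ZMod 2) →ₗ[ZMod 2] ZMod 2 := fun k =>
      Finsupp.lift (ZMod 2) (ZMod 2) (X × X) fun p => k p.1 p.2
    have hlin : ∀ k a b, lin k (e a b) = k a b := fun k a b => by
      simp [lin, he, Finsupp.lift_apply]
    have key : ∀ m ∈ B, ∃ Q, FineChain Q ε ∧ ∀ k : X → X → ZMod 2, SymNorm k →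
        pairing Q k = lin k m := by
      intro m hm
      induction hm using Submodule.span_induction with
      | mem m hm =>
        rcases hm with ⟨a, b, c, h1, h2, h3, rfl⟩ | ⟨a, b, rfl⟩ | ⟨a, rfl⟩
        · refine ⟨[(a, b, c)], ?_, fun k hk => ?_⟩
          · intro T hT
            rw [List.mem_singleton] at hT
            subst hT
            exact ⟨h1, h2, h3⟩
          · simp only [pairing, List.map_cons, List.map_nil, List.sum_cons, List.sum_nil, cobd,
              map_add, hlin, add_zero]
        · refine ⟨[], by intro T hT; simp at hT, fun k hk => ?_⟩
          rw [map_add, hlin, hlin, hk.symm b a, zmod_two_add_self]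
          simp [pairing]
        · refine ⟨[], by intro T hT; simp at hT, fun k hk => ?_⟩
          rw [hlin, hk.diag]
          simp [pairing]
      | zero => exact ⟨[], by intro T hT; simp at hT, fun k hk => by simp [pairing]⟩
      | add x y _ _ hx hy =>
        obtain ⟨P, hP, hP'⟩ := hx
        obtain ⟨Q, hQ, hQ'⟩ := hy
        exact ⟨P ++ Q, fineChain_append hP hQ, fun k hk => by
          rw [pairing_append, hP' k hk, hQ' k hk, map_add]⟩
      | smul a x _ hx =>
        rcases zmod_two_cases a with rfl | rfl
        · exact ⟨[], by intro T hT; simp at hT, fun k hk => by simp [pairing]⟩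
        · simpa using hx
    obtain ⟨Q, hQ, hQ'⟩ := key z hzB
    refine ⟨Q, hQ, fun k hk => ?_⟩
    rw [hQ' k hk, hz, map_list_sum, List.map_map]
    simp only [Function.comp_def, hlin]
  · left
    obtain ⟨f, hf, hBf⟩ := Submodule.exists_le_ker_of_notMem hzB
    have h0 : ∀ m ∈ B, f m = 0 := fun m hm => LinearMap.mem_ker.1 (hBf hm)
    refine ⟨fun a b => f (e a b), ⟨fun a b => ?_, fun a => ?_⟩, fun a _ b _ c _ h1 h2 h3 => ?_, ?_⟩
    · have := h0 _ (Submodule.subset_span (Or.inr (Or.inl ⟨a, b, rfl⟩)))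
      rw [map_add] at this
      exact zmod_two_eq_of_add_eq_zero this
    · exact h0 _ (Submodule.subset_span (Or.inr (Or.inr ⟨a, rfl⟩)))
    · have := h0 _ (Submodule.subset_span (Or.inl ⟨a, b, c, h1, h2, h3, rfl⟩))
      rwa [map_add, map_add] at this
    · rw [hz, map_list_sum, List.map_map] at hf
      exact zmod_two_ne_zero hf

end Duality

lemma sum_range_telescope (f : ℕ → ZMod 2) (n : ℕ) :
    ((List.range n).map fun j => f j + f (j + 1)).sum = f 0 + f n := by
  induction n with
  | zero => simp [zmod_two_add_self]
  | succ n ih =>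
    rw [List.range_succ, List.map_append, List.sum_append, ih]
    simp only [List.map_cons, List.map_nil, List.sum_cons, List.sum_nil]
    grind

-- The two rays cancel to the right of 1, so the sum counts crossings of the segment [−1, 1], a
-- cochain localized near that segment. The imaginary axis crosses it once, at 0.
open Classical in
lemma segCross_imag (y y' : ℝ) : cross (-1) (y * Complex.I) (y' * Complex.I) +
    cross 1 (y * Complex.I) (y' * Complex.I) = (if 0 ≤ y then 1 else 0) + (if 0 ≤ y' then 1 else 0) := by
  have h11 : (1 : ZMod 2) + 1 = 0 := rfl
  have h1 : ¬ (1 : ℝ) ≤ 0 := by norm_num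
  simp only [cross, Complex.mul_im, Complex.mul_re, Complex.ofReal_re, Complex.ofReal_im,
    Complex.I_re, Complex.I_im, Complex.neg_re, Complex.neg_im, Complex.one_re, Complex.one_im,
    mul_zero, mul_one, zero_add, add_zero, neg_zero, sub_self, h1, and_false, or_self, if_false,
    Left.neg_nonpos_iff, zero_le_one, and_true]
  by_cases a : 0 ≤ y <;> by_cases b : 0 ≤ y' <;> simp [a, b, h11, not_le.1, not_lt.2] <;> grind

/-- A short edge beyond 1 crosses both rays or neither, so only edges near the segment contribute.
-/
lemma segCross_ne_zero {z w : ℂ} (h : dist z w < 1 / 4)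
    (hne : cross (-1) z w + cross 1 z w ≠ 0) : ‖z‖ < 2 ∧ ‖w‖ < 2 := by
  classical
  obtain ⟨h1, h2, h3, h4⟩ := re_im_bounds h
  have h11 : (1 : ZMod 2) + 1 = 0 := rfl
  have key : |z.re| ≤ 5 / 4 ∧ |z.im| ≤ 1 / 4 ∧ |w.re| ≤ 5 / 4 ∧ |w.im| ≤ 1 / 4 := by
    simp only [cross, Complex.neg_re, Complex.neg_im, Complex.one_re, Complex.one_im,
      neg_zero] at hne
    simp only [abs_le]
    by_contra hcon
    apply hne
    split_ifs with c1 c2 c2 <;> first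
      | rfl
      | exact h11
      | (exfalso; apply hcon; rcases c1 with c | c <;>
          refine ⟨⟨?_, ?_⟩, ⟨?_, ?_⟩, ⟨?_, ?_⟩, ⟨?_, ?_⟩⟩ <;> by_contra hx <;> grind)
      | (exfalso; apply hcon; rcases c2 with c | c <;>
          refine ⟨⟨?_, ?_⟩, ⟨?_, ?_⟩, ⟨?_, ?_⟩, ⟨?_, ?_⟩⟩ <;> by_contra hx <;> grind)
  have e1 := Complex.norm_le_abs_re_add_abs_im z
  have e2 := Complex.norm_le_abs_re_add_abs_im w
  exact ⟨by linarith, by linarith⟩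

/-! ### A class dual to a nonseparating curve -/

section Dual

variable {X ι : Type*} [MetricSpace X]

open Real in
/-- A curve that does not separate the two sides of its collar has a dual cohomology class. -/
theorem exists_dual_cocycle [Finite ι] {F : ι → ℂ → X} (hF : ∀ i, IsOpenEmbedding (F i))
    (hcov : ⋃ i, F i '' closedBall 0 1 = univ) (i₀ : ι) {c : Set X} (hc : IsClosed c)
    (hjoin : JoinedIn cᶜ (F i₀ (-1)) (F i₀ 1)) {γ : ℝ → X} (hγ : Continuous γ)
    (hγc : ∀ s, γ s ∈ c) (h1 : ∀ s ∈ Ioo (-(π / 2)) (π / 2), γ s = F i₀ (tan s * Complex.I))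
    (h2 : ∀ s ∈ Icc (-π) π, s ∉ Ioo (-(π / 2)) (π / 2) → γ s ∉ range (F i₀)) :
    ∃ ε > 0, ∃ ψ : X → X → ZMod 2, SymNorm ψ ∧ IsCocycleOn ψ univ ε ∧ HasInt ψ γ (-π) π 1 := by
  classical
  set col := F i₀ with hcol
  have hce : IsOpenEmbedding col := hF i₀
  obtain ⟨τ₀, hτ₀⟩ := hjoin
  have hτc : Continuous τ₀ := τ₀.continuous
  -- The path from one side of the curve to the other keeps a positive distance from c, so chains
  -- bounded by c have no boundary along it.
  obtain ⟨ρ, hρ, hρc⟩ := (isCompact_range hτc).exists_thickening_subset_open hc.isOpen_compl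
    (range_subset_iff.2 hτ₀)
  choose ρ' hρ' Hρ using fun p : ι × ι => deg_eq_deg (hF p.1) (hF p.2) 3
  obtain ⟨r₂, hr₂, hr₂'⟩ := exists_pos_forall_le hρ'
  obtain ⟨lam, hlam, Hlam⟩ := exists_modulus_inv hce 3 (show (0 : ℝ) < 1 / 4 by norm_num)
  obtain ⟨r, hr, hrρ, hrr, hrl⟩ : ∃ r > 0, r ≤ ρ ∧ r < r₂ ∧ r ≤ lam / 2 :=
    ⟨min ρ (min (r₂ / 2) (lam / 2)), by positivity, min_le_left _ _,
      ((min_le_right _ _).trans (min_le_left _ _)).trans_lt (by linarith),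
      (min_le_right _ _).trans (min_le_right _ _)⟩
  obtain ⟨μ, hμ, Hμ⟩ := exists_modulus hce 3 hr
  choose e1 he1 He1 using fun p : ι × ι => Hρ p r hr (hrr.trans_le (hr₂' p))
  obtain ⟨ε₁, hε₁, hε₁'⟩ := exists_pos_forall_le he1
  obtain ⟨ε₂, hε₂, Hε₂⟩ := exists_modulus_inv hce 3 (show 0 < min (μ / 4) (1 / 4) by positivity)
  obtain ⟨ε, hε, hεε1, hεε2, hεl⟩ : ∃ ε > 0, ε ≤ ε₁ ∧ ε ≤ ε₂ ∧ ε ≤ lam / 2 :=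
    ⟨min ε₁ (min ε₂ (lam / 2)), by positivity, min_le_left _ _,
      (min_le_right _ _).trans (min_le_left _ _), (min_le_right _ _).trans (min_le_right _ _)⟩
  refine ⟨ε, hε, ?_⟩
  by_contra! hcon
  obtain ⟨δ₀, hδ₀, Hδ₀⟩ := Metric.uniformContinuousOn_iff.1
    (isCompact_Icc.uniformContinuousOn_of_continuous (hγ.continuousOn (s := Icc (-π) π))) ε hε
  obtain ⟨δ, hδ, hδ0, hδ4⟩ : ∃ δ > 0, δ ≤ δ₀ ∧ δ ≤ π / 4 :=
    ⟨min δ₀ (π / 4), by positivity, min_le_left _ _, min_le_right _ _⟩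
  obtain ⟨n, hn⟩ := exists_nat_gt (2 * π / (δ / 2))
  have hn0 : (0 : ℝ) < n := lt_trans (by positivity) hn
  set s : ℕ → ℝ := fun j => -π + 2 * π / n * j with hs
  have hs0 : s 0 = -π := by simp [hs]
  have hsn : s n = π := by simp only [hs]; field_simp; ring
  have hsd : ∀ j, dist (s j) (s (j + 1)) < δ / 2 := by
    intro j
    have h3 : s j - s (j + 1) = -(2 * π / n) := by simp only [hs]; push_cast; ring
    rw [Real.dist_eq, h3, abs_neg, abs_of_pos (by positivity), div_lt_iff₀ hn0]
    rw [div_lt_iff₀ (by positivity)] at hn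
    linarith
  have hsI : ∀ j ≤ n, s j ∈ Icc (-π) π := by
    intro j hj
    have hj' : (j : ℝ) ≤ n := by exact_mod_cast hj
    have h3 : 2 * π / n * j ≤ 2 * π / n * n := by gcongr
    have h4 : 2 * π / n * n = 2 * π := by field_simp
    have h5 : 0 ≤ 2 * π / n * j := by positivity
    exact ⟨by simp only [hs]; linarith, by simp only [hs]; linarith⟩
  -- The curve, finely subdivided, is a 1-cycle: either some cocycle is odd on it, or it bounds a
  -- fine chain Q.
  rcases exists_cocycle_or_chain ε ((List.range n).map fun j => (γ (s j), γ (s (j + 1)))) with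
    ⟨ψ, hψ, hψc, hψ1⟩ | ⟨Q, hQ, hQk⟩
  · refine hcon ψ hψ hψc ?_
    obtain ⟨b, hb⟩ := exists_potential (convex_Icc (-π) π) (isBounded_Icc (-π) π) hδ
      (hψc.comp γ (mapsTo_univ _ _) fun y hy y' hy' hyy => Hδ₀ y hy y' hy' (hyy.trans_le hδ0))
    refine ⟨b, ⟨δ / 2, half_pos hδ, hb⟩, ?_⟩
    rw [← hψ1, List.map_map, ← hs0, ← hsn, hs0, ← hs0, ← sum_range_telescope (fun j => b (s j))]
    congr 1
    refine List.map_congr_left fun j hj => ?_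
    rw [List.mem_range] at hj
    exact hb _ (hsI j (by omega)) _ (hsI (j + 1) (by omega)) (hsd j)
  -- the second case is contradictory
  have hNo : ∀ t, NoBdry Q (ball (τ₀ t) r) := by
    intro t k hk hks
    rw [hQk k hk, List.map_map]
    refine list_sum_eq_zero fun j _ => ?_
    by_contra hne
    have h3 := (hks _ _ hne).1
    refine hρc ?_ (hγc (s j))
    rw [mem_thickening_iff]
    exact ⟨_, mem_range_self t, (mem_ball.1 h3).trans_le hrρ⟩
  -- The local degree of Q is locally constant along the path, each of whose points is the image of
  -- a point in some chart.
  have hdeg : deg col (-1) r Q = deg col 1 r Q := by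
    have hx : ∀ x : X, ∃ p : ι × ℂ, p.2 ∈ closedBall (0 : ℂ) 3 ∧ F p.1 p.2 = x := by
      intro x
      obtain ⟨i, z, hz, hzx⟩ := mem_iUnion.1 (hcov.symm ▸ mem_univ x : x ∈ ⋃ i, F i '' closedBall 0 1)
      exact ⟨(i, z), closedBall_subset_closedBall (by norm_num) hz, hzx⟩
    choose q hq hqx using hx
    have hcmp : ∀ t : ℝ, ∀ i, ∀ p ∈ closedBall (0 : ℂ) 3, ∀ j, ∀ p' ∈ closedBall (0 : ℂ) 3,
        F i p = τ₀.extend t → dist (F i p) (F j p') < ε → deg (F i) p r Q = deg (F j) p' r Q := by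
      intro t i p hp j p' hp' hpt hd
      refine He1 (i, j) p hp p' hp' (by linarith [hε₁' (i, j)]) Q
        (hQ.mono (hεε1.trans (hε₁' (i, j)))) ?_
      rw [hpt]
      exact hNo _
    obtain ⟨δ', hδ', H⟩ := Metric.uniformContinuousOn_iff.1
      (isCompact_Icc.uniformContinuousOn_of_continuous
        (τ₀.continuous_extend.continuousOn (s := Icc (0 : ℝ) 1))) ε hε
    have h3 := eq_of_locally_constant (d := fun t => deg (F (q (τ₀.extend t)).1) (q (τ₀.extend t)).2 r Q)
      (convex_Icc (0 : ℝ) 1) (isBounded_Icc _ _) hδ' (fun t ht t' ht' htt =>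
        hcmp t _ _ (hq _) _ _ (hq _) (hqx _) (by rw [hqx, hqx]; exact H t ht t' ht' htt))
      (left_mem_Icc.2 zero_le_one) (right_mem_Icc.2 zero_le_one)
    have h4 := hcmp 0 _ _ (hq (τ₀.extend 0)) i₀ (-1) (by simp) (hqx _)
      (by rw [hqx, τ₀.extend_zero, dist_self]; exact hε)
    have h5 := hcmp 1 _ _ (hq (τ₀.extend 1)) i₀ 1 (by simp) (hqx _)
      (by rw [hqx, τ₀.extend_one, dist_self]; exact hε)
    rw [h4, h5] at h3
    exact h3
  set D := col '' closedBall 0 3 with hD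
  -- This cochain counts crossings of the segment from −1 to 1. Evaluated on Q it gives the
  -- difference of the degrees at the ends of the segment, and on the boundary of Q the number of
  -- times c crosses the segment.
  set k : X → X → ZMod 2 := fun x y => if x ∈ D ∧ y ∈ D then chi col (-1) x y + chi col 1 x y else 0
    with hk
  have hks : SymNorm k := by
    convert ((symmNorm_chi col (-1)).add (symmNorm_chi col 1)).ite (P := fun x y => x ∈ D ∧ y ∈ D)
      (fun x y => and_comm)
  have hdist : ∀ x ∈ D, ∀ y ∈ D, dist x y < ε →
      dist (coord col x) (coord col y) < min (μ / 4) (1 / 4) := by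
    rintro _ ⟨z, hz, rfl⟩ _ ⟨w, hw, rfl⟩ hzw
    obtain ⟨z', e, hz'⟩ := Hε₂ w hw (col z) (by linarith)
    rw [hce.injective e] at hz'
    rwa [coord_apply hce, coord_apply hce]
  have hnear : ∀ z ∈ closedBall (0 : ℂ) 2, ∀ y, dist y (col z) < lam → y ∈ D := by
    intro z hz y hy
    obtain ⟨w, rfl, hw⟩ := Hlam z (closedBall_subset_closedBall (by norm_num) hz) y hy
    refine ⟨w, ?_, rfl⟩
    rw [mem_closedBall] at *
    linarith [dist_triangle w z 0]
  -- For a triple inside the disc each crossing cochain is closed off its pole, so the restriction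
  -- to the balls is harmless. A triple that leaves the disc is far from both poles and from the
  -- support of `k`.
  have hsum : pairing Q k = deg col (-1) r Q + deg col 1 r Q := by
    unfold pairing deg holePairing
    rw [← List.sum_map_add]
    congr 1
    refine List.map_congr_left fun T hT => ?_
    obtain ⟨d1, d2, d3⟩ := hQ T hT
    have hin : ∀ z ∈ closedBall (0 : ℂ) 2, ∀ x, dist x (col z) < lam / 2 → ∀ y, dist y x < ε →
        y ∈ D := fun z hz x hx y hy => hnear z hz y (by linarith [dist_triangle y x (col z)])
    by_cases hI : Inside T D
    · have hp : ∀ p ∈ closedBall (0 : ℂ) 2, (if Meets T (ball (col p) r) then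
          cobd (chi col p) T.1 T.2.1 T.2.2 else 0) = cobd (chi col p) T.1 T.2.1 T.2.2 := by
        intro p hp
        refine ite_eq_left_iff.2 fun hm => ?_
        have hfar : ∀ x ∈ D, x ∉ ball (col p) r → coord col x ∈ {z | 2 * (μ / 2) ≤ dist z p} := by
          rintro _ ⟨z, hz, rfl⟩ hx
          rw [coord_apply hce, mem_ofPred_eq]
          by_contra! hlt
          exact hx (Hμ z hz p (closedBall_subset_closedBall (by norm_num) hp) (by linarith))
        simp only [Meets, not_or] at hm
        have g : ∀ x ∈ D, ∀ y ∈ D, dist x y < ε → dist (coord col x) (coord col y) < μ / 2 / 2 :=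
          fun x hx y hy hxy => ((hdist x hx y hy hxy).trans_le (min_le_left _ _)).trans_le
            (by linarith)
        exact (isCocycleOn_cross p (μ / 2) _ (hfar _ hI.1 hm.1) _ (hfar _ hI.2.1 hm.2.1) _
          (hfar _ hI.2.2 hm.2.2) (g _ hI.1 _ hI.2.1 d1) (g _ hI.2.1 _ hI.2.2 d2)
          (g _ hI.1 _ hI.2.2 d3)).symm
      rw [hp (-1) (by simp), hp 1 (by simp)]
      obtain ⟨i1, i2, i3⟩ := hI
      simp only [cobd, hk, i1, i2, i3, and_self, if_true]
      ring
    · have hm : ∀ p ∈ closedBall (0 : ℂ) 2, ¬ Meets T (ball (col p) r) := by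
        intro p hp hm
        obtain ⟨x, hx, f1, f2, f3⟩ := hm.near (hQ T hT)
        have hx' : dist x (col p) < lam / 2 := (mem_ball.1 hx).trans_le hrl
        exact hI ⟨hin p hp x hx' _ f1, hin p hp x hx' _ f2, hin p hp x hx' _ f3⟩
      rw [if_neg (hm _ (by simp)), if_neg (hm _ (by simp)), add_zero]
      have hk0 : ∀ x y w, dist x y < ε → dist w x < ε → k x y ≠ 0 → x ∈ D ∧ y ∈ D ∧ w ∈ D := by
        intro x y w hxy hwx hne
        simp only [hk, ne_eq, ite_eq_right_iff, Classical.not_imp] at hne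
        obtain ⟨⟨hx, hy⟩, hne⟩ := hne
        have h3 := segCross_ne_zero ((hdist x hx y hy hxy).trans_le (min_le_right _ _)) hne
        refine ⟨hx, hy, ?_⟩
        obtain ⟨z, hz, rfl⟩ := hx
        rw [coord_apply hce] at h3
        exact hnear z (by simpa using h3.1.le) w (by linarith)
      have z1 : k T.1 T.2.1 = 0 := by
        by_contra hne
        have := hk0 _ _ T.2.2 d1 (by rwa [dist_comm]) hne
        exact hI this
      have z2 : k T.2.1 T.2.2 = 0 := by
        by_contra hne
        have := hk0 _ _ T.1 d2 d1 hne
        exact hI ⟨this.2.2, this.1, this.2.1⟩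
      have z3 : k T.1 T.2.2 = 0 := by
        by_contra hne
        have := hk0 _ _ T.2.1 d3 (by rwa [dist_comm]) hne
        exact hI ⟨this.1, this.2.2, this.2.1⟩
      simp only [cobd, z1, z2, z3, add_zero]
  have hone : pairing Q k = 1 := by
    rw [hQk k hks, List.map_map]
    set U : ℝ → ZMod 2 := fun s => if 0 ≤ s then 1 else 0 with hU
    -- The curve runs along the imaginary axis of the chart for |s| < π / 2 and is off the chart
    -- otherwise, so it crosses the segment only at s = 0.
    have hkU : ∀ x ∈ Icc (-π) π, ∀ y ∈ Icc (-π) π, dist x y < δ → k (γ x) (γ y) = U x + U y := by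
      intro x hx y hy hxy
      have hpi := pi_pos
      have htan : ∀ x ∈ Ioo (-(π / 2)) (π / 2), 0 ≤ tan x ↔ 0 ≤ x := by
        intro x hx
        constructor
        · intro h; by_contra! hx0; exact absurd h (not_le.2 (tan_neg_of_neg_of_pi_div_two_lt hx0 hx.1))
        · intro h; exact tan_nonneg_of_nonneg_of_le_pi_div_two h hx.2.le
      have hIoo : ∀ x ∈ Icc (-π) π, γ x ∈ D → x ∈ Ioo (-(π / 2)) (π / 2) := by
        intro x hx hD
        by_contra hn
        exact h2 x hx hn (image_subset_range _ _ hD)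
      by_cases hxyD : γ x ∈ D ∧ γ y ∈ D
      · have hx' := hIoo x hx hxyD.1
        have hy' := hIoo y hy hxyD.2
        simp only [hk, hxyD, and_self, if_true, chi]
        rw [h1 x hx', h1 y hy', coord_apply hce, coord_apply hce, segCross_imag]
        simp only [hU, htan x hx', htan y hy']
      · simp only [hk, hxyD, if_false]
        have hsmall : ∀ x, |x| < π / 4 → γ x ∈ D := by
          intro x hx
          rw [abs_lt] at hx
          have hx' : x ∈ Ioo (-(π / 2)) (π / 2) := ⟨by linarith, by linarith⟩
          refine ⟨_, ?_, (h1 x hx').symm⟩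
          have t1 : tan x < 1 := by
            rw [← tan_pi_div_four]
            exact tan_lt_tan_of_lt_of_lt_pi_div_two hx'.1 (by linarith) hx.2
          have t2 : -1 < tan x := by
            rw [← tan_pi_div_four, ← tan_neg]
            exact tan_lt_tan_of_lt_of_lt_pi_div_two (by linarith) hx'.2 hx.1
          rw [mem_closedBall_zero_iff, norm_mul, Complex.norm_I, mul_one, Complex.norm_real,
            Real.norm_eq_abs, abs_le]
          exact ⟨by linarith, by linarith⟩
        rw [Real.dist_eq, abs_lt] at hxy
        by_cases a : 0 ≤ x <;> by_cases b : 0 ≤ y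
        · simp only [hU, a, b, if_true, zmod_two_add_self]
        · rw [not_le] at b
          exact absurd ⟨hsmall x (abs_lt.2 ⟨by linarith, by linarith⟩),
            hsmall y (abs_lt.2 ⟨by linarith, by linarith⟩)⟩ hxyD
        · rw [not_le] at a
          exact absurd ⟨hsmall x (abs_lt.2 ⟨by linarith, by linarith⟩),
            hsmall y (abs_lt.2 ⟨by linarith, by linarith⟩)⟩ hxyD
        · simp only [hU, a, b, if_false, add_zero]
    have h3 := sum_range_telescope (fun j => U (s j)) n
    have hU0 : U (-π) = 0 := if_neg (by linarith [pi_pos])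
    have hU1 : U π = 1 := if_pos pi_pos.le
    rw [hs0, hsn, hU0, hU1, zero_add] at h3
    rw [← h3]
    congr 1
    refine List.map_congr_left fun j hj => ?_
    rw [List.mem_range] at hj
    exact hkU _ (hsI j (by omega)) _ (hsI (j + 1) (by omega)) ((hsd j).trans (by linarith))
  rw [hsum, hdeg, zmod_two_add_self] at hone
  exact zero_ne_one hone

end Dual

/-- The distance between images is bounded below on the compact set of pairs at distance at least ν.
-/
lemma exists_modulus_of_injOn {X Y : Type*} [PseudoMetricSpace X] [MetricSpace Y] {K : Set X}
    (hK : IsCompact K) {f : X → Y} (hf : ContinuousOn f K) (hi : InjOn f K) {ν : ℝ} (hν : 0 < ν) :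
    ∃ e > 0, ∀ x ∈ K, ∀ y ∈ K, dist (f x) (f y) < e → dist x y < ν := by
  have hC : IsCompact ((K ×ˢ K) ∩ {p : X × X | ν ≤ dist p.1 p.2}) :=
    (hK.prod hK).inter_right (isClosed_le continuous_const continuous_dist)
  have hfc : ContinuousOn (fun p : X × X => dist (f p.1) (f p.2))
      ((K ×ˢ K) ∩ {p : X × X | ν ≤ dist p.1 p.2}) := by
    exact continuous_dist.comp_continuousOn ((hf.comp continuousOn_fst fun p hp => hp.1.1).prodMk
      (hf.comp continuousOn_snd fun p hp => hp.1.2))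
  rcases ((K ×ˢ K) ∩ {p : X × X | ν ≤ dist p.1 p.2}).eq_empty_or_nonempty with h | h
  · refine ⟨1, one_pos, fun x hx y hy _ => ?_⟩
    by_contra! hc
    exact (h ▸ (⟨⟨hx, hy⟩, hc⟩ : (x, y) ∈ (K ×ˢ K) ∩ {p : X × X | ν ≤ dist p.1 p.2}) :
      (x, y) ∈ (∅ : Set (X × X)))
  · obtain ⟨p, hp, hmin⟩ := hC.exists_isMinOn h hfc
    have hpos : 0 < dist (f p.1) (f p.2) := by
      refine dist_pos.2 fun e => ?_
      have h1 := hi hp.1.1 hp.1.2 e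
      have h2 : ν ≤ dist p.1 p.2 := hp.2
      rw [h1, dist_self] at h2
      linarith
    refine ⟨_, hpos, fun x hx y hy hxy => ?_⟩
    by_contra! hc
    exact absurd (hmin (⟨⟨hx, hy⟩, hc⟩ : (x, y) ∈ (K ×ˢ K) ∩ {p : X × X | ν ≤ dist p.1 p.2}))
      (not_le.2 hxy)

/-! ### Representatives of points of the circle ℝ/ℤ -/

section Circle

lemma norm_coe_le_abs_sub (x : ℝ) (m : ℤ) : ‖(x : UnitAddCircle)‖ ≤ |x - m| := by
  rw [UnitAddCircle.norm_eq]; exact round_le x m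

/-- Representatives in [0, 1) of close points of the circle can differ by nearly a nonzero integer
only if the points lie on either side of 0. This localizes jump cochains near zero sets. -/
lemma norm_coe_lt_of_sub {x y τ : ℝ} {q : ℤ} (hx : x ∈ Ico (0 : ℝ) 1) (hy : y ∈ Ico (0 : ℝ) 1)
    (hq : q ≠ 0) (hτ : τ ≤ 1 / 2) (h : |x - y - q| < τ) :
    ‖(x : UnitAddCircle)‖ < τ ∧ ‖(y : UnitAddCircle)‖ < τ := by
  obtain ⟨hx0, hx1⟩ := hx
  obtain ⟨hy0, hy1⟩ := hy
  have h' := abs_lt.1 h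
  have h1 : (q : ℝ) < 2 := by linarith
  have h2 : (-2 : ℝ) < q := by linarith
  have h1' : q < 2 := by exact_mod_cast h1
  have h2' : -2 < q := by exact_mod_cast h2
  obtain rfl | rfl : q = 1 ∨ q = -1 := by omega
  · push_cast at h'
    refine ⟨(norm_coe_le_abs_sub x 1).trans_lt ?_, (norm_coe_le_abs_sub y 0).trans_lt ?_⟩ <;>
    rw [abs_lt] <;> push_cast <;> constructor <;> linarith
  · push_cast at h'
    refine ⟨(norm_coe_le_abs_sub x 0).trans_lt ?_, (norm_coe_le_abs_sub y 1).trans_lt ?_⟩ <;>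
    rw [abs_lt] <;> push_cast <;> constructor <;> linarith

lemma coe_fract (x : ℝ) : ((Int.fract x : ℝ) : UnitAddCircle) = x := by
  have h : ((⌊x⌋ : ℝ) : UnitAddCircle) = 0 := by
    rw [AddCircle.coe_eq_zero_iff]
    exact ⟨⌊x⌋, by simp⟩
  rw [Int.fract, AddCircle.coe_sub, h, sub_zero]

lemma exists_rep (x : UnitAddCircle) : ∃ t ∈ Ico (0 : ℝ) 1, (t : UnitAddCircle) = x := by
  induction x using QuotientAddGroup.induction_on with
  | H t => exact ⟨Int.fract t, ⟨Int.fract_nonneg t, Int.fract_lt_one t⟩, coe_fract t⟩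

lemma int_eq_of_abs_lt {a b : ℤ} (h : |(a : ℝ) - b| < 1) : a = b := by
  have : |a - b| < 1 := by exact_mod_cast h
  rw [Int.abs_lt_one_iff] at this
  omega

end Circle

/-! ### The cup product against the fundamental class -/

section Contradiction

variable {X ι : Type*} [MetricSpace X] [CompactSpace X]

open Real in
/-- The dual class of the core of an annulus does not vanish near the zero set of a function that
represents the same class as the height of the annulus. -/
theorem dual_not_coboundary {F : ι → ℂ → X} (hF : ∀ i, IsOpenEmbedding (F i))
    (hfund : HasFundamental F univ) (i₀ : ι) {θ : X → UnitAddCircle} (hθ : Continuous θ)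
    (hθcol : ∀ z, θ (F i₀ z) = ((arctan z.re / 4 : ℝ) : UnitAddCircle))
    {Φ : ℂ → X} (hΦ : ContinuousOn Φ (annulus 0 (1 / 2) (3 / 2)))
    (hΦi : InjOn Φ (annulus 0 (1 / 2) (3 / 2))) (hΦ1 : Φ 1 = F i₀ 0)
    (hΦθ : ∀ x, ‖θ x‖ < 1 / 4 → ∃ ζ ∈ annulus 0 (1 / 2) (3 / 2), Φ ζ = x ∧ |dist ζ 0 - 1| ≤ 2 * ‖θ x‖)
    (hΦcol : ∀ z ∈ ball (0 : ℂ) (1 / 2), ∃ ζ ∈ annulus 0 (1 / 2) (3 / 2), Φ ζ = F i₀ z ∧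
      0 ≤ ζ.re ∧ (0 ≤ ζ.im ↔ 0 ≤ z.im))
    {ψ : X → X → ZMod 2} (hψ : SymNorm ψ) {ε₀ : ℝ} (hε₀ : 0 < ε₀) (hψc : IsCocycleOn ψ univ ε₀)
    (hψ1 : HasInt ψ (fun s => Φ (circleMap 0 1 s)) 0 (2 * π) 1) {w : X → ℝ} (hw : Continuous w)
    {η δ : ℝ} (hη : 0 < η) (hδ : 0 < δ) (b : X → ZMod 2)
    (hb : ∀ x y, ‖θ x + (w x : UnitAddCircle)‖ < η → ‖θ y + (w y : UnitAddCircle)‖ < η →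
      dist x y < δ → ψ x y = b x + b y) : False := by
  classical
  set col := F i₀ with hcol
  have hce : IsOpenEmbedding col := hF i₀
  obtain ⟨r₁, hr₁, hfund⟩ := hfund
  obtain ⟨lam, hlam, Hlam⟩ := exists_modulus_inv hce 3 (show (0 : ℝ) < 1 / 2 by norm_num)
  obtain ⟨r, hr, hrr, hrl⟩ : ∃ r > 0, r < r₁ ∧ r ≤ lam / 4 :=
    ⟨min (r₁ / 2) (lam / 4), by positivity, (min_le_left _ _).trans_lt (by linarith),
      min_le_right _ _⟩
  obtain ⟨μ, hμ, Hμ⟩ := exists_modulus hce 3 hr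
  have h1mem : (1 : ℂ) ∈ annulus 0 (1 / 2) (3 / 2) := by
    constructor <;> rw [dist_zero_right, norm_one] <;> norm_num
  obtain ⟨ν, hν, Hν⟩ := Metric.continuousOn_iff.1 hΦ 1 h1mem r hr
  have hKc : IsCompact (annulus 0 (1 / 2) (3 / 2)) := by
    have : annulus 0 (1 / 2) (3 / 2) = closedBall 0 (3 / 2) ∩ {z | 1 / 2 ≤ dist z 0} := by
      ext z; exact and_comm
    rw [this]
    exact (isCompact_closedBall _ _).inter_right (isClosed_le continuous_const (by fun_prop))
  -- the potential on the annulus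
  obtain ⟨δ₁, hδ₁, Hδ₁⟩ := Metric.uniformContinuousOn_iff.1
    (hKc.uniformContinuousOn_of_continuous hΦ) ε₀ hε₀
  obtain ⟨δ₂, hδ₂, Hδ₂⟩ := exists_potential_annulus (r := 1 / 2) (R := 3 / 2) (by norm_num)
    (show 0 < min δ₁ (1 / 8) by positivity)
  have hcocΦ : IsCocycleOn (fun ζ ζ' => ψ (Φ ζ) (Φ ζ')) (annulus 0 (1 / 2) (3 / 2))
      (min δ₁ (1 / 8)) := hψc.comp Φ (mapsTo_univ _ _) fun y hy y' hy' hyy =>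
        Hδ₁ y hy y' hy' (hyy.trans_le (min_le_left _ _))
  have hcocc : IsCocycleOn (cross 0) (annulus 0 (1 / 2) (3 / 2)) (min δ₁ (1 / 8)) := by
    refine (isCocycleOn_cross 0 (1 / 4)).mono (fun z hz => ?_) ((min_le_right _ _).trans (by norm_num))
    have := hz.1
    rw [mem_ofPred_eq]; linarith
  -- On the unit circle both ψ and the crossing cochain of the positive real ray have integral 1, so
  -- on the annulus ψ is cohomologous to the crossing of that ray.
  obtain ⟨ba, hba⟩ := Hδ₂ 0 _ (hcocΦ.add hcocc) ⟨1, by constructor <;> norm_num, by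
    have := HasInt.add (k := fun ζ ζ' => ψ (Φ ζ) (Φ ζ')) (A := circleMap 0 1) hψ1
      (hasInt_cross_circleMap 0 one_pos)
    rwa [show (1 : ZMod 2) + 1 = 0 from rfl] at this⟩
  obtain ⟨δ₃, hδ₃, Hδ₃⟩ := exists_modulus_of_injOn hKc hΦ hΦi
    (show 0 < min δ₂ (min (ν / 4) (1 / 8)) by positivity)
  set Ψ : X → ℂ := Function.invFunOn Φ (annulus 0 (1 / 2) (3 / 2)) with hΨ
  have hΨΦ : ∀ ζ ∈ annulus 0 (1 / 2) (3 / 2), Ψ (Φ ζ) = ζ := fun ζ hζ =>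
    hΦi.leftInvOn_invFunOn hζ
  set b' : X → ZMod 2 := fun x => ba (Ψ x) with hb'
  have hcut : ∀ x y, ‖θ x‖ < 1 / 4 → ‖θ y‖ < 1 / 4 → dist x y < δ₃ →
      ψ x y + (b' x + b' y) = cross 0 (Ψ x) (Ψ y) := by
    intro x y hx hy hxy
    obtain ⟨ζ, hζ, rfl, -⟩ := hΦθ x hx
    obtain ⟨ζ', hζ', rfl, -⟩ := hΦθ y hy
    have h1 := hba ζ hζ ζ' hζ' ((Hδ₃ ζ hζ ζ' hζ' hxy).trans_le (min_le_left _ _))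
    simp only [hb', hΨΦ ζ hζ, hΨΦ ζ' hζ']
    grind
  -- the integer-valued cocycle of the height
  choose t₀ ht₀ ht₀θ using fun x => exists_rep (θ x)
  set R : X → X → ℤ := fun x y => round (t₀ x - t₀ y) with hR
  set n : X → ZMod 2 := fun x => ((⌊t₀ x + w x⌋ : ℤ) : ZMod 2) with hn
  set G : X → X → ZMod 2 := fun x y => ((R x y : ℤ) : ZMod 2) with hG
  -- `G` represents the class of θ. Adding the coboundary of `n` gives the jump cochain of θ + w,
  -- supported near its zero set, where ψ is the coboundary of `b`. Hence the cup product of `G` and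
  -- ψ has the primitive n ψ + (G + n + n) b, and the term with `b'` turns it into the product of
  -- `G` with ψ corrected by `b'`, supported near the point where the core meets the ray.
  set k : X → X → ZMod 2 := fun x y =>
    n x * ψ x y + (G x y + n x + n y) * b y + G x y * b' y with hk
  obtain ⟨σ, hσ, hση, hσν, hσ1⟩ : ∃ σ > 0, σ ≤ η / 8 ∧ σ ≤ ν / 16 ∧ σ ≤ 1 / 16 :=
    ⟨min (η / 8) (min (ν / 16) (1 / 16)), by positivity, min_le_left _ _,
      (min_le_right _ _).trans (min_le_left _ _), (min_le_right _ _).trans (min_le_right _ _)⟩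
  obtain ⟨e1, he1, He1⟩ := Metric.uniformContinuous_iff.1
    (CompactSpace.uniformContinuous_of_continuous hθ) σ hσ
  obtain ⟨e2, he2, He2⟩ := Metric.uniformContinuous_iff.1
    (CompactSpace.uniformContinuous_of_continuous hw) σ hσ
  obtain ⟨e3, he3, He3⟩ := exists_modulus_inv hce 3 (show 0 < min (μ / 4) 1 by positivity)
  obtain ⟨e, he, hee1, hee2, hee3, heε, heδ, heδ₃⟩ : ∃ e > 0, e ≤ e1 ∧ e ≤ e2 ∧ e ≤ e3 ∧
      e ≤ ε₀ ∧ e ≤ δ ∧ e ≤ δ₃ :=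
    ⟨min (min e1 e2) (min (min e3 ε₀) (min δ δ₃)), by positivity,
      (min_le_left _ _).trans (min_le_left _ _), (min_le_left _ _).trans (min_le_right _ _),
      (min_le_right _ _).trans ((min_le_left _ _).trans (min_le_left _ _)),
      (min_le_right _ _).trans ((min_le_left _ _).trans (min_le_right _ _)),
      (min_le_right _ _).trans ((min_le_right _ _).trans (min_le_left _ _)),
      (min_le_right _ _).trans ((min_le_right _ _).trans (min_le_right _ _))⟩
  have hRd : ∀ x y, dist x y < e → |t₀ x - t₀ y - R x y| < σ := by
    intro x y hxy
    have h1 := He1 (hxy.trans_le hee1)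
    rwa [dist_eq_norm, ← ht₀θ x, ← ht₀θ y, ← AddCircle.coe_sub, UnitAddCircle.norm_eq] at h1
  have hR0 : ∀ x, R x x = 0 := fun x => by simp [hR]
  have hRadd : ∀ x y z, dist x y < e → dist y z < e → dist x z < e → R x z = R x y + R y z := by
    intro x y z h1 h2 h3
    have g1 := abs_lt.1 (hRd x y h1)
    have g2 := abs_lt.1 (hRd y z h2)
    have g3 := abs_lt.1 (hRd x z h3)
    refine int_eq_of_abs_lt ?_
    rw [abs_lt]
    push_cast
    constructor <;> linarith
  have hGadd : ∀ x y z, dist x y < e → dist y z < e → dist x z < e → G x z = G x y + G y z := by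
    intro x y z h1 h2 h3
    simp only [hG, hRadd x y z h1 h2 h3, Int.cast_add]
  have hG0 : ∀ x y, dist x y < e → G x y ≠ 0 → ‖θ x‖ < σ ∧ ‖θ y‖ < σ := by
    intro x y hxy hne
    have hR' : R x y ≠ 0 := fun h => hne (by simp only [hG, h, Int.cast_zero])
    have h1 := norm_coe_lt_of_sub (ht₀ x) (ht₀ y) hR' (by linarith) (hRd x y hxy)
    rwa [ht₀θ, ht₀θ] at h1
  have hGw : ∀ x y, dist x y < e → G x y + n x + n y ≠ 0 →
      ‖θ x + (w x : UnitAddCircle)‖ < 2 * σ ∧ ‖θ y + (w y : UnitAddCircle)‖ < 2 * σ := by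
    intro x y hxy hne
    have hq : R x y - (⌊t₀ x + w x⌋ - ⌊t₀ y + w y⌋) ≠ 0 := by
      intro h
      have h' : R x y = ⌊t₀ x + w x⌋ - ⌊t₀ y + w y⌋ := by omega
      apply hne
      simp only [hG, hn, h', Int.cast_sub]
      grind
    have h1 := abs_lt.1 (hRd x y hxy)
    have h2 := He2 (hxy.trans_le hee2)
    rw [Real.dist_eq, abs_lt] at h2
    have h3 := norm_coe_lt_of_sub (τ := 2 * σ)
      ⟨Int.fract_nonneg (t₀ x + w x), Int.fract_lt_one (t₀ x + w x)⟩
      ⟨Int.fract_nonneg (t₀ y + w y), Int.fract_lt_one (t₀ y + w y)⟩ hq (by linarith) (by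
        simp only [Int.fract]
        push_cast
        rw [abs_lt]
        constructor <;> linarith)
    rwa [coe_fract, coe_fract, AddCircle.coe_add, AddCircle.coe_add, ht₀θ, ht₀θ] at h3
  have hwd : ∀ x y, dist x y < e → ‖θ y + (w y : UnitAddCircle)‖ < 2 * σ →
      ‖θ x + (w x : UnitAddCircle)‖ < η := by
    intro x y hxy hy
    have h1 := He1 (hxy.trans_le hee1)
    have h2 := He2 (hxy.trans_le hee2)
    rw [dist_eq_norm] at h1
    have h3 : ‖((w x - w y : ℝ) : UnitAddCircle)‖ < σ := by
      refine (norm_coe_le_abs_sub _ 0).trans_lt ?_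
      rw [Int.cast_zero, sub_zero]
      exact h2
    have h4 : θ x + (w x : UnitAddCircle) =
        (θ y + (w y : UnitAddCircle)) + ((θ x - θ y) + ((w x - w y : ℝ) : UnitAddCircle)) := by
      rw [AddCircle.coe_sub]; abel
    rw [h4]
    have h5 := norm_add_le (θ y + (w y : UnitAddCircle))
      ((θ x - θ y) + ((w x - w y : ℝ) : UnitAddCircle))
    have h6 := norm_add_le (θ x - θ y) ((w x - w y : ℝ) : UnitAddCircle)
    linarith
  have hcobd : ∀ x y z, dist x y < e → dist y z < e → dist x z < e →
      cobd k x y z = G x y * (ψ y z + (b' y + b' z)) := by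
    intro x y z h1 h2 h3
    have g1 := hGadd x y z h1 h2 h3
    have g2 := hψc x (mem_univ _) y (mem_univ _) z (mem_univ _) (h1.trans_le heε)
      (h2.trans_le heε) (h3.trans_le heε)
    have g3 : (G x y + n x + n y) * (ψ y z + (b y + b z)) = 0 := by
      by_cases h0 : G x y + n x + n y = 0
      · rw [h0, zero_mul]
      · have h4 := (hGw x y h1 h0).2
        rw [dist_comm] at h2
        rw [hb y z (by linarith) (hwd z y h2 h4) (by rw [dist_comm]; linarith),
          zmod_two_add_self, mul_zero]
    simp only [cobd, hk] at g2 ⊢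
    rw [g1]
    grind
  -- `G` forces y near the core, and the corrected ψ forces y near the positive real ray; the two
  -- meet at the centre of the collar chart.
  have hnear : ∀ x y z, dist x y < e → dist y z < e → G x y * (ψ y z + (b' y + b' z)) ≠ 0 →
      y ∈ ball (col 0) r := by
    intro x y z h1 h2 hne
    have hy := (hG0 x y h1 (left_ne_zero_of_mul hne)).2
    have hz : ‖θ z‖ < 1 / 4 := by
      have h3 := He1 (h2.trans_le hee1)
      rw [dist_comm, dist_eq_norm] at h3
      have h4 := norm_add_le (θ z - θ y) (θ y)
      rw [sub_add_cancel] at h4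
      linarith
    have hc := right_ne_zero_of_mul hne
    rw [hcut y z (by linarith) hz (h2.trans_le heδ₃)] at hc
    obtain ⟨ζ, hζ, rfl, hζθ⟩ := hΦθ y (by linarith)
    obtain ⟨ζ', hζ', rfl, -⟩ := hΦθ z hz
    rw [hΨΦ ζ hζ, hΨΦ ζ' hζ'] at hc
    have hd := Hδ₃ ζ hζ ζ' hζ' (h2.trans_le heδ₃)
    rw [lt_min_iff, lt_min_iff] at hd
    have b1 := re_im_bounds hd.2.1
    have b2 := re_im_bounds hd.2.2
    simp only [cross, ne_eq, ite_eq_right_iff, Classical.not_imp, Complex.zero_re,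
      Complex.zero_im] at hc
    have him : |ζ.im| ≤ ν / 4 ∧ |ζ.im| < 1 / 8 ∧ -(1 / 8) < ζ.re := by
      rw [abs_le, abs_lt]
      rcases hc.1 with h | h <;> refine ⟨⟨?_, ?_⟩, ⟨?_, ?_⟩, ?_⟩ <;> linarith
    have hn1 : dist ζ 0 ≤ |ζ.re| + |ζ.im| := by
      rw [dist_zero_right]; exact Complex.norm_le_abs_re_add_abs_im ζ
    have hn2 : |ζ.re| ≤ dist ζ 0 := by
      rw [dist_zero_right]; exact Complex.abs_re_le_norm ζ
    rw [abs_le] at hζθ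
    have hre : 0 < ζ.re := by
      by_contra! h0
      rw [abs_of_nonpos h0] at hn1
      linarith [hζ.1]
    rw [abs_of_pos hre] at hn1 hn2
    refine mem_ball.2 ?_
    rw [← hΦ1]
    refine Hν ζ hζ ?_
    have h5 : dist ζ 1 ≤ (2 * ‖θ (Φ ζ)‖ + ν / 4) + ν / 4 := by
      refine dist_le_of_re_im ?_ ?_
      · rw [Complex.one_re, abs_le]; constructor <;> linarith
      · rw [Complex.one_im, sub_zero]; exact him.1
    linarith
  -- the disc
  set U : ℂ → ZMod 2 := fun z => if 0 ≤ z.re then 1 else 0 with hU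
  set s : ℂ → ZMod 2 := fun z => if 0 ≤ z.im then 1 else 0 with hs
  obtain ⟨e4, he4, He4⟩ := exists_modulus hce 3 he
  have hhalf : ball (0 : ℂ) (1 / 2) ⊆ closedBall 0 3 :=
    ball_subset_closedBall.trans (closedBall_subset_closedBall (by norm_num))
  -- In the collar chart the representative of θ jumps across the imaginary axis, so `G` is the
  -- coboundary of the indicator of the right half plane.
  have hGU : ∀ z ∈ ball (0 : ℂ) (1 / 2), ∀ z' ∈ ball (0 : ℂ) (1 / 2), dist (col z) (col z') < e →
      G (col z) (col z') = U z + U z' := by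
    intro z hz z' hz' hzz
    have hat : ∀ z ∈ ball (0 : ℂ) (1 / 2), |arctan z.re / 4| < 1 / 4 ∧
        (0 ≤ arctan z.re ↔ 0 ≤ z.re) := by
      intro z hz
      rw [mem_ball_zero_iff] at hz
      have h1 := (abs_le.1 ((Complex.abs_re_le_norm z).trans hz.le))
      refine ⟨?_, arctan_nonneg⟩
      have h2 : arctan z.re ≤ arctan 1 := arctan_mono (by linarith)
      have h3 : arctan (-1) ≤ arctan z.re := arctan_mono (by linarith)
      rw [arctan_neg] at h3
      rw [arctan_one] at h2 h3
      have := pi_lt_d2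
      rw [abs_lt]
      constructor <;> linarith
    have hrep : ∀ z ∈ ball (0 : ℂ) (1 / 2), t₀ (col z) = 
        arctan z.re / 4 + (if 0 ≤ z.re then 0 else 1) := by
      intro z hz
      obtain ⟨h1, h2⟩ := hat z hz
      rw [abs_lt] at h1
      have h3 := (ht₀θ (col z)).trans (hθcol z)
      obtain ⟨m, hm⟩ := (AddCircle.coe_eq_zero_iff 1).1
        (show ((t₀ (col z) - arctan z.re / 4 : ℝ) : UnitAddCircle) = 0 by
          rw [AddCircle.coe_sub, h3, sub_self])
      simp only [zsmul_eq_mul, mul_one] at hm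
      have h4 := ht₀ (col z)
      split_ifs with h0
      · have h5 := h2.2 h0
        have : m = 0 := by
          refine int_eq_of_abs_lt ?_
          rw [Int.cast_zero, sub_zero, abs_lt]
          constructor <;> linarith [h4.1, h4.2]
        rw [this, Int.cast_zero] at hm
        linarith
      · have h5 : arctan z.re < 0 := not_le.1 fun h => h0 (h2.1 h)
        have : m = 1 := by
          refine int_eq_of_abs_lt ?_
          rw [Int.cast_one, abs_lt]
          constructor <;> linarith [h4.1, h4.2]
        rw [this, Int.cast_one] at hm
        linarith
    have h1 := hRd _ _ hzz
    rw [hrep z hz, hrep z' hz'] at h1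
    have g1 := abs_lt.1 (hat z hz).1
    have g2 := abs_lt.1 (hat z' hz').1
    rw [abs_lt] at h1
    simp only [hG, hU]
    by_cases a : 0 ≤ z.re <;> by_cases a' : 0 ≤ z'.re <;> simp only [a, a', if_true, if_false] at h1 ⊢
    · have : R (col z) (col z') = 0 := int_eq_of_abs_lt (by
        rw [Int.cast_zero, sub_zero, abs_lt]; constructor <;> linarith)
      rw [this]; rfl
    · have : R (col z) (col z') = -1 := int_eq_of_abs_lt (by
        rw [Int.cast_neg, Int.cast_one, abs_lt]; constructor <;> linarith)
      rw [this]; rfl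
    · have : R (col z) (col z') = 1 := int_eq_of_abs_lt (by
        rw [Int.cast_one, abs_lt]; constructor <;> linarith)
      rw [this]; rfl
    · have : R (col z) (col z') = 0 := int_eq_of_abs_lt (by
        rw [Int.cast_zero, sub_zero, abs_lt]; constructor <;> linarith)
      rw [this]; rfl
  have hcuts : ∀ z ∈ ball (0 : ℂ) (1 / 2), ∀ z' ∈ ball (0 : ℂ) (1 / 2), dist (col z) (col z') < e →
      ψ (col z) (col z') + (b' (col z) + b' (col z')) = s z + s z' := by
    intro z hz z' hz' hzz
    have hth : ∀ z ∈ ball (0 : ℂ) (1 / 2), ‖θ (col z)‖ < 1 / 4 := by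
      intro z hz
      rw [mem_ball_zero_iff] at hz
      have h1 := (abs_le.1 ((Complex.abs_re_le_norm z).trans hz.le))
      rw [hθcol]
      refine (norm_coe_le_abs_sub _ 0).trans_lt ?_
      have h2 : arctan z.re ≤ arctan 1 := arctan_mono (by linarith)
      have h3 : arctan (-1) ≤ arctan z.re := arctan_mono (by linarith)
      rw [arctan_neg] at h3
      rw [arctan_one] at h2 h3
      have := pi_lt_d2
      rw [abs_lt]
      push_cast
      constructor <;> linarith
    rw [hcut _ _ (hth z hz) (hth z' hz') (hzz.trans_le heδ₃)]
    obtain ⟨ζ, hζ, hζz, hre, him⟩ := hΦcol z hz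
    obtain ⟨ζ', hζ', hζz', hre', him'⟩ := hΦcol z' hz'
    rw [← hζz, ← hζz', hΨΦ ζ hζ, hΨΦ ζ' hζ']
    have h11 : (1 : ZMod 2) + 1 = 0 := rfl
    simp only [cross, hs, ← him, ← him', Complex.zero_re, Complex.zero_im, hre, hre', and_true]
    by_cases a : 0 ≤ ζ.im <;> by_cases a' : 0 ≤ ζ'.im <;>
      simp [a, a', h11, not_le.1, not_lt.2] <;> grind
  -- In the disc the coboundary of `k` is the product of the coboundaries of `U` and `s`, which is
  -- also the coboundary of U times that of s. Off the centre the latter cochain is the crossing of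
  -- the horizontal ray.
  have hlc : IsCocycleOn (fun z z' => k (col z) (col z') + U z * (s z + s z')) (ball (0 : ℂ) (1 / 2))
      e4 := by
    intro x hx y hy z hz h1 h2 h3
    have d1 := He4 x (hhalf hx) y (hhalf hy) h1
    have d2 := He4 y (hhalf hy) z (hhalf hz) h2
    have d3 := He4 x (hhalf hx) z (hhalf hz) h3
    have g := hcobd _ _ _ d1 d2 d3
    rw [hGU x hx y hy d1, hcuts y hy z hz d2] at g
    unfold cobd at g ⊢
    grind
  obtain ⟨β, hβ⟩ := exists_potential (convex_ball (0 : ℂ) (1 / 2)) isBounded_ball he4 hlc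
  obtain ⟨e5, he5, He5⟩ := exists_modulus_inv hce 3 (show 0 < min (e4 / 2) (μ / 2) by positivity)
  obtain ⟨ε, hε, hεe, hε5, hεr⟩ : ∃ ε > 0, ε ≤ e ∧ ε ≤ e5 ∧ ε ≤ r :=
    ⟨min e (min e5 r), by positivity, min_le_left _ _, (min_le_right _ _).trans (min_le_left _ _),
      (min_le_right _ _).trans (min_le_right _ _)⟩
  obtain ⟨P, hP, hPN, hPd⟩ := hfund r hr hrr ε hε
  set A := ball (col 0) r with hA
  -- Off the hole `k` is closed on small triples, so the pairing of the fundamental chain with `k'`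
  -- is concentrated at the hole, where it is the local degree 1; being a coboundary pairing, it is
  -- 0.
  set k' : X → X → ZMod 2 := fun x y => if dist x y < ε ∧ x ∉ A ∧ y ∉ A then k x y else 0 with hk'
  have hkxx : ∀ x, k x x = 0 := fun x => by
    simp only [hk, hψ.diag, hG, hR0, Int.cast_zero, mul_zero, zero_mul, zero_add, add_zero,
      zmod_two_add_self]
  have hk's : SymNorm k' := by
    -- The primitive `k` is not symmetric in general; symmetry on short edges off the hole follows
    -- from its closedness there.
    have key : ∀ x y, dist x y < ε → y ∉ A → k x y = k y x := by
      intro x y hxy hy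
      have h1 := hxy.trans_le hεe
      have h1' : dist y x < e := by rwa [dist_comm]
      have h2 := hcobd x y x h1 h1' (by rwa [dist_self])
      have h3 : G x y * (ψ y x + (b' y + b' x)) = 0 := by
        by_contra hne
        exact hy (hnear x y x h1 h1' hne)
      rw [h3] at h2
      simp only [cobd, hkxx, add_zero] at h2
      exact zmod_two_eq_of_add_eq_zero h2
    constructor
    · intro x y
      simp only [hk']
      by_cases h : dist x y < ε ∧ x ∉ A ∧ y ∉ A
      · have h' : dist y x < ε ∧ y ∉ A ∧ x ∉ A := ⟨by rw [dist_comm]; exact h.1, h.2.2, h.2.1⟩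
        rw [if_pos h, if_pos h', key x y h.1 h.2.2]
      · have h' : ¬ (dist y x < ε ∧ y ∉ A ∧ x ∉ A) := fun h' =>
          h ⟨by rw [dist_comm]; exact h'.1, h'.2.2, h'.2.1⟩
        rw [if_neg h, if_neg h']
    · intro x
      simp only [hk', hkxx, ite_self]
  have h0 : pairing P k' = 0 := hPN k' hk's fun _ _ _ => ⟨mem_univ _, mem_univ _⟩
  have h1 : pairing P k' = holePairing P k' A := by
    unfold pairing holePairing
    congr 1
    refine List.map_congr_left fun T hT => ?_
    obtain ⟨d1, d2, d3⟩ := hP T hT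
    rw [eq_comm]
    refine ite_eq_left_iff.2 fun hm => ?_
    simp only [Meets, not_or] at hm
    have h2 : cobd k' T.1 T.2.1 T.2.2 = cobd k T.1 T.2.1 T.2.2 := by
      simp only [cobd, hk', d1, d2, d3, hm, not_false_iff, and_self, if_true]
    rw [h2, hcobd _ _ _ (d1.trans_le hεe) (d2.trans_le hεe) (d3.trans_le hεe)]
    by_contra hne
    exact hm.2.1 (hnear _ _ _ (d1.trans_le hεe) (d2.trans_le hεe) fun h => hne h.symm)
  have h2 : holePairing P k' A = deg col 0 r P := by
    refine holePairing_eq (B := ball (col 0) (2 * r)) hP (hPN.mono (subset_univ _)) hk's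
      (symmNorm_chi _ _) (fun x => β (coord col x)) (fun x hx y hy hx' hy' hxy => ?_)
      (fun x hx y hxy => ?_)
    · have hco : ∀ x ∈ ball (col 0) (2 * r), x ∉ A → ∃ z ∈ ball (0 : ℂ) (1 / 2), col z = x ∧
          2 * (μ / 2) ≤ dist z 0 := by
        intro x hx hx'
        obtain ⟨z, rfl, hz⟩ := Hlam 0 (by simp) x (by linarith [mem_ball.1 hx])
        refine ⟨z, hz, rfl, ?_⟩
        by_contra! hlt
        exact hx' (Hμ z (hhalf hz) 0 (by simp) (by linarith))
      obtain ⟨z, hz, rfl, hzμ⟩ := hco x hx hx'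
      obtain ⟨z', hz', rfl, hzμ'⟩ := hco y hy hy'
      obtain ⟨z'', e'', hzz⟩ := He5 z' (hhalf hz') (col z) (by linarith)
      rw [hce.injective e'', lt_min_iff] at hzz
      have h3 := hβ z hz z' hz' hzz.1
      rw [coord_apply hce, coord_apply hce, ← h3]
      simp only [hk', hxy, hx', hy', not_false_iff, and_self, if_true, chi, coord_apply hce]
      congr 1
      rw [cross_eq hzμ hzz.2]
      simp only [hU, hs, Complex.zero_re, Complex.zero_im]
      split_ifs <;> simp
    · rw [mem_ball] at *
      rw [dist_comm] at hxy
      linarith [dist_triangle y x (col 0)]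
  rw [h0, h2, hPd i₀ 0 (by simp) (subset_univ _)] at h1
  exact zero_ne_one h1

end Contradiction

/-! ### Odd cyclic chains of small sets -/

section Walks

variable {X : Type*}

/-- The walks that stay in a set of the family `𝒟` at each step, with the sum of the cochain. -/
inductive Reach (𝒟 : Set (Set X)) (ψ : X → X → ZMod 2) (u : X) : X → ZMod 2 → Prop
  | refl : Reach 𝒟 ψ u u 0
  | step {x y : X} {v : ZMod 2} {D : Set X} : Reach 𝒟 ψ u x v → D ∈ 𝒟 → x ∈ D → y ∈ D →
      Reach 𝒟 ψ u y (v + ψ x y)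

lemma Reach.trans {𝒟 : Set (Set X)} {ψ : X → X → ZMod 2} {u x y : X} {v w : ZMod 2}
    (h : Reach 𝒟 ψ u x v) (h' : Reach 𝒟 ψ x y w) : Reach 𝒟 ψ u y (v + w) := by
  induction h' with
  | refl => rwa [add_zero]
  | step _ hD hx hy ih => rw [← add_assoc]; exact ih.step hD hx hy

lemma Reach.symm {𝒟 : Set (Set X)} {ψ : X → X → ZMod 2} (hψ : SymNorm ψ) {u x : X} {v : ZMod 2}
    (h : Reach 𝒟 ψ u x v) : Reach 𝒟 ψ x u v := by
  induction h with
  | refl => exact .refl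
  | step _ hD hx hy ih =>
    have := (Reach.refl.step hD hy hx).trans ih
    rwa [zero_add, hψ.symm, add_comm] at this

/-- A cochain with even sum on all closed walks is a coboundary. -/
lemma exists_potential_of_walks {𝒟 : Set (Set X)} {ψ : X → X → ZMod 2} (hψ : SymNorm ψ)
    (h : ∀ u v, Reach 𝒟 ψ u u v → v = 0) :
    ∃ b : X → ZMod 2, ∀ D ∈ 𝒟, ∀ x ∈ D, ∀ y ∈ D, ψ x y = b x + b y := by
  let s : Setoid X :=
    { r := fun x y => ∃ v, Reach 𝒟 ψ x y v
      iseqv := ⟨fun _ => ⟨0, .refl⟩, fun ⟨v, hv⟩ => ⟨v, hv.symm hψ⟩,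
        fun ⟨_, hv⟩ ⟨_, hw⟩ => ⟨_, hv.trans hw⟩⟩ }
  have hrep : ∀ x, ∃ v, Reach 𝒟 ψ (Quotient.mk s x).out x v := fun x =>
    Quotient.exact (Quotient.out_eq (Quotient.mk s x))
  -- The potential at x is the sum along some walk from the representative of its class; the choice
  -- is immaterial since closed walks have sum 0.
  choose b hb using hrep
  refine ⟨b, fun D hD x hx y hy => ?_⟩
  have hq : Quotient.mk s x = Quotient.mk s y :=
    Quotient.sound ⟨_, Reach.refl.step hD hx hy⟩
  have h1 := (hb x).step hD hx hy
  have h2 := hb y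
  rw [← hq] at h2
  have h3 := h _ _ (h1.trans (h2.symm hψ))
  grind

/-- A cyclic chain of sets of the family `𝒟` with odd sum of the cochain `ψ`. -/
structure OddChain (𝒟 : Set (Set X)) (ψ : X → X → ZMod 2) (n : ℕ) (x : ℕ → X) (D : ℕ → Set X)
    (p : ℕ → ZMod 2) : Prop where
  mem : ∀ k < n, D k ∈ 𝒟
  left : ∀ k < n, x k ∈ D k
  right : ∀ k < n, x (k + 1) ∈ D k
  closed : x n = x 0
  pot : ∀ k < n, ψ (x k) (x (k + 1)) = p k + p (k + 1)
  odd : p 0 + p n = 1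

lemma Reach.exists_chain {𝒟 : Set (Set X)} {ψ : X → X → ZMod 2} {u y : X} {v : ZMod 2}
    (h : Reach 𝒟 ψ u y v) : ∃ (n : ℕ) (x : ℕ → X) (D : ℕ → Set X) (p : ℕ → ZMod 2),
      (∀ k < n, D k ∈ 𝒟) ∧ (∀ k < n, x k ∈ D k) ∧ (∀ k < n, x (k + 1) ∈ D k) ∧
      (∀ k < n, ψ (x k) (x (k + 1)) = p k + p (k + 1)) ∧ x 0 = u ∧ x n = y ∧ p 0 = 0 ∧ p n = v := by
  induction h with
  | refl => exact ⟨0, fun _ => u, fun _ => ∅, fun _ => 0, by simp⟩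
  | @step x' y' v' D' _ hD hx hy ih =>
    obtain ⟨n, x, D, p, h1, h2, h3, h4, h5, h6, h7, h8⟩ := ih
    refine ⟨n + 1, fun k => if k ≤ n then x k else y', fun k => if k < n then D k else D',
      fun k => if k ≤ n then p k else v' + ψ x' y', ?_, ?_, ?_, ?_, ?_, ?_, ?_, ?_⟩
    · intro k hk
      by_cases h : k < n
      · simp only [h, if_true]; exact h1 k h
      · simp only [h, if_false]; exact hD
    · intro k hk
      by_cases h : k < n
      · simp only [h, h.le, if_true]; exact h2 k h
      · obtain rfl : k = n := by omega
        simp only [lt_irrefl, le_refl, if_true, if_false, h6]; exact hx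
    · intro k hk
      by_cases h : k < n
      · simp only [h, Nat.succ_le_of_lt h, if_true]; exact h3 k h
      · have : ¬ k + 1 ≤ n := by omega
        simp only [h, this, if_false]; exact hy
    · intro k hk
      by_cases h : k < n
      · simp only [h.le, Nat.succ_le_of_lt h, if_true]; exact h4 k h
      · obtain rfl : k = n := by omega
        have : ¬ k + 1 ≤ k := by omega
        simp only [le_refl, this, if_true, if_false, h6, h8]
        grind
    · simpa using h5
    · simp
    · simpa using h7
    · simp

/-- If a cochain is not a coboundary, then there is a cyclic odd chain. -/
lemma exists_oddChain {𝒟 : Set (Set X)} {ψ : X → X → ZMod 2} (hψ : SymNorm ψ)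
    (h : ¬ ∃ b : X → ZMod 2, ∀ D ∈ 𝒟, ∀ x ∈ D, ∀ y ∈ D, ψ x y = b x + b y) :
    ∃ n x D p, OddChain 𝒟 ψ n x D p := by
  by_contra! hc
  refine h (exists_potential_of_walks hψ fun u v hv => ?_)
  obtain ⟨n, x, D, p, h1, h2, h3, h4, h5, h6, h7, h8⟩ := hv.exists_chain
  by_contra hv0
  exact hc n x D p ⟨h1, h2, h3, h6.trans h5.symm, h4, by rw [h7, h8, zmod_two_ne_zero hv0, zero_add]⟩

variable [PseudoMetricSpace X]

/-- In an odd chain of minimal length, only consecutive sets meet. -/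
lemma OddChain.disjoint {𝒟 : Set (Set X)} {ψ : X → X → ZMod 2} {ε : ℝ}
    (hψ : IsCocycleOn ψ univ ε) (h𝒟 : ∀ D ∈ 𝒟, ∀ x ∈ D, ∀ y ∈ D, dist x y < ε)
    {n : ℕ} {x : ℕ → X} {D : ℕ → Set X} {p : ℕ → ZMod 2} (h : OddChain 𝒟 ψ n x D p)
    (hmin : ∀ m < n, ∀ x D p, ¬ OddChain 𝒟 ψ m x D p) {i j : ℕ} (hij : i + 2 ≤ j) (hj : j < n)
    (hji : j + 2 ≤ i + n) : Disjoint (D i) (D j) := by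
  -- A common point y cuts the chain into two closed chains through y whose values add up to 1, so
  -- one of them is odd. The indices being cyclically non-adjacent is what makes both shorter than
  -- n.
  rw [Set.disjoint_left]
  intro y hyi hyj
  have hi : i < n := by omega
  have tri : ∀ k < n, y ∈ D k → p k + p (k + 1) = ψ (x k) y + ψ y (x (k + 1)) := by
    intro k hk hy
    have hd := h𝒟 (D k) (h.mem k hk)
    rw [← h.pot k hk]
    exact hψ.triangle (mem_univ _) (mem_univ _) (mem_univ _) (hd _ (h.left k hk) _ hy)
      (hd _ hy _ (h.right k hk)) (hd _ (h.left k hk) _ (h.right k hk))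
  have e1 := tri i hi hyi
  have e2 := tri j hj hyj
  have hodd := h.odd
  -- the values of the two shorter chains
  set a : ZMod 2 := ψ y (x (i + 1)) + p (i + 1) + p j + ψ (x j) y with ha
  have hsum : a + (p 0 + p i + ψ (x i) y + ψ y (x (j + 1)) + p (j + 1) + p n) = 1 := by
    rw [ha]; grind
  rcases zmod_two_cases a with h0 | h1
  · -- the chain that skips the part between `i` and `j`
    obtain ⟨d, hd⟩ : ∃ d, j = i + 1 + d := ⟨j - i - 1, by omega⟩
    refine hmin (n - d) (by omega) (fun k => if k ≤ i then x k else if k = i + 1 then y else x (k + d))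
      (fun k => if k ≤ i then D k else D (k + d))
      (fun k => if k ≤ i then p k else if k = i + 1 then p i + ψ (x i) y else
        p i + ψ (x i) y + ψ y (x (j + 1)) + p (j + 1) + p (k + d)) ⟨?_, ?_, ?_, ?_, ?_, ?_⟩
    · intro k hk
      by_cases h1 : k ≤ i
      · simp only [h1, if_true]; exact h.mem k (by omega)
      · simp only [h1, if_false]; exact h.mem _ (by omega)
    · intro k hk
      by_cases h1 : k ≤ i
      · simp only [h1, if_true]; exact h.left k (by omega)
      · by_cases h2 : k = i + 1
        · subst h2; simp only [h1, if_true, if_false, ← hd]; exact hyj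
        · simp only [h1, h2, if_false]; exact h.left _ (by omega)
    · intro k hk
      by_cases h1 : k ≤ i
      · by_cases h2 : k = i
        · subst h2
          have : ¬ k + 1 ≤ k := by omega
          simp only [le_refl, this, if_true, if_false]; exact hyi
        · have : k + 1 ≤ i := by omega
          simp only [h1, this, if_true]; exact h.right k (by omega)
      · have h2 : ¬ k + 1 ≤ i := by omega
        have h3 : ¬ k + 1 = i + 1 := by omega
        simp only [h1, h2, h3, if_false]
        rw [show k + 1 + d = k + d + 1 by omega]
        exact h.right _ (by omega)
    · have h2 : ¬ n - d ≤ i := by omega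
      have h3 : ¬ n - d = i + 1 := by omega
      simp only [h2, h3, if_false, Nat.zero_le, if_true]
      rw [show n - d + d = n by omega]
      exact h.closed
    · intro k hk
      by_cases h1 : k ≤ i
      · by_cases h2 : k = i
        · subst h2
          have : ¬ k + 1 ≤ k := by omega
          simp only [le_refl, this, if_true, if_false]
          grind
        · have : k + 1 ≤ i := by omega
          simp only [h1, this, if_true]; exact h.pot k (by omega)
      · have h2 : ¬ k + 1 ≤ i := by omega
        have h3 : ¬ k + 1 = i + 1 := by omega
        by_cases h4 : k = i + 1
        · have h5 : k + 1 + d = j + 1 := by omega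
          have h6 : ¬ i + 1 ≤ i := by omega
          simp only [h4, h6, if_true, if_false]
          rw [h4] at h2 h3 h5
          simp only [h2, h3, if_false, h5]
          grind
        · simp only [h1, h2, h3, h4, if_false]
          rw [show k + 1 + d = k + d + 1 by omega, h.pot _ (by omega)]
          grind
    · have h2 : ¬ n - d ≤ i := by omega
      have h3 : ¬ n - d = i + 1 := by omega
      simp only [h2, h3, if_false, Nat.zero_le, if_true]
      rw [show n - d + d = n by omega]
      rw [h0] at hsum
      grind
  · -- the chain between `i` and `j`
    obtain ⟨d, hd⟩ : ∃ d, j = i + d := ⟨j - i, by omega⟩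
    refine hmin (d + 1) (by omega) (fun k => if k = 0 then y else if k ≤ d then x (i + k) else y)
      (fun k => D (i + k))
      (fun k => if k = 0 then 0 else if k ≤ d then ψ y (x (i + 1)) + p (i + 1) + p (i + k) else a)
      ⟨?_, ?_, ?_, ?_, ?_, ?_⟩
    · exact fun k hk => h.mem _ (by omega)
    · intro k hk
      by_cases h2 : k = 0
      · subst h2; simpa using hyi
      · have h3 : k ≤ d := by omega
        simp only [h2, h3, if_false, if_true]; exact h.left _ (by omega)
    · intro k hk
      by_cases h3 : k + 1 ≤ d
      · simp only [Nat.succ_ne_zero, h3, if_false, if_true]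
        exact h.right _ (by omega)
      · simp only [Nat.succ_ne_zero, h3, if_false]
        rwa [show i + k = j by omega]
    · have : ¬ d + 1 ≤ d := by omega
      simp only [Nat.succ_ne_zero, this, if_false, if_true]
    · intro k hk
      by_cases h2 : k = 0
      · subst h2
        have h3 : 0 + 1 ≤ d := by omega
        simp only [if_true, Nat.succ_ne_zero, h3, if_false]
        grind
      · have h3 : k ≤ d := by omega
        by_cases h4 : k + 1 ≤ d
        · simp only [h2, h3, h4, Nat.succ_ne_zero, if_false, if_true]
          rw [← add_assoc i k 1, h.pot _ (by omega)]
          grind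
        · have h5 : i + k = j := by omega
          simp only [h2, h3, h4, Nat.succ_ne_zero, if_false, if_true, h5]
          rw [ha]; grind
    · have : ¬ d + 1 ≤ d := by omega
      simp only [Nat.succ_ne_zero, this, if_false, if_true, zero_add]
      exact h1

/-- An odd chain of small sets has at least four members. -/
lemma OddChain.four_le {𝒟 : Set (Set X)} {ψ : X → X → ZMod 2} {ε : ℝ} (hs : SymNorm ψ)
    (hψ : IsCocycleOn ψ univ ε) (h𝒟 : ∀ D ∈ 𝒟, ∀ x ∈ D, ∀ y ∈ D, dist x y < ε)
    {n : ℕ} {x : ℕ → X} {D : ℕ → Set X} {p : ℕ → ZMod 2} (h : OddChain 𝒟 ψ n x D p) : 4 ≤ n := by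
  by_contra! hn
  have hodd := h.odd
  have hcl := h.closed
  have hd : ∀ k < n, dist (x k) (x (k + 1)) < ε := fun k hk =>
    h𝒟 _ (h.mem k hk) _ (h.left k hk) _ (h.right k hk)
  have hpot := h.pot
  obtain rfl | rfl | rfl | rfl : n = 0 ∨ n = 1 ∨ n = 2 ∨ n = 3 := by omega
  · grind
  · have e := hpot 0 (by omega)
    simp only [zero_add] at e
    rw [hcl, hs.diag] at e
    grind
  · have e := hpot 0 (by omega)
    have e' := hpot 1 (by omega)
    simp only [zero_add, Nat.reduceAdd] at e e'
    rw [hcl, hs.symm] at e'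
    grind
  · have e := hpot 0 (by omega)
    have e' := hpot 1 (by omega)
    have e'' := hpot 2 (by omega)
    have d := hd 0 (by omega)
    have d' := hd 1 (by omega)
    have d'' := hd 2 (by omega)
    simp only [zero_add, Nat.reduceAdd] at e e' e'' d d' d''
    rw [hcl] at e'' d''
    rw [dist_comm] at d''
    have := hψ.triangle (mem_univ _) (mem_univ _) (mem_univ _) d d' d''
    rw [hs.symm] at e''
    grind

end Walks

/-! ### Simple closed curves in minimal odd chains -/

section Arcs

variable {X : Type*} [MetricSpace X]

/-- Any two points of the set are joined by an arc in it. -/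
def ArcConn (D : Set X) : Prop :=
  ∀ x ∈ D, ∀ y ∈ D, ∃ σ : ℝ → X, Continuous σ ∧ σ 0 = x ∧ σ 1 = y ∧ (∀ s ∈ Icc (0 : ℝ) 1, σ s ∈ D) ∧
    (x ≠ y → InjOn σ (Icc 0 1))

lemma arcConn_image {f : ℂ → X} (hf : IsOpenEmbedding f) {B : Set ℂ} (hB : Convex ℝ B) :
    ArcConn (f '' B) := by
  rintro _ ⟨z, hz, rfl⟩ _ ⟨w, hw, rfl⟩
  refine ⟨fun s => f (AffineMap.lineMap z w s), hf.continuous.comp AffineMap.lineMap_continuous,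
    by simp, by simp, fun s hs => ⟨_, hB.lineMap_mem hz hw hs, rfl⟩, fun hne s _ s' _ h => ?_⟩
  have hzw : z ≠ w := fun h => hne (by rw [h])
  exact AffineMap.lineMap_injective ℝ hzw (hf.injective h)

open Classical in
/-- The concatenation of two paths. -/
noncomputable def concat (A : ℝ → X) (a : ℝ) (B : ℝ → X) : ℝ → X :=
  fun t => if t ≤ a then A t else B (t - a)

lemma concat_of_le {A B : ℝ → X} {a t : ℝ} (h : t ≤ a) : concat A a B t = A t := if_pos h

lemma concat_of_ge {A B : ℝ → X} {a t : ℝ} (hAB : A a = B 0) (h : a ≤ t) :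
    concat A a B t = B (t - a) := by
  rcases h.eq_or_lt with rfl | h
  · rw [concat_of_le le_rfl, sub_self, hAB]
  · exact if_neg (not_le.2 h)

lemma continuousOn_concat {A B : ℝ → X} {a b : ℝ} (ha : 0 ≤ a) (hb : 0 ≤ b)
    (hA : ContinuousOn A (Icc 0 a)) (hB : ContinuousOn B (Icc 0 b)) (hAB : A a = B 0) :
    ContinuousOn (concat A a B) (Icc 0 (a + b)) := by
  have h1 : ContinuousOn (concat A a B) (Icc 0 a) :=
    hA.congr fun t ht => concat_of_le ht.2
  have h2 : ContinuousOn (concat A a B) (Icc a (a + b)) := by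
    refine (hB.comp (f := fun t => t - a) (by fun_prop) fun t ht => ?_).congr
      fun t ht => concat_of_ge hAB ht.1
    exact ⟨by linarith [ht.1], by linarith [ht.2]⟩
  rw [← Icc_union_Icc_eq_Icc ha (by linarith : a ≤ a + b)]
  exact h1.union_of_isClosed h2 isClosed_Icc isClosed_Icc

lemma hasInt_concat {ψ : X → X → ZMod 2} {ε : ℝ} (hε : 0 < ε) (hψ : IsCocycleOn ψ univ ε)
    {A B : ℝ → X} {a b : ℝ} {u v : ZMod 2} (ha : 0 ≤ a) (hb : 0 ≤ b)
    (hA : ContinuousOn A (Icc 0 a)) (hB : ContinuousOn B (Icc 0 b)) (hAB : A a = B 0)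
    (hu : HasInt ψ A 0 a u) (hv : HasInt ψ B 0 b v) : HasInt ψ (concat A a B) 0 (a + b) (u + v) := by
  obtain ⟨w, hw⟩ := exists_hasInt hε hψ (continuousOn_concat ha hb hA hB hAB) (mapsTo_univ _ _)
  have h1 : HasInt ψ (concat A a B) 0 a u := by
    have := hu.congr (B := concat A a B) 0 fun t ht => by rw [add_zero, concat_of_le ht.2]
    simpa using this
  have h2 : HasInt ψ (concat A a B) a (a + b) v := by
    have := hv.congr (B := concat A a B) a fun t ht => by
      rw [concat_of_ge hAB (by linarith [ht.1]), add_sub_cancel_right]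
    rwa [zero_add, add_comm b a] at this
  rwa [← hw.split ha (by linarith) h1 h2]

lemma injOn_concat {A B : ℝ → X} {a b : ℝ} {s : Set ℝ} (hs : s ⊆ Icc 0 (a + b))
    (hA : InjOn A (Icc 0 a)) (hB : InjOn B (Icc 0 b)) (hAB : A a = B 0)
    (hd : ∀ t ∈ s, a < t → B (t - a) ∉ A '' Icc 0 a) : InjOn (concat A a B) s := by
  intro t ht t' ht' h
  rcases le_or_gt t a with h1 | h1 <;> rcases le_or_gt t' a with h2 | h2
  · rw [concat_of_le h1, concat_of_le h2] at h
    exact hA ⟨(hs ht).1, h1⟩ ⟨(hs ht').1, h2⟩ h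
  · rw [concat_of_le h1, concat_of_ge hAB h2.le] at h
    exact absurd ⟨t, ⟨(hs ht).1, h1⟩, h⟩ (hd t' ht' h2)
  · rw [concat_of_le h2, concat_of_ge hAB h1.le] at h
    exact absurd ⟨t', ⟨(hs ht').1, h2⟩, h.symm⟩ (hd t ht h1)
  · rw [concat_of_ge hAB h1.le, concat_of_ge hAB h2.le] at h
    have := hB ⟨by linarith, by linarith [(hs ht).2]⟩ ⟨by linarith, by linarith [(hs ht').2]⟩ h
    linarith

/-- A minimal chain contains an arc that runs through its first members. -/
lemma exists_arc {𝒟 : Set (Set X)} {ψ : X → X → ZMod 2} {ε : ℝ} (hε : 0 < ε)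
    (hψ : IsCocycleOn ψ univ ε) (h𝒟 : ∀ D ∈ 𝒟, ∀ x ∈ D, ∀ y ∈ D, dist x y < ε)
    (harc : ∀ D ∈ 𝒟, ArcConn D)
    {n : ℕ} {x : ℕ → X} {D : ℕ → Set X} {p : ℕ → ZMod 2} (h : OddChain 𝒟 ψ n x D p)
    (hdisj : ∀ i j, i + 2 ≤ j → j < n → j + 2 ≤ i + n → Disjoint (D i) (D j)) (k : ℕ)
    (hk : k + 2 ≤ n) : ∀ y ∈ D k, ∃ (A : ℝ → X) (T : ℝ), 0 ≤ T ∧ ContinuousOn A (Icc 0 T) ∧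
      InjOn A (Icc 0 T) ∧ A 0 = x 0 ∧ A T = y ∧
      (∀ t ∈ Icc 0 T, (∃ i < k, A t ∈ D i) ∨ ∀ u ∈ Icc t T, A u ∈ D k) ∧
      (∀ t ∈ Icc 0 T, (∃ i, 1 ≤ i ∧ i ≤ k ∧ A t ∈ D i) ∨ ∀ u ∈ Icc 0 t, A u ∈ D 0) ∧
      HasInt ψ A 0 T (p 0 + p k + ψ (x k) y) := by
  induction k with
  | zero =>
    intro y hy
    obtain ⟨σ, hσ, hσ0, hσ1, hσD, hσi⟩ := harc _ (h.mem 0 (by omega)) _ (h.left 0 (by omega)) y hy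
    have hint : ∀ T ∈ Icc (0 : ℝ) 1, HasInt ψ σ 0 T (ψ (x 0) (σ T)) := by
      intro T hT
      rw [← hσ0]
      exact hasInt_of_small hψ hT.1 (mapsTo_univ _ _) fun s hs s' hs' =>
        h𝒟 _ (h.mem 0 (by omega)) _ (hσD s ⟨hs.1, hs.2.trans hT.2⟩) _ (hσD s' ⟨hs'.1, hs'.2.trans hT.2⟩)
    by_cases hxy : x 0 = y
    · refine ⟨σ, 0, le_rfl, hσ.continuousOn, ?_, hσ0, hσ0.trans hxy, ?_, ?_, ?_⟩
      · rw [Icc_self]; exact injOn_singleton _ _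
      · exact fun t ht => Or.inr fun u hu => hσD u ⟨ht.1.trans hu.1, by linarith [hu.2]⟩
      · exact fun t ht => Or.inr fun u hu => hσD u ⟨hu.1, by linarith [hu.2, ht.2]⟩
      · have := hint 0 (by simp)
        rw [hσ0] at this
        rwa [zmod_two_add_self, zero_add, ← hxy]
    · refine ⟨σ, 1, zero_le_one, hσ.continuousOn, hσi hxy, hσ0, hσ1, ?_, ?_, ?_⟩
      · exact fun t ht => Or.inr fun u hu => hσD u ⟨ht.1.trans hu.1, hu.2⟩
      · exact fun t ht => Or.inr fun u hu => hσD u ⟨hu.1, hu.2.trans ht.2⟩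
      · have := hint 1 (by simp)
        rwa [zmod_two_add_self, zero_add, ← hσ1]
  | succ k ih =>
    intro y hy
    have hDk := h𝒟 _ (h.mem k (by omega))
    have hDk1 := h𝒟 _ (h.mem (k + 1) (by omega))
    obtain ⟨A, T, hT, hAc, hAi, hA0, hAT, htail, hhead, hint⟩ :=
      ih (by omega) (x (k + 1)) (h.right k (by omega))
    obtain ⟨σ, hσ, hσ0, hσ1, hσD, hσi⟩ :=
      harc _ (h.mem (k + 1) (by omega)) y hy _ (h.left (k + 1) (by omega))
    -- The arc in the next set is followed from y up to its first meeting with the arc already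
    -- built; the old arc is cut there and the new one is run backwards to y.
    have hcl : IsCompact (Icc (0 : ℝ) 1 ∩ σ ⁻¹' (A '' Icc 0 T)) :=
      isCompact_Icc.inter_right ((isCompact_Icc.image_of_continuousOn hAc).isClosed.preimage hσ)
    obtain ⟨s, ⟨hs, t, ht, hts⟩, hsmin⟩ := hcl.exists_isLeast
      ⟨1, by simp, T, ⟨hT, le_rfl⟩, by rw [hAT, hσ1]⟩
    have hAtD : A t ∈ D (k + 1) := by rw [hts]; exact hσD s hs
    -- The next set is disjoint from all earlier ones except the last, so the cut is in the final
    -- portion of the old arc and the part removed is small.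
    have htl : ∀ u ∈ Icc t T, A u ∈ D k := by
      refine (htail t ht).resolve_left ?_
      rintro ⟨i, hi, hAi'⟩
      exact Set.disjoint_left.1 (hdisj i (k + 1) (by omega) (by omega) (by omega)) hAi' hAtD
    set B : ℝ → X := fun u => σ (s - u) with hB
    have hBc : ContinuousOn B (Icc 0 s) := (hσ.comp (continuous_const.sub continuous_id)).continuousOn
    have hAB : A t = B 0 := by simp only [hB, sub_zero, hts]
    have hBD : ∀ u ∈ Icc 0 s, B u ∈ D (k + 1) := fun u hu =>
      hσD _ ⟨by linarith [hu.2], by linarith [hu.1, hs.2]⟩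
    have hBi : InjOn B (Icc 0 s) := by
      by_cases hxy : y = x (k + 1)
      · have hs0 : s ≤ 0 := hsmin ⟨by simp, T, ⟨hT, le_rfl⟩, by rw [hAT, hσ0, hxy]⟩
        have : s = 0 := le_antisymm hs0 hs.1
        rw [this, Icc_self]
        exact injOn_singleton _ _
      · intro u hu u' hu' e
        have := hσi hxy ⟨by linarith [hu.2], by linarith [hu.1, hs.2]⟩
          ⟨by linarith [hu'.2], by linarith [hu'.1, hs.2]⟩ e
        linarith
    have hBs : B s = y := by simp only [hB, sub_self, hσ0]
    have hAc' := hAc.mono (Icc_subset_Icc_right ht.2)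
    refine ⟨concat A t B, t + s, add_nonneg ht.1 hs.1, continuousOn_concat ht.1 hs.1 hAc' hBc hAB,
      injOn_concat subset_rfl (hAi.mono (Icc_subset_Icc_right ht.2)) hBi hAB ?_, ?_, ?_, ?_, ?_, ?_⟩
    · rintro u hu htu ⟨v, hv, e⟩
      have h1 := hsmin (⟨⟨by linarith [hu.2], by linarith [hs.2]⟩, v, ⟨hv.1, hv.2.trans ht.2⟩, e⟩ :
        s - (u - t) ∈ Icc (0 : ℝ) 1 ∩ σ ⁻¹' (A '' Icc 0 T))
      linarith
    · rw [concat_of_le ht.1, hA0]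
    · rw [concat_of_ge hAB (by linarith [hs.1]), add_sub_cancel_left, hBs]
    · intro u hu
      rcases le_total u t with hut | hut
      · left
        rw [concat_of_le hut]
        rcases htail u ⟨hu.1, hut.trans ht.2⟩ with ⟨i, hi, hAi'⟩ | h1
        · exact ⟨i, by omega, hAi'⟩
        · exact ⟨k, by omega, h1 u ⟨le_rfl, hut.trans ht.2⟩⟩
      · right
        intro v hv
        rw [concat_of_ge hAB (hut.trans hv.1)]
        exact hBD _ ⟨by linarith [hv.1], by linarith [hv.2]⟩
    · intro u hu
      rcases le_total u t with hut | hut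
      · rcases hhead u ⟨hu.1, hut.trans ht.2⟩ with ⟨i, hi, hi', hAi'⟩ | h1
        · exact Or.inl ⟨i, hi, by omega, by rwa [concat_of_le hut]⟩
        · right
          intro v hv
          rw [concat_of_le (hv.2.trans hut)]
          exact h1 v hv
      · refine Or.inl ⟨k + 1, by omega, le_rfl, ?_⟩
        rw [concat_of_ge hAB hut]
        exact hBD _ ⟨by linarith, by linarith [hu.2]⟩
    -- The removed piece and the added one lie in small sets, so their integrals are the values of ψ
    -- at their endpoints.
    · obtain ⟨I, J, hI, hJ, hIJ⟩ := hint.sub_left ht.1 ht.2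
      have h1 := hJ.unique ht.2 (hasInt_of_small hψ ht.2 (mapsTo_univ _ _) fun u hu v hv =>
        hDk _ (htl u hu) _ (htl v hv))
      have h2 := hasInt_of_small hψ hs.1 (mapsTo_univ B _) fun u hu v hv =>
        hDk1 _ (hBD u hu) _ (hBD v hv)
      have h3 := hasInt_concat hε hψ ht.1 hs.1 hAc' hBc hAB hI h2
      rw [← hAB, hBs] at h3
      rw [hAT] at h1
      have hx1 := h.left (k + 1) (by omega)
      have h4 := hψ.triangle (mem_univ _) (mem_univ _) (mem_univ _) (hDk1 _ hx1 _ hAtD)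
        (hDk1 _ hAtD _ hy) (hDk1 _ hx1 _ hy)
      have h5 := hψ.symm (mem_univ _) (mem_univ _) (hDk1 _ hx1 _ hAtD)
      have h6 := h.pot k (by omega)
      have h7 : p 0 + p (k + 1) + ψ (x (k + 1)) y = I + ψ (A t) y := by grind
      rwa [h7]

/-- A minimal odd chain contains a simple closed curve with odd integral. -/
theorem exists_loop {𝒟 : Set (Set X)} {ψ : X → X → ZMod 2} {ε : ℝ} (hε : 0 < ε)
    (hψ : IsCocycleOn ψ univ ε) (h𝒟 : ∀ D ∈ 𝒟, ∀ x ∈ D, ∀ y ∈ D, dist x y < ε)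
    (harc : ∀ D ∈ 𝒟, ArcConn D) (hopen : ∀ D ∈ 𝒟, IsOpen D)
    {n : ℕ} {x : ℕ → X} {D : ℕ → Set X} {p : ℕ → ZMod 2} (h : OddChain 𝒟 ψ n x D p) (hn : 4 ≤ n)
    (hdisj : ∀ i j, i + 2 ≤ j → j < n → j + 2 ≤ i + n → Disjoint (D i) (D j)) :
    ∃ (C : ℝ → X) (L : ℝ), 0 < L ∧ ContinuousOn C (Icc 0 L) ∧ InjOn C (Ico 0 L) ∧ C L = C 0 ∧
      (∀ t ∈ Icc 0 L, ∃ k < n, C t ∈ D k) ∧ HasInt ψ C 0 L 1 := by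
  obtain ⟨m, rfl⟩ : ∃ m, n = m + 2 := ⟨n - 2, by omega⟩
  have hDm1 := h𝒟 _ (h.mem (m + 1) (by omega))
  have hDm := h𝒟 _ (h.mem m (by omega))
  have hD0 := h𝒟 _ (h.mem 0 (by omega))
  obtain ⟨A, T, hT, hAc, hAi, hA0, hAT, htail, hhead, hint⟩ :=
    exists_arc hε hψ h𝒟 harc h hdisj m le_rfl (x (m + 1)) (h.right m (by omega))
  have hx0 : x 0 ∈ D (m + 1) := by rw [← h.closed]; exact h.right (m + 1) (by omega)
  have hx1 := h.left (m + 1) (by omega)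
  obtain ⟨σ, hσ, hσ0, hσ1, hσD, hσi⟩ := harc _ (h.mem (m + 1) (by omega)) _ hx0 _ hx1
  have h0m : Disjoint (D 0) (D m) := hdisj 0 m (by omega) (by omega) (by omega)
  have hcase : ∀ t ∈ Icc 0 T, A t ∈ D (m + 1) →
      (A t ∈ D 0 ∧ A t ∉ D m ∧ ∀ u ∈ Icc 0 t, A u ∈ D 0) ∨
      (A t ∈ D m ∧ A t ∉ D 0 ∧ ∀ u ∈ Icc t T, A u ∈ D m) := by
    intro t ht hAt
    have honly : ∀ i ≤ m, A t ∈ D i → i = 0 ∨ i = m := by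
      intro i hi hAi'
      by_contra! hc
      exact Set.disjoint_left.1 (hdisj i (m + 1) (by omega) (by omega) (by omega)) hAi' hAt
    have hcov : A t ∈ D 0 ∨ A t ∈ D m := by
      rcases htail t ht with ⟨i, hi, h1⟩ | h1
      · rcases honly i hi.le h1 with rfl | rfl
        · exact Or.inl h1
        · exact Or.inr h1
      · exact Or.inr (h1 t ⟨le_rfl, ht.2⟩)
    rcases hcov with h1 | h1
    · have h2 := Set.disjoint_left.1 h0m h1
      refine Or.inl ⟨h1, h2, (hhead t ht).resolve_left ?_⟩
      rintro ⟨i, hi, hi', h3⟩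
      rcases honly i hi' h3 with rfl | rfl
      · omega
      · exact h2 h3
    · have h2 : A t ∉ D 0 := fun h2 => Set.disjoint_left.1 h0m h2 h1
      refine Or.inr ⟨h1, h2, (htail t ht).resolve_left ?_⟩
      rintro ⟨i, hi, h3⟩
      rcases honly i hi.le h3 with rfl | rfl
      · exact h2 h3
      · omega
  have hσimg : IsClosed (σ '' Icc 0 1) := (isCompact_Icc.image hσ).isClosed
  have hK : ∀ U : Set X, IsOpen U → IsCompact ((Icc 0 T ∩ A ⁻¹' (σ '' Icc 0 1)) ∩ A ⁻¹' Uᶜ) := by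
    intro U hU
    have h1 := hAc.preimage_isClosed_of_isClosed isClosed_Icc (hσimg.inter hU.isClosed_compl)
    have h2 : (Icc 0 T ∩ A ⁻¹' (σ '' Icc 0 1)) ∩ A ⁻¹' Uᶜ =
        Icc 0 T ∩ (Icc 0 T ∩ A ⁻¹' (σ '' Icc 0 1 ∩ Uᶜ)) := by
      ext t; simp only [mem_inter_iff, mem_preimage]; tauto
    rw [h2]
    exact isCompact_Icc.inter_right h1
  -- The last set of the chain meets the arc only in its initial portion, inside D 0, or its final
  -- portion, inside D m. The parameters of the meeting points with σ split accordingly into two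
  -- compact sets.
  set K0 := (Icc 0 T ∩ A ⁻¹' (σ '' Icc 0 1)) ∩ A ⁻¹' (D m)ᶜ with hK0
  set K1 := (Icc 0 T ∩ A ⁻¹' (σ '' Icc 0 1)) ∩ A ⁻¹' (D 0)ᶜ with hK1
  have hK0c : IsCompact K0 := hK _ (hopen _ (h.mem m (by omega)))
  have hK1c : IsCompact K1 := hK _ (hopen _ (h.mem 0 (by omega)))
  have hsub : ∀ t ∈ Icc 0 T ∩ A ⁻¹' (σ '' Icc 0 1), A t ∈ D (m + 1) := by
    rintro t ⟨-, s, hs, e⟩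
    rw [← e]; exact hσD s hs
  have hH : ∀ K : Set ℝ, IsCompact K → K ⊆ Icc 0 T → IsCompact (Icc (0 : ℝ) 1 ∩ σ ⁻¹' (A '' K)) :=
    fun K hKc hKT => isCompact_Icc.inter_right
      ((hKc.image_of_continuousOn (hAc.mono hKT)).isClosed.preimage hσ)
  have hK0T : K0 ⊆ Icc 0 T := fun t ht => ht.1.1
  have hK1T : K1 ⊆ Icc 0 T := fun t ht => ht.1.1
  have h0K : (0 : ℝ) ∈ K0 := by
    refine ⟨⟨⟨le_rfl, hT⟩, 0, by simp, by rw [hσ0, hA0]⟩, ?_⟩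
    rw [mem_preimage, hA0]
    exact Set.disjoint_left.1 h0m (h.left 0 (by omega))
  have hTK : T ∈ K1 := by
    refine ⟨⟨⟨hT, le_rfl⟩, 1, by simp, by rw [hσ1, hAT]⟩, ?_⟩
    rw [mem_preimage, hAT]
    exact fun h' => Set.disjoint_left.1 h0m h' (h.right m (by omega))
  -- The first point of σ on the final portion, then the last point of σ before it on the initial
  -- portion: between them σ avoids the arc, so together with the arc between the two points it
  -- forms a simple loop.
  obtain ⟨s₁, ⟨hs₁, t₁, ht₁, e₁⟩, hmin₁⟩ := (hH K1 hK1c hK1T).exists_isLeast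
    ⟨1, by simp, T, hTK, by rw [hAT, hσ1]⟩
  obtain ⟨s₀, ⟨⟨hs₀, t₀, ht₀, e₀⟩, hs₀₁⟩, hmax₀⟩ :=
    ((hH K0 hK0c hK0T).inter_right (isClosed_Iic (a := s₁))).exists_isGreatest
    ⟨0, ⟨by simp, 0, h0K, by rw [hA0, hσ0]⟩, hs₁.1⟩
  have c₀ : ∀ u ∈ Icc 0 t₀, A u ∈ D 0 := by
    rcases hcase t₀ (hK0T ht₀) (hsub t₀ ht₀.1) with h1 | h1
    · exact h1.2.2
    · exact absurd h1.1 ht₀.2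
  have c₁ : ∀ u ∈ Icc t₁ T, A u ∈ D m := by
    rcases hcase t₁ (hK1T ht₁) (hsub t₁ ht₁.1) with h1 | h1
    · exact absurd h1.1 ht₁.2
    · exact h1.2.2
  have hT₀ := hK0T ht₀
  have hT₁ := hK1T ht₁
  have ht₀₁ : t₀ < t₁ := by
    by_contra! hle
    exact ht₁.2 (c₀ t₁ ⟨hT₁.1, hle⟩)
  have hslt : s₀ < s₁ := by
    refine lt_of_le_of_ne hs₀₁ fun e => ?_
    rw [e, ← e₁] at e₀
    exact ht₀₁.ne (hAi hT₀ hT₁ e₀)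
  have hfree : ∀ s, s₀ < s → s < s₁ → ∀ t ∈ Icc 0 T, A t ≠ σ s := by
    intro s h1 h2 t ht e
    have hs : s ∈ Icc (0 : ℝ) 1 := ⟨hs₀.1.trans h1.le, h2.le.trans hs₁.2⟩
    by_cases hm : A t ∈ D m
    · have : A t ∉ D 0 := fun h' => Set.disjoint_left.1 h0m h' hm
      have h3 := hmin₁ ⟨hs, t, ⟨⟨ht, s, hs, e.symm⟩, this⟩, e⟩
      linarith
    · have h3 := hmax₀ ⟨⟨hs, t, ⟨⟨ht, s, hs, e.symm⟩, hm⟩, e⟩, h2.le⟩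
      linarith
  have hσne : x 0 ≠ x (m + 1) := by
    intro e
    exact Set.disjoint_left.1 h0m (h.left 0 (by omega)) (by rw [e]; exact h.right m (by omega))
  set A' : ℝ → X := fun t => A (t + t₀) with hA'
  set B : ℝ → X := fun u => σ (s₁ - u) with hB
  set a := t₁ - t₀ with ha
  set b := s₁ - s₀ with hb
  have ha0 : 0 < a := sub_pos.2 ht₀₁
  have hb0 : 0 < b := sub_pos.2 hslt
  have hin : ∀ t ∈ Icc 0 a, t + t₀ ∈ Icc 0 T := fun t ht =>
    ⟨by linarith [ht.1, hT₀.1], by linarith [ht.2, hT₁.2]⟩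
  have hinB : ∀ u ∈ Icc 0 b, s₁ - u ∈ Icc (0 : ℝ) 1 := fun u hu =>
    ⟨by linarith [hu.2, hs₀.1], by linarith [hu.1, hs₁.2]⟩
  have hA'c : ContinuousOn A' (Icc 0 a) := hAc.comp (by fun_prop) hin
  have hBc : ContinuousOn B (Icc 0 b) := (hσ.comp (continuous_const.sub continuous_id)).continuousOn
  have hAB : A' a = B 0 := by simp only [hA', hB, ha, sub_add_cancel, sub_zero, e₁]
  have hBA : B b = A' 0 := by simp only [hA', hB, hb, sub_sub_cancel, zero_add, e₀]
  have hA'i : InjOn A' (Icc 0 a) := fun t ht t' ht' e => by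
    have := hAi (hin t ht) (hin t' ht') e
    linarith
  have hBi : InjOn B (Icc 0 b) := fun t ht t' ht' e => by
    have := hσi hσne (hinB t ht) (hinB t' ht') e
    linarith
  have hBD : ∀ u ∈ Icc 0 b, B u ∈ D (m + 1) := fun u hu => hσD _ (hinB u hu)
  refine ⟨concat A' a B, a + b, by positivity, continuousOn_concat ha0.le hb0.le hA'c hBc hAB,
    injOn_concat Ico_subset_Icc_self hA'i hBi hAB ?_, ?_, ?_, ?_⟩
  · rintro t ht hat ⟨u, hu, e⟩
    exact hfree (s₁ - (t - a)) (by linarith [ht.2]) (by linarith) _ (hin u hu) e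
  · rw [concat_of_ge hAB (by linarith), add_sub_cancel_left, hBA, concat_of_le ha0.le]
  · intro t ht
    rcases le_total t a with hta | hta
    · rw [concat_of_le hta]
      have h1 := hin t ⟨ht.1, hta⟩
      rcases htail _ h1 with ⟨i, hi, h2⟩ | h2
      · exact ⟨i, by omega, h2⟩
      · exact ⟨m, by omega, h2 _ ⟨le_rfl, h1.2⟩⟩
    · rw [concat_of_ge hAB hta]
      exact ⟨m + 1, by omega, hBD _ ⟨by linarith, by linarith [ht.2]⟩⟩
  -- The discarded ends of the arc stay in D 0 and D m, so trimming them and closing up in D (m + 1)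
  -- changes the integral only by values that the cocycle relation cancels.
  · obtain ⟨I₁, J, hI₁, hJ, hIJ⟩ := hint.sub_left hT₁.1 hT₁.2
    obtain ⟨I₀, I, hI₀, hI, hII⟩ := hI₁.sub_left hT₀.1 ht₀₁.le
    have g1 := hJ.unique hT₁.2 (hasInt_of_small hψ hT₁.2 (mapsTo_univ _ _) fun u hu v hv =>
        hDm _ (c₁ u hu) _ (c₁ v hv))
    have g0 := hI₀.unique hT₀.1 (hasInt_of_small hψ hT₀.1 (mapsTo_univ _ _) fun u hu v hv =>
        hD0 _ (c₀ u hu) _ (c₀ v hv))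
    have hI' : HasInt ψ A' 0 a I := by
      have := hI.congr (B := A') (-t₀) fun t _ => by simp only [hA', neg_add_cancel_right]
      rwa [← sub_eq_add_neg, ← sub_eq_add_neg, sub_self] at this
    have g2 := hasInt_of_small hψ hb0.le (mapsTo_univ B _) fun u hu v hv =>
        hDm1 _ (hBD u hu) _ (hBD v hv)
    have g3 := hasInt_concat hε hψ ha0.le hb0.le hA'c hBc hAB hI' g2
    have hB0 : B 0 = A t₁ := by simp only [hB, sub_zero, e₁]
    have hBb : B b = A t₀ := by rw [hBA]; simp only [hA', zero_add]
    rw [hB0, hBb] at g3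
    rw [hA0] at g0
    rw [hAT] at g1
    have q0 : A t₀ ∈ D (m + 1) := hsub _ ht₀.1
    have q1 : A t₁ ∈ D (m + 1) := hsub _ ht₁.1
    have u1 := hψ.triangle (mem_univ _) (mem_univ _) (mem_univ _) (hDm1 _ hx1 _ q1)
        (hDm1 _ q1 _ hx0) (hDm1 _ hx1 _ hx0)
    have u2 := hψ.triangle (mem_univ _) (mem_univ _) (mem_univ _) (hDm1 _ q1 _ q0)
        (hDm1 _ q0 _ hx0) (hDm1 _ q1 _ hx0)
    have u3 := hψ.symm (mem_univ _) (mem_univ _) (hDm1 _ hx1 _ q1)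
    have u4 := hψ.symm (mem_univ _) (mem_univ _) (hDm1 _ hx0 _ q0)
    have u5 := h.pot m (by omega)
    have u6 := h.pot (m + 1) (by omega)
    have u7 := h.odd
    have u8 := h.closed
    rw [show m + 1 + 1 = m + 2 by omega, u8] at u6
    have : I + ψ (A t₁) (A t₀) = 1 := by grind
    rwa [this] at g3

end Arcs

/-! ### Odd integral implies essential -/

section Essential

variable {X : Type*} [PseudoMetricSpace X]

/-- A closed path with odd integral for some cocycle is essential. -/
theorem not_nullhomotopic_of_hasInt {ψ : X → X → ZMod 2} {ε L : ℝ} (hε : 0 < ε)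
    (hψ : IsCocycleOn ψ univ ε) (hL : 0 < L) {C : ℝ → X} (hC : HasInt ψ C 0 L 1) {γ : C(Circle, X)}
    (hγ : ∀ s ∈ Icc 0 L, γ (AddCircle.homeomorphCircle hL.ne' (s : AddCircle L)) = C s) :
    ¬ γ.Nullhomotopic := by
  rintro ⟨y₀, ⟨H⟩⟩
  set G : ℝ × ℝ → X := fun q =>
    H (projIcc 0 1 zero_le_one q.1, AddCircle.homeomorphCircle hL.ne' (q.2 : AddCircle L)) with hG
  have hGc : Continuous G := by
    refine H.continuous.comp ((continuous_projIcc.comp continuous_fst).prodMk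
      ((AddCircle.homeomorphCircle hL.ne').continuous.comp ?_))
    exact (AddCircle.continuous_mk' L).comp continuous_snd
  have hYc : Convex ℝ (Icc (0 : ℝ) 1 ×ˢ Icc (0 : ℝ) L) := (convex_Icc _ _).prod (convex_Icc _ _)
  have hYk : IsCompact (Icc (0 : ℝ) 1 ×ˢ Icc (0 : ℝ) L) := isCompact_Icc.prod isCompact_Icc
  obtain ⟨δ, hδ, hd⟩ := Metric.uniformContinuousOn_iff.1
    (hYk.uniformContinuousOn_of_continuous hGc.continuousOn) ε hε
  -- Pulled back to the square by the homotopy, the cocycle has a potential. Its difference between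
  -- the two vertical sides does not depend on the time t; it is the integral 1 at t = 0 and 0 at t
  -- = 1, where the loop is constant.
  obtain ⟨b, hb⟩ := exists_potential hYc hYk.isBounded hδ
    (hψ.comp (B := Icc (0 : ℝ) 1 ×ˢ Icc (0 : ℝ) L) G (fun _ _ => mem_univ _) hd)
  have hδ2 : 0 < δ / 2 := half_pos hδ
  have h0L : (0 : ℝ) ∈ Icc 0 L := ⟨le_rfl, hL.le⟩
  have hLL : L ∈ Icc 0 L := ⟨hL.le, le_rfl⟩
  have hend : ∀ t, G (t, 0) = G (t, L) := by
    intro t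
    simp only [hG, AddCircle.coe_period, AddCircle.coe_zero]
  have key : b (0, 0) + b (0, L) = b (1, 0) + b (1, L) := by
    refine eq_of_locally_constant (convex_Icc (0 : ℝ) 1) (isBounded_Icc 0 1)
      (d := fun t => b (t, 0) + b (t, L)) hδ2 (fun t ht t' ht' htt => ?_) (by simp) (by simp)
    have e1 := hb (t, 0) ⟨ht, h0L⟩ (t', 0) ⟨ht', h0L⟩ (by simpa [Prod.dist_eq, hδ] using htt)
    have e2 := hb (t, L) ⟨ht, hLL⟩ (t', L) ⟨ht', hLL⟩ (by simpa [Prod.dist_eq, hδ] using htt)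
    simp only [hend] at e1
    simp only [e1] at e2
    grind
  have k0 : b (0, 0) + b (0, L) = 1 := by
    refine HasInt.unique hL.le ⟨fun s => b (0, s), ⟨δ / 2, hδ2, fun s hs s' hs' hss => ?_⟩, rfl⟩ hC
    have e := hb (0, s) ⟨by simp, hs⟩ (0, s') ⟨by simp, hs'⟩ (by simpa [Prod.dist_eq, hδ] using hss)
    rw [← e, ← hγ s hs, ← hγ s' hs']
    simp [hG]
  have k1 : b (1, 0) = b (1, L) := by
    refine eq_of_locally_constant (convex_Icc (0 : ℝ) L) (isBounded_Icc 0 L)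
      (d := fun s => b (1, s)) hδ2 (fun s hs s' hs' hss => ?_) h0L hLL
    have e := hb (1, s) ⟨by simp, hs⟩ (1, s') ⟨by simp, hs'⟩ (by simpa [Prod.dist_eq, hδ] using hss)
    have e' : ψ (G (1, s)) (G (1, s')) = 0 := by
      simp [hG, hψ.diag hε (mem_univ y₀)]
    rw [e'] at e
    exact zmod_two_eq_of_add_eq_zero e.symm
  rw [k0, k1, zmod_two_add_self] at key
  exact one_ne_zero key

/-- An injective closed path with odd integral is an essential simple closed curve. -/
theorem isEssentialCurve_of_hasInt {ψ : X → X → ZMod 2} {ε L : ℝ} (hε : 0 < ε)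
    (hψ : IsCocycleOn ψ univ ε) (hL : 0 < L) {C : ℝ → X} (hC : HasInt ψ C 0 L 1)
    (hCc : ContinuousOn C (Icc 0 L)) (hCi : InjOn C (Ico 0 L)) (hC0 : C L = C 0) :
    IsEssentialCurve (C '' Icc 0 L) := by
  have : Fact (0 < L) := ⟨hL⟩
  have hlc : Continuous (AddCircle.liftIco L 0 C) :=
    AddCircle.liftIco_continuous (by rw [zero_add, hC0]) (by rwa [zero_add])
  have hl : ∀ s ∈ Icc 0 L, AddCircle.liftIco L 0 C (s : AddCircle L) = C s := by
    intro s hs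
    rcases hs.2.eq_or_lt with rfl | h
    · rw [AddCircle.coe_period, ← AddCircle.coe_zero,
        AddCircle.liftIco_coe_apply (by simpa using hL), hC0]
    · exact AddCircle.liftIco_coe_apply (by simpa using ⟨hs.1, h⟩)
  set e := AddCircle.homeomorphCircle hL.ne' with he
  have hsurj : ∀ z : Circle, ∃ s ∈ Ico 0 L, e (s : AddCircle L) = z := by
    intro z
    obtain ⟨s, hs, h⟩ := (AddCircle.coe_image_Ico_eq L 0).ge (mem_univ (e.symm z))
    rw [zero_add] at hs
    exact ⟨s, hs, by rw [h, e.apply_symm_apply]⟩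
  set γ : C(Circle, X) := ⟨fun z => AddCircle.liftIco L 0 C (e.symm z), hlc.comp e.symm.continuous⟩
  have hγ : ∀ s ∈ Icc 0 L, γ (e (s : AddCircle L)) = C s := by
    intro s hs
    simp only [γ, ContinuousMap.coe_mk, e.symm_apply_apply, hl s hs]
  refine ⟨γ, fun z z' h => ?_, ?_, not_nullhomotopic_of_hasInt hε hψ hL hC hγ⟩
  · obtain ⟨s, hs, rfl⟩ := hsurj z
    obtain ⟨s', hs', rfl⟩ := hsurj z'
    rw [hγ s ⟨hs.1, hs.2.le⟩, hγ s' ⟨hs'.1, hs'.2.le⟩] at h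
    rw [hCi hs hs' h]
  · ext x
    constructor
    · rintro ⟨z, rfl⟩
      obtain ⟨s, hs, rfl⟩ := hsurj z
      exact ⟨s, ⟨hs.1, hs.2.le⟩, (hγ s ⟨hs.1, hs.2.le⟩).symm⟩
    · rintro ⟨s, hs, rfl⟩
      exact ⟨_, hγ s hs⟩

end Essential

/-! ### Essential curves from a nontrivial cocycle -/

section Trichotomy

variable {X : Type*} [MetricSpace X] [CompactSpace X]

/-- If the cocycle `ψ` is a coboundary near no closed set `K` inside the open set `V`, then `V`
contains an essential simple closed curve. -/
theorem exists_essentialCurve {F : X → ℂ → X} (hF : ∀ x, IsOpenEmbedding (F x))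
    (hF0 : ∀ x, F x 0 = x) {ψ : X → X → ZMod 2} (hψs : SymNorm ψ) {ε : ℝ} (hε : 0 < ε)
    (hψ : IsCocycleOn ψ univ ε) {V K : Set X} (hV : IsOpen V) (hK : IsClosed K) (hKV : K ⊆ V)
    (hKψ : ∀ δ > 0, ∀ b : X → ZMod 2, ∃ x ∈ K, ∃ y ∈ K, dist x y < δ ∧ ψ x y ≠ b x + b y) :
    ∃ A ⊆ V, IsEssentialCurve A := by
  set 𝒟 : Set (Set X) := {D | (∃ x r, D = F x '' ball 0 r) ∧ D ⊆ V ∧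
    ∀ y ∈ D, ∀ z ∈ D, dist y z < ε} with h𝒟
  have hex : ∃ n x D p, OddChain 𝒟 ψ n x D p := by
    refine exists_oddChain hψs ?_
    rintro ⟨b, hb⟩
    have hcov : ∀ x ∈ K, ∃ D ∈ 𝒟, IsOpen D ∧ x ∈ D := by
      intro x hx
      have ho : IsOpen (V ∩ ball x (ε / 2)) := hV.inter isOpen_ball
      obtain ⟨r, hr, hr'⟩ := Metric.isOpen_iff.1 (ho.preimage (hF x).continuous) 0
        (by simp only [mem_preimage, hF0]; exact ⟨hKV hx, mem_ball_self (half_pos hε)⟩)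
      refine ⟨F x '' ball 0 r, ⟨⟨x, r, rfl⟩, fun y hy => ?_, fun y hy z hz => ?_⟩,
        (hF x).isOpenMap _ isOpen_ball, ⟨0, mem_ball_self hr, hF0 x⟩⟩
      · exact (image_subset_iff.2 hr' hy).1
      · have h1 := mem_ball.1 (image_subset_iff.2 hr' hy).2
        have h2 := mem_ball.1 (image_subset_iff.2 hr' hz).2
        linarith [dist_triangle_right y z x]
    -- By a Lebesgue number, a potential on every small chart disc in V would be a potential of ψ on
    -- K at a positive scale.
    obtain ⟨δ, hδ, hL⟩ := lebesgue_number_lemma_of_metric_sUnion (s := K)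
      (c := {D | D ∈ 𝒟 ∧ IsOpen D}) hK.isCompact (fun D hD => hD.2) (fun x hx => by
        obtain ⟨D, h1, h2, h3⟩ := hcov x hx
        exact ⟨D, ⟨h1, h2⟩, h3⟩)
    obtain ⟨x, hx, y, -, hxy, hne⟩ := hKψ δ hδ b
    obtain ⟨D, hD, hsub⟩ := hL x hx
    exact hne (hb D hD.1 x (hsub (mem_ball_self hδ)) y (hsub (by rwa [mem_ball, dist_comm])))
  classical
  obtain ⟨x, D, p, h⟩ := Nat.find_spec hex
  have hmin : ∀ m < Nat.find hex, ∀ x D p, ¬ OddChain 𝒟 ψ m x D p :=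
    fun m hm x D p h => Nat.find_min hex hm ⟨x, D, p, h⟩
  have hdist : ∀ D ∈ 𝒟, ∀ x ∈ D, ∀ y ∈ D, dist x y < ε := fun D hD => hD.2.2
  obtain ⟨C, L, hL, hCc, hCi, hC0, hCD, hCI⟩ := exists_loop hε hψ hdist
    (by rintro D ⟨⟨x, r, rfl⟩, -⟩; exact arcConn_image (hF x) (convex_ball _ _))
    (by rintro D ⟨⟨x, r, rfl⟩, -⟩; exact (hF x).isOpenMap _ isOpen_ball)
    h (h.four_le hψs hψ hdist) (fun i j hij hj hji => h.disjoint hψ hdist hmin hij hj hji)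
  refine ⟨C '' Icc 0 L, ?_, isEssentialCurve_of_hasInt hε hψ hL hCI hCc hCi hC0⟩
  rintro _ ⟨t, ht, rfl⟩
  obtain ⟨k, hk, hk'⟩ := hCD t ht
  exact (h.mem k hk).2.1 hk'

end Trichotomy

/-! ### Charts and polar coordinates of a collar -/

section CollarChart

open Real

lemma arctan_half_mem (x : ℝ) : arctan x / 2 ∈ Ioo (-1 : ℝ) 1 := by
  have h1 := arctan_lt_pi_div_two x
  have h2 := neg_pi_div_two_lt_arctan x
  have h3 := pi_lt_four
  constructor <;> linarith

lemma isOpenMap_arctan_half : IsOpenMap fun x : ℝ => arctan x / 2 := by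
  refine isOpenMap_of_hasStrictDerivAt (f' := fun x => 1 / (1 + x ^ 2) / 2)
    (fun x => (hasStrictDerivAt_arctan x).div_const 2) fun x => ?_
  positivity

/-- The open strip of the annulus around the right half of the core. -/
noncomputable def stripMap (z : ℂ) : Circle × Icc (-1 : ℝ) 1 :=
  (Circle.exp (arctan z.im), ⟨arctan z.re / 2, Ioo_subset_Icc_self (arctan_half_mem _)⟩)

lemma continuous_stripMap : Continuous stripMap := by
  unfold stripMap
  fun_prop

lemma circleExp_arctan_injective : Function.Injective fun x => Circle.exp (arctan x) := by
  intro x y h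
  have h1 : (Circle.exp (arctan x) : ℂ) = Circle.exp (arctan y) := congrArg _ h
  rw [Circle.coe_exp, Circle.coe_exp] at h1
  have hx := arctan_mem_Ioo x
  have hy := arctan_mem_Ioo y
  have h2 := congrArg Complex.arg h1
  rw [Complex.arg_exp_mul_I, Complex.arg_exp_mul_I, (toIocMod_eq_self _).2, (toIocMod_eq_self _).2] at h2
  · exact arctan_injective h2
  all_goals constructor <;> linarith [hx.1, hx.2, hy.1, hy.2, pi_pos]

lemma stripMap_injective : Function.Injective stripMap := by
  intro z w h
  have h1 := congrArg Prod.fst h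
  have h2 : arctan z.re / 2 = arctan w.re / 2 := congrArg (fun q => (q.2 : ℝ)) h
  exact Complex.ext (arctan_injective (by linarith)) (circleExp_arctan_injective h1)

lemma isOpenMap_stripMap : IsOpenMap stripMap := by
  have ha : IsOpenMap fun x => Circle.exp (arctan x) := by
    refine isLocalHomeomorph_circleExp.isOpenMap.comp (f := arctan) ?_
    exact isOpenMap_of_hasStrictDerivAt (f' := fun x => 1 / (1 + x ^ 2))
      (fun x => hasStrictDerivAt_arctan x) fun x => by positivity
  have hb : IsOpenMap fun x : ℝ =>
      (⟨arctan x / 2, Ioo_subset_Icc_self (arctan_half_mem _)⟩ : Icc (-1 : ℝ) 1) := by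
    intro U hU
    convert (isOpenMap_arctan_half U hU).preimage (continuous_subtype_val (p := (· ∈ Icc (-1 : ℝ) 1))) using 1
    ext s
    simp [Subtype.ext_iff]
  have h := (ha.prodMap hb).comp
    (Complex.equivRealProdCLM.toHomeomorph.trans (Homeomorph.prodComm ℝ ℝ)).isOpenMap
  exact h

variable {S : Type*} [TopologicalSpace S] [T2Space S] {c : Set S} (κ : Collar c)

lemma Collar.isClosedEmbedding : IsClosedEmbedding κ.toMap :=
  κ.toMap.continuous.isClosedEmbedding κ.injective

/-- Openness of the interior of the collar is given; from it one removes the image of the complement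
of W, which is closed because the collar map is a closed embedding. -/
lemma Collar.isOpen_image {W : Set (Circle × Icc (-1 : ℝ) 1)} (hW : IsOpen W)
    (hW' : ∀ p ∈ W, (p.2 : ℝ) ∈ Ioo (-1 : ℝ) 1) : IsOpen (κ.toMap '' W) := by
  have h : κ.toMap '' W = (κ.toMap '' {p | (p.2 : ℝ) ∈ Ioo (-1 : ℝ) 1}) \ (κ.toMap '' Wᶜ) := by
    rw [← image_sdiff κ.injective]
    congr 1
    ext p
    simp only [Set.mem_sdiff, mem_compl_iff, not_not]
    exact ⟨fun hp => ⟨hW' p hp, hp⟩, fun hp => hp.2⟩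
  rw [h]
  exact κ.isOpen_interior.sdiff (κ.isClosedEmbedding.isClosedMap _ hW.isClosed_compl)

/-- The chart of the surface given by a strip of a collar. -/
noncomputable def Collar.chart (z : ℂ) : S := κ.toMap (stripMap z)

lemma Collar.isOpenEmbedding_chart : IsOpenEmbedding κ.chart := by
  refine .of_continuous_injective_isOpenMap (κ.toMap.continuous.comp continuous_stripMap)
    (κ.injective.comp stripMap_injective) fun U hU => ?_
  have h : κ.chart '' U = κ.toMap '' (stripMap '' U) := by rw [image_image]; rfl
  rw [h]
  refine κ.isOpen_image (isOpenMap_stripMap U hU) ?_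
  rintro _ ⟨z, -, rfl⟩
  exact arctan_half_mem _

lemma Collar.height_toMap (p : Circle × Icc (-1 : ℝ) 1) :
    κ.height (κ.toMap p) = (((p.2 : ℝ) / 2 : ℝ) : UnitAddCircle) :=
  κ.injective.extend_apply _ _ _

lemma Collar.height_of_notMem {x : S} (hx : x ∉ range κ.toMap) :
    κ.height x = ((1 / 2 : ℝ) : UnitAddCircle) :=
  Function.extend_apply' _ _ _ hx

lemma coe_neg_half : ((-1 / 2 : ℝ) : UnitAddCircle) = ((1 / 2 : ℝ) : UnitAddCircle) := by
  rw [show (1 / 2 : ℝ) = -1 / 2 + 1 by norm_num, AddCircle.coe_add, AddCircle.coe_period, add_zero]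

/-- On the boundary circles s = ±1 the height is ±1 / 2, the same point of ℝ/ℤ as outside the
collar. This agreement makes the height continuous. -/
lemma Collar.height_of_notMem_interior {x : S}
    (hx : x ∉ κ.toMap '' {p | (p.2 : ℝ) ∈ Ioo (-1 : ℝ) 1}) :
    κ.height x = ((1 / 2 : ℝ) : UnitAddCircle) := by
  by_cases h : x ∈ range κ.toMap
  · obtain ⟨p, rfl⟩ := h
    have hp : ¬ (p.2 : ℝ) ∈ Ioo (-1 : ℝ) 1 := fun h => hx ⟨p, h, rfl⟩
    have h1 := p.2.2
    rw [κ.height_toMap]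
    rcases h1.1.eq_or_lt with h2 | h2
    · rw [← h2, coe_neg_half]
    · rcases h1.2.eq_or_lt with h3 | h3
      · rw [h3]
      · exact absurd ⟨h2, h3⟩ hp
  · exact κ.height_of_notMem h

lemma Collar.continuous_height : Continuous κ.height := by
  refine continuous_iff_isClosed.2 fun K hK => ?_
  have h : κ.height ⁻¹' K = κ.toMap '' {p | (((p.2 : ℝ) / 2 : ℝ) : UnitAddCircle) ∈ K} ∪
      ((κ.toMap '' {p | (p.2 : ℝ) ∈ Ioo (-1 : ℝ) 1})ᶜ ∩
        {_x | ((1 / 2 : ℝ) : UnitAddCircle) ∈ K}) := by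
    ext x
    constructor
    · intro hx
      by_cases h : x ∈ κ.toMap '' {p | (p.2 : ℝ) ∈ Ioo (-1 : ℝ) 1}
      · obtain ⟨p, -, rfl⟩ := h
        rw [mem_preimage, κ.height_toMap] at hx
        exact Or.inl ⟨p, hx, rfl⟩
      · rw [mem_preimage, κ.height_of_notMem_interior h] at hx
        exact Or.inr ⟨h, hx⟩
    · rintro (⟨p, hp, rfl⟩ | ⟨h, hx⟩)
      · rw [mem_preimage, κ.height_toMap]; exact hp
      · rw [mem_preimage, κ.height_of_notMem_interior h]; exact hx
  rw [h]
  refine (κ.isClosedEmbedding.isClosedMap _ ?_).union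
    (κ.isOpen_interior.isClosed_compl.inter isClosed_const)
  exact hK.preimage ((AddCircle.continuous_mk' 1).comp (by fun_prop))

lemma norm_coe_half {s : ℝ} (hs : s ∈ Icc (-1 : ℝ) 1) :
    ‖((s / 2 : ℝ) : UnitAddCircle)‖ = |s| / 2 := by
  rw [show |s| / 2 = |s / 2| by rw [abs_div, abs_two]]
  rw [AddCircle.norm_coe_eq_abs_iff 1 one_ne_zero, abs_div, abs_two, abs_one]
  have := abs_le.2 hs
  linarith

lemma Collar.toMap_mem_iff {p : Circle × Icc (-1 : ℝ) 1} : κ.toMap p ∈ c ↔ (p.2 : ℝ) = 0 := by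
  have h : κ.toMap p ∈ κ.toMap '' {p | (p.2 : ℝ) = 0} ↔ (p.2 : ℝ) = 0 :=
    κ.injective.mem_set_image
  rwa [κ.core] at h

/-- The curve is the zero set of the height. -/
lemma Collar.height_eq_zero_iff {x : S} : κ.height x = 0 ↔ x ∈ c := by
  by_cases h : x ∈ range κ.toMap
  · obtain ⟨p, rfl⟩ := h
    rw [κ.height_toMap, ← norm_eq_zero, norm_coe_half p.2.2, κ.toMap_mem_iff]
    simp
  · rw [κ.height_of_notMem h, ← norm_eq_zero, show (1 / 2 : ℝ) = (1 : ℝ) / 2 from rfl,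
      norm_coe_half (by simp)]
    simp only [abs_one, one_div, inv_eq_zero, OfNat.ofNat_ne_zero, false_iff]
    intro hx
    obtain ⟨p, -, hp⟩ := κ.core.ge hx
    exact h ⟨p, hp⟩

lemma Collar.isClosed (μ : Collar c) : IsClosed c := by
  rw [← μ.core]
  exact μ.isClosedEmbedding.isClosedMap _ (isClosed_eq (by fun_prop) continuous_const)

/-- The annulus of the collar in polar coordinates of the plane. -/
noncomputable def Collar.polar (ζ : ℂ) : S :=
  κ.toMap (Circle.exp (Complex.arg ζ), projIcc (-1) 1 (by norm_num) (‖ζ‖ - 1))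

lemma coe_exp_arg {ζ : ℂ} (hζ : ζ ≠ 0) : (Circle.exp (Complex.arg ζ) : ℂ) = ζ / ‖ζ‖ := by
  rw [Circle.coe_exp, eq_div_iff (by simpa using hζ), mul_comm]
  exact Complex.norm_mul_exp_arg_mul_I ζ

lemma mem_annulus_unit {ζ : ℂ} : ζ ∈ annulus 0 (1 / 2) (3 / 2) ↔ ‖ζ‖ - 1 ∈ Icc (-(1 / 2) : ℝ) (1 / 2) := by
  simp only [annulus, mem_ofPred_eq, dist_zero_right, mem_Icc]
  constructor <;> rintro ⟨h1, h2⟩ <;> constructor <;> linarith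

lemma ne_zero_of_mem_annulus {ζ : ℂ} (hζ : ζ ∈ annulus 0 (1 / 2) (3 / 2)) : ζ ≠ 0 := by
  rintro rfl
  have := (mem_annulus_unit.1 hζ).1
  rw [norm_zero] at this
  norm_num at this

lemma Collar.continuousOn_polar : ContinuousOn κ.polar (annulus 0 (1 / 2) (3 / 2)) := by
  refine κ.toMap.continuous.comp_continuousOn (ContinuousOn.prodMk ?_
    (continuous_projIcc.comp (by fun_prop)).continuousOn)
  refine IsInducing.subtypeVal.continuousOn_iff.2 ?_
  have h : ContinuousOn (fun ζ : ℂ => ζ / ‖ζ‖) (annulus 0 (1 / 2) (3 / 2)) :=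
    continuousOn_id.div (by fun_prop) fun ζ hζ => by simpa using ne_zero_of_mem_annulus hζ
  exact h.congr fun ζ hζ => coe_exp_arg (ne_zero_of_mem_annulus hζ)

lemma Collar.polar_eq {ζ : ℂ} (hζ : ζ ∈ annulus 0 (1 / 2) (3 / 2)) :
    κ.polar ζ = κ.toMap (Circle.exp (Complex.arg ζ), ⟨‖ζ‖ - 1, by
      have := mem_annulus_unit.1 hζ
      constructor <;> linarith [this.1, this.2]⟩) := by
  have := mem_annulus_unit.1 hζ
  rw [Collar.polar, projIcc_of_mem]
  constructor <;> linarith [this.1, this.2]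

lemma Collar.injOn_polar : InjOn κ.polar (annulus 0 (1 / 2) (3 / 2)) := by
  intro ζ hζ ξ hξ h
  rw [κ.polar_eq hζ, κ.polar_eq hξ] at h
  have h' := κ.injective h
  have h1 : (Circle.exp (Complex.arg ζ) : ℂ) = Circle.exp (Complex.arg ξ) :=
    congrArg (fun q => (q.1 : ℂ)) h'
  have h2 : ‖ζ‖ - 1 = ‖ξ‖ - 1 := congrArg (fun q => (q.2 : ℝ)) h'
  have h3 : ‖ζ‖ = ‖ξ‖ := by linarith
  rw [coe_exp_arg (ne_zero_of_mem_annulus hζ), coe_exp_arg (ne_zero_of_mem_annulus hξ), h3] at h1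
  have h4 : (‖ξ‖ : ℂ) ≠ 0 := by simpa using ne_zero_of_mem_annulus hξ
  exact (div_left_inj' h4).1 h1

lemma Collar.exists_polar {p : Circle × Icc (-1 : ℝ) 1} (hp : |(p.2 : ℝ)| ≤ 1 / 2) :
    ((1 + (p.2 : ℝ) : ℝ) * (p.1 : ℂ)) ∈ annulus 0 (1 / 2) (3 / 2) ∧
      ‖((1 + (p.2 : ℝ) : ℝ) * (p.1 : ℂ))‖ - 1 = p.2 ∧
      κ.polar ((1 + (p.2 : ℝ) : ℝ) * (p.1 : ℂ)) = κ.toMap p := by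
  have hp' := abs_le.1 hp
  have hpos : 0 < 1 + (p.2 : ℝ) := by linarith
  have hn : ‖((1 + (p.2 : ℝ) : ℝ) * (p.1 : ℂ))‖ = 1 + p.2 := by
    rw [norm_mul, Circle.norm_coe, mul_one, Complex.norm_real, norm_of_nonneg hpos.le]
  have hm : ((1 + (p.2 : ℝ) : ℝ) * (p.1 : ℂ)) ∈ annulus 0 (1 / 2) (3 / 2) := by
    rw [mem_annulus_unit, hn, add_sub_cancel_left]
    exact hp'
  refine ⟨hm, by rw [hn, add_sub_cancel_left], ?_⟩
  rw [κ.polar_eq hm]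
  congr 1
  refine Prod.ext ?_ (Subtype.ext ?_)
  · refine Circle.ext ?_
    simp only
    rw [coe_exp_arg (ne_zero_of_mem_annulus hm), hn, mul_div_cancel_left₀]
    exact_mod_cast hpos.ne'
  · simp only [hn, add_sub_cancel_left]

lemma abs_arctan_le (x : ℝ) : |arctan x| ≤ |x| := by
  have key : ∀ y : ℝ, 0 ≤ y → arctan y ≤ y := by
    intro y hy
    have h := le_tan (arctan_nonneg.2 hy) (arctan_lt_pi_div_two y)
    rwa [tan_arctan] at h
  rcases le_total 0 x with hx | hx
  · rw [abs_of_nonneg hx, abs_of_nonneg (arctan_nonneg.2 hx)]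
    exact key x hx
  · have h1 := key (-x) (by linarith)
    rw [arctan_neg] at h1
    rw [abs_of_nonpos hx, abs_of_nonpos]
    · exact h1
    · have := arctan_nonneg.2 (show 0 ≤ -x by linarith)
      rw [arctan_neg] at this
      linarith

lemma Collar.exists_polar_of_height {x : S} (hx : ‖κ.height x‖ < 1 / 4) :
    ∃ ζ ∈ annulus 0 (1 / 2) (3 / 2), κ.polar ζ = x ∧ |dist ζ 0 - 1| ≤ 2 * ‖κ.height x‖ := by
  by_cases h : x ∈ range κ.toMap
  · obtain ⟨p, rfl⟩ := h
    rw [κ.height_toMap, norm_coe_half p.2.2] at hx ⊢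
    obtain ⟨h1, h2, h3⟩ := κ.exists_polar (p := p) (by linarith)
    refine ⟨_, h1, h3, ?_⟩
    rw [dist_zero_right, h2]
    linarith
  · rw [κ.height_of_notMem h, norm_coe_half (by simp)] at hx
    norm_num at hx

lemma Collar.exists_polar_chart {z : ℂ} (hz : z ∈ ball (0 : ℂ) (1 / 2)) :
    ∃ ζ ∈ annulus 0 (1 / 2) (3 / 2), κ.polar ζ = κ.chart z ∧ 0 ≤ ζ.re ∧ (0 ≤ ζ.im ↔ 0 ≤ z.im) := by
  have h0 : |arctan z.re / 2| ≤ 1 / 2 := by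
    rw [mem_ball_zero_iff] at hz
    have h1 := abs_arctan_le z.re
    have h2 := Complex.abs_re_le_norm z
    rw [abs_div, abs_two]
    linarith
  obtain ⟨h1, h2, h3⟩ := κ.exists_polar (p := stripMap z) h0
  have hpos : 0 < 1 + ((stripMap z).2 : ℝ) := by
    have := (abs_le.1 h0).1
    have h : ((stripMap z).2 : ℝ) = arctan z.re / 2 := rfl
    linarith
  have hre : ((stripMap z).1 : ℂ).re = cos (arctan z.im) := Complex.exp_ofReal_mul_I_re _
  have him : ((stripMap z).1 : ℂ).im = sin (arctan z.im) := Complex.exp_ofReal_mul_I_im _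
  refine ⟨_, h1, h3, ?_, ?_⟩
  · rw [Complex.re_ofReal_mul, hre]
    exact mul_nonneg hpos.le (cos_arctan_pos _).le
  · rw [Complex.im_ofReal_mul, him, mul_nonneg_iff_of_pos_left hpos]
    have := arctan_mem_Ioo z.im
    constructor
    · intro h
      by_contra! hneg
      have h4 : arctan z.im < 0 := arctan_lt_zero.2 hneg
      linarith [sin_neg_of_neg_of_neg_pi_lt h4 (by linarith [this.1, pi_pos])]
    · intro h
      exact sin_nonneg_of_nonneg_of_le_pi (arctan_nonneg.2 h) (by linarith [this.2, pi_pos])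

end CollarChart

/-! ### Essential curves near zero sets in the dual class -/

section Surface

variable {S : Type*} [TopologicalSpace S]

/-- Every point of a surface is the centre of a chart defined on the whole plane. -/
lemma exists_chart [ChartedSpace (EuclideanSpace ℝ (Fin 2)) S] (x : S) :
    ∃ f : ℂ → S, IsOpenEmbedding f ∧ f 0 = x := by
  set φ := chartAt (EuclideanSpace ℝ (Fin 2)) x with hφ
  have hx : x ∈ φ.source := mem_chart_source _ x
  obtain ⟨r, hr, hr'⟩ := Metric.isOpen_iff.1 φ.open_target (φ x) (φ.map_source hx)
  set e : OpenPartialHomeomorph (EuclideanSpace ℝ (Fin 2)) S :=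
    (OpenPartialHomeomorph.univBall (φ x) r).trans φ.symm with he
  have hes : e.source = univ := by
    rw [he, OpenPartialHomeomorph.trans_source, OpenPartialHomeomorph.univBall_source, univ_inter,
      eq_univ_iff_forall]
    intro y
    refine hr' ?_
    rw [← OpenPartialHomeomorph.univBall_target (φ x) hr]
    exact (OpenPartialHomeomorph.univBall (φ x) r).map_source (by simp)
  refine ⟨e ∘ Complex.orthonormalBasisOneI.repr,
    (e.isOpenEmbedding hes).comp Complex.orthonormalBasisOneI.repr.toHomeomorph.isOpenEmbedding, ?_⟩
  simp only [Function.comp_apply, map_zero, he, OpenPartialHomeomorph.coe_trans,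
    OpenPartialHomeomorph.univBall_apply_zero]
  exact φ.left_inv hx

open Real in
/-- The zero set of a function that represents the class dual to the nonseparating curve `c` is
a limit of essential simple closed curves. -/
theorem exists_essentialCurve_near [T2Space S] [CompactSpace S]
    [ChartedSpace (EuclideanSpace ℝ (Fin 2)) S] {c : Set S} (hc : IsConnected cᶜ) (κ : Collar c)
    {w : S → ℝ} (hw : Continuous w) {η : ℝ} (hη : 0 < η) :
    ∃ A : Set S, IsEssentialCurve A ∧ ∀ x ∈ A, ‖κ.height x + (w x : UnitAddCircle)‖ < η := by
  have := ChartedSpace.secondCountable_of_sigmaCompact (EuclideanSpace ℝ (Fin 2)) S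
  have := ChartedSpace.locallyPathConnectedSpace (EuclideanSpace ℝ (Fin 2)) S
  letI : MetricSpace S := TopologicalSpace.metrizableSpaceMetric S
  choose f hf hf0 using exists_chart (S := S)
  obtain ⟨t, ht⟩ := isCompact_univ.elim_finite_subcover (fun x => f x '' ball 0 1)
    (fun x => (hf x).isOpenMap _ isOpen_ball)
    (fun x _ => mem_iUnion.2 ⟨x, 0, mem_ball_self one_pos, hf0 x⟩)
  -- The finite atlas receives one more chart, that of the collar, indexed by `none`.
  set F : Option t → ℂ → S := fun i => i.elim κ.chart fun x => f x with hF
  have hFo : ∀ i, IsOpenEmbedding (F i) := by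
    rintro (_ | x)
    · exact κ.isOpenEmbedding_chart
    · exact hf x
  have hcov : ⋃ i, F i '' closedBall 0 1 = univ := by
    refine eq_univ_of_forall fun y => ?_
    obtain ⟨x, hx⟩ := mem_iUnion.1 (ht (mem_univ y))
    obtain ⟨hxt, hxy⟩ := mem_iUnion.1 hx
    exact mem_iUnion.2 ⟨some ⟨x, hxt⟩, image_mono ball_subset_closedBall hxy⟩
  set γ : ℝ → S := fun s => κ.toMap (Circle.exp s, ⟨0, by norm_num⟩) with hγ
  have hγc : Continuous γ := by
    refine κ.toMap.continuous.comp ?_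
    fun_prop
  have hcore : ∀ z : ℂ, z.re ≠ 0 → κ.chart z ∈ cᶜ := by
    intro z hz
    rw [mem_compl_iff, Collar.chart, κ.toMap_mem_iff]
    change ¬ arctan z.re / 2 = 0
    rw [div_eq_zero_iff, arctan_eq_zero_iff]
    simpa using hz
  -- The complement of c is open and connected in a surface, hence path connected; the points ±1 of
  -- the collar chart are on the two sides of c.
  have hjoin : JoinedIn cᶜ (F none (-1)) (F none 1) :=
    (κ.isClosed.isOpen_compl.isConnected_iff_isPathConnected.1 hc).joinedIn _
      (hcore _ (by simp)) _ (hcore _ (by simp))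
  obtain ⟨ε, hε, ψ, hψs, hψ, hψ1⟩ := exists_dual_cocycle hFo hcov none κ.isClosed hjoin hγc
    (fun s => κ.toMap_mem_iff.2 rfl)
    (fun s hs => by
      change _ = κ.toMap (stripMap _)
      simp only [hγ, stripMap]
      congr 2
      · rw [Complex.im_ofReal_mul, Complex.I_im, mul_one, arctan_tan hs.1 hs.2]
      · simp)
    (fun s hs hs' => by
      rintro ⟨z, hz⟩
      have h1 : stripMap z = _ := κ.injective hz
      have h2 : (Circle.exp (arctan z.im) : ℂ).re = (Circle.exp s : ℂ).re :=
        congrArg (fun q => (q.1 : ℂ).re) h1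
      rw [Circle.coe_exp, Circle.coe_exp, Complex.exp_ofReal_mul_I_re,
        Complex.exp_ofReal_mul_I_re] at h2
      have h3 := cos_arctan_pos z.im
      rw [h2, ← cos_abs] at h3
      have h4 := abs_le.2 hs
      have h5 : π / 2 ≤ |s| := by
        by_contra! h
        exact hs' (abs_lt.1 h)
      linarith [cos_nonpos_of_pi_div_two_le_of_le h5 (by linarith [pi_pos])])
  have hper : ∀ s, γ (s + 2 * π) = γ s := by
    intro s
    simp only [hγ, Circle.exp_add, Circle.exp_two_pi, mul_one]
  -- The integral over [−π, π] is moved to [0, 2π] by translating the first half by one period.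
  have hint : HasInt ψ (fun s => κ.polar (circleMap 0 1 s)) 0 (2 * π) 1 := by
    have hpol : (fun s => κ.polar (circleMap 0 1 s)) = γ := by
      funext s
      have h := (κ.exists_polar (p := (Circle.exp s, ⟨0, by norm_num⟩)) (by simp)).2.2
      simpa [circleMap] using h
    rw [hpol]
    have hpi := pi_pos
    obtain ⟨v₁, v₂, h1, h2, h12⟩ := hψ1.sub_left (s := 0) (by linarith) hpi.le
    have h1' := h1.congr (B := γ) (2 * π) fun s _ => hper s
    rw [show -π + 2 * π = π by ring, zero_add] at h1'
    obtain ⟨u, hu⟩ := exists_hasInt hε hψ (s := 0) (t := 2 * π) hγc.continuousOn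
      (fun _ _ => mem_univ _)
    have := hu.split hpi.le (by linarith) h2 h1'
    rwa [this, add_comm, ← h12] at hu
  have hcont : Continuous fun x => ‖κ.height x + (w x : UnitAddCircle)‖ :=
    (κ.continuous_height.add ((AddCircle.continuous_mk' 1).comp hw)).norm
  -- `K` is the closed neighbourhood of half the width, so a potential on `K` is one near the zero
  -- set, which the cup product argument excludes.
  obtain ⟨A, hAV, hA⟩ := exists_essentialCurve hf hf0 hψs hε hψ
    (V := {x | ‖κ.height x + (w x : UnitAddCircle)‖ < η})
    (K := {x | ‖κ.height x + (w x : UnitAddCircle)‖ ≤ η / 2})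
    (isOpen_lt hcont continuous_const) (isClosed_le hcont continuous_const)
    (fun x hx => lt_of_le_of_lt hx (half_lt_self hη)) (fun δ hδ b => by
      by_contra! hb
      exact dual_not_coboundary hFo (hasFundamental_univ hFo hcov) none κ.continuous_height
        (fun z => by
          change κ.height (κ.toMap (stripMap z)) = _
          rw [κ.height_toMap]
          congr 1
          change arctan z.re / 2 / 2 = _
          ring)
        κ.continuousOn_polar κ.injOn_polar (by
          have h := (κ.exists_polar (p := (Circle.exp 0, ⟨0, by norm_num⟩)) (by simp)).2.2
          change _ = κ.toMap (stripMap 0)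
          simpa [stripMap] using h)
        (fun x hx => κ.exists_polar_of_height hx) (fun z hz => κ.exists_polar_chart hz)
        hψs hε hψ hint hw (half_pos hη) hδ b
        (fun x y hx hy hxy => hb x hx.le y hy.le hxy))
  exact ⟨A, hA, hAV⟩

end Surface

/-! ### Lifts to the infinite cyclic cover -/

section Lifts

variable {S : Type*} [TopologicalSpace S] [T2Space S] {c : Set S} (κ : Collar c)

/-- The real coordinate on the infinite cyclic cover. -/
def Collar.level (q : κ.Cover) : ℝ := q.1.2

lemma Collar.continuous_level : Continuous κ.level :=
  continuous_snd.comp (continuous_subtype_val (p := fun q : S × ℝ => κ.height q.1 = (q.2 : UnitAddCircle)))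

lemma Collar.continuous_proj : Continuous κ.proj :=
  continuous_fst.comp (continuous_subtype_val (p := fun q : S × ℝ => κ.height q.1 = (q.2 : UnitAddCircle)))

lemma Collar.height_proj (q : κ.Cover) : κ.height (κ.proj q) = (κ.level q : UnitAddCircle) := q.2

lemma Collar.cover_ext {q q' : κ.Cover} (h : κ.proj q = κ.proj q') (h' : κ.level q = κ.level q') :
    q = q' := Subtype.ext (Prod.ext h h')

/-- A curve isotopic to `c` lifts to the infinite cyclic cover defined by `c`. -/
theorem Collar.exists_isLift {A : Set S} (h : IsotopicCurves A c) : ∃ B, κ.IsLift B A := by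
  obtain ⟨H, hi, h0, h1⟩ := h
  have hcov : IsCoveringMap ((↑) : ℝ → UnitAddCircle) := AddCircle.isCoveringMap_coe 1
  -- The isotopy is run backwards from c, where the height is 0 and lifts to the constant 0;
  -- homotopy lifting to ℝ then supplies the level on A.
  set G : C(unitInterval × Circle, UnitAddCircle) :=
    ⟨fun q => κ.height (H (unitInterval.symm q.1, q.2)), κ.continuous_height.comp
      (H.continuous.comp (by fun_prop))⟩ with hG
  have hG0 : ∀ z, G (0, z) = (((0 : C(Circle, ℝ)) z : ℝ) : UnitAddCircle) := by
    intro z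
    simp only [hG, ContinuousMap.coe_mk, unitInterval.symm_zero, ContinuousMap.zero_apply,
      AddCircle.coe_zero]
    exact κ.height_eq_zero_iff.2 (h1.le ⟨z, rfl⟩)
  set T := hcov.liftHomotopy G 0 hG0 with hT
  have hTl : ∀ z, κ.height (H (0, z)) = (T (1, z) : UnitAddCircle) := by
    intro z
    have := congr_fun (hcov.liftHomotopy_lifts G 0 hG0) (1, z)
    simp only [hG, Function.comp_apply, ContinuousMap.coe_mk, unitInterval.symm_one] at this
    exact this.symm
  set γ : C(Circle, κ.Cover) := ⟨fun z => ⟨(H (0, z), T (1, z)), hTl z⟩, by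
    refine Continuous.subtype_mk ?_ _
    fun_prop⟩ with hγ
  have hγp : ∀ z, κ.proj (γ z) = H (0, z) := fun z => rfl
  have hγi : Function.Injective γ := fun z z' hz => hi 0 (by
    have := congrArg κ.proj hz
    rwa [hγp, hγp] at this)
  refine ⟨range γ, ⟨γ, hγi, rfl⟩, ?_, ?_, ?_⟩
  · rintro _ ⟨z, rfl⟩
    exact h0.le ⟨z, rfl⟩
  · rintro _ ⟨z, rfl⟩ _ ⟨z', rfl⟩ hz
    rw [hγp, hγp] at hz
    rw [hi 0 hz]
  · intro x hx
    obtain ⟨z, rfl⟩ := h0.ge hx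
    exact ⟨γ z, ⟨z, rfl⟩, rfl⟩

/-- The lift of `c` at level `n`. -/
def Collar.coreLift (n : ℤ) : Set κ.Cover := {q | κ.level q = n}

lemma Collar.level_coe_eq_zero {q : κ.Cover} {n : ℤ} (h : κ.level q = n) : κ.proj q ∈ c := by
  rw [← κ.height_eq_zero_iff, κ.height_proj, h]
  exact (AddCircle.coe_eq_zero_iff 1).2 ⟨n, by simp⟩

lemma Collar.exists_level {q : κ.Cover} (h : κ.proj q ∈ c) : ∃ n : ℤ, κ.level q = n := by
  rw [← κ.height_eq_zero_iff, κ.height_proj] at h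
  obtain ⟨n, hn⟩ := (AddCircle.coe_eq_zero_iff 1).1 h
  exact ⟨n, by rw [← hn]; simp⟩

lemma Collar.exists_mem_coreLift {x : S} (hx : x ∈ c) (n : ℤ) : ∃ q ∈ κ.coreLift n, κ.proj q = x := by
  have h : κ.height x = (((n : ℤ) : ℝ) : UnitAddCircle) := by
    rw [κ.height_eq_zero_iff.2 hx]
    exact ((AddCircle.coe_eq_zero_iff 1).2 ⟨n, by simp⟩).symm
  exact ⟨⟨(x, n), h⟩, rfl, rfl⟩

lemma Collar.isLift_coreLift (n : ℤ) : κ.IsLift (κ.coreLift n) c := by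
  have hmem : ∀ z : Circle, κ.toMap (z, ⟨0, by norm_num⟩) ∈ c := fun z => κ.toMap_mem_iff.2 rfl
  have hh : ∀ z : Circle, κ.height (κ.toMap (z, ⟨0, by norm_num⟩)) = (((n : ℤ) : ℝ) : UnitAddCircle) := by
    intro z
    rw [κ.height_eq_zero_iff.2 (hmem z)]
    exact ((AddCircle.coe_eq_zero_iff 1).2 ⟨n, by simp⟩).symm
  set γ : C(Circle, κ.Cover) := ⟨fun z => ⟨(κ.toMap (z, ⟨0, by norm_num⟩), n), hh z⟩, by
    refine Continuous.subtype_mk ?_ _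
    fun_prop⟩ with hγ
  refine ⟨⟨γ, fun z z' hz => ?_, ?_⟩, ?_, ?_, ?_⟩
  · exact congrArg Prod.fst (κ.injective (congrArg κ.proj hz))
  · ext q
    constructor
    · rintro ⟨z, rfl⟩
      rfl
    · intro hq
      obtain ⟨p, hp, hpq⟩ := κ.core.ge (κ.level_coe_eq_zero hq)
      refine ⟨p.1, κ.cover_ext ?_ (Eq.symm hq)⟩
      rw [← hpq]
      exact congrArg κ.toMap (Prod.ext rfl (Subtype.ext (Eq.symm hp)))
  · exact fun q hq => κ.level_coe_eq_zero hq
  · exact fun q hq q' hq' h => κ.cover_ext h (Eq.trans hq (Eq.symm hq'))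
  · exact fun x hx => κ.exists_mem_coreLift hx n

/-- The lifts of `c` are the curves at integral levels. -/
lemma Collar.isLift_iff {C : Set κ.Cover} : κ.IsLift C c ↔ ∃ n : ℤ, C = κ.coreLift n := by
  constructor
  · rintro ⟨⟨γ, -, rfl⟩, hb⟩
    have hc : IsPreconnected (range γ) := isPreconnected_range γ.continuous
    choose n hn using fun z : Circle => κ.exists_level (hb.mapsTo ⟨z, rfl⟩ : κ.proj (γ z) ∈ c)
    -- On a lift of c the level is continuous with integral values.
    have hconst : ∀ z, κ.level (γ z) = n 1 := by
      intro z
      have hnc : Continuous n := by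
        have h : Continuous fun z => ((n z : ℤ) : ℝ) := by
          simp only [← hn]
          exact κ.continuous_level.comp γ.continuous
        exact Int.isClosedEmbedding_coe_real.isInducing.continuous_iff.2 h
      rw [hn z, PreconnectedSpace.constant inferInstance hnc (x := z) (y := 1)]
    refine ⟨n 1, Subset.antisymm ?_ ?_⟩
    · rintro _ ⟨z, rfl⟩
      exact hconst z
    · intro q hq
      obtain ⟨_, ⟨z, rfl⟩, hz⟩ := hb.surjOn (κ.level_coe_eq_zero hq)
      exact ⟨z, κ.cover_ext hz ((hconst z).trans (Eq.symm hq))⟩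
  · rintro ⟨n, rfl⟩
    exact κ.isLift_coreLift n

/-- A closed curve of the cover lies strictly between two levels whose distance is the number of
lifts of `c` that it meets, plus one. -/
theorem Collar.exists_level_bounds {B : Set κ.Cover} (hB : IsSimpleClosedCurve B) (hc : c.Nonempty) :
    ∃ a : ℤ, ∀ q ∈ B, (a : ℝ) < κ.level q ∧ κ.level q < a + (κ.liftsMet B + 1 : ℕ) := by
  obtain ⟨γ, -, rfl⟩ := hB
  have hcont : Continuous (κ.level ∘ γ) := κ.continuous_level.comp γ.continuous
  have hconn : IsPreconnected (range (κ.level ∘ γ)) := isPreconnected_range hcont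
  obtain ⟨zm, -, hzm⟩ := isCompact_univ.exists_isMinOn univ_nonempty hcont.continuousOn
  obtain ⟨zM, -, hzM⟩ := isCompact_univ.exists_isMaxOn univ_nonempty hcont.continuousOn
  set m := κ.level (γ zm) with hm
  set M := κ.level (γ zM) with hM
  have hle : ∀ z, m ≤ κ.level (γ z) ∧ κ.level (γ z) ≤ M :=
    fun z => ⟨hzm (mem_univ z), hzM (mem_univ z)⟩
  have hmM : m ≤ M := (hle zm).2
  -- By the intermediate value theorem the closed curve meets exactly the lifts at the integers
  -- between its least and greatest level.
  have hset : {C : Set κ.Cover | κ.IsLift C c ∧ (range γ ∩ C).Nonempty} =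
      κ.coreLift '' (Icc ⌈m⌉ ⌊M⌋ : Set ℤ) := by
    ext C
    constructor
    · rintro ⟨hC, q, ⟨z, rfl⟩, hq⟩
      obtain ⟨n, rfl⟩ := κ.isLift_iff.1 hC
      refine ⟨n, ⟨Int.ceil_le.2 ?_, Int.le_floor.2 ?_⟩, rfl⟩
      · exact (hle z).1.trans_eq hq
      · exact (Eq.symm hq).trans_le (hle z).2
    · rintro ⟨n, ⟨h1, h2⟩, rfl⟩
      obtain ⟨z, hz⟩ := hconn.Icc_subset ⟨zm, rfl⟩ ⟨zM, rfl⟩ (⟨Int.ceil_le.1 h1, Int.le_floor.1 h2⟩ :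
        (n : ℝ) ∈ Icc m M)
      exact ⟨κ.isLift_coreLift n, γ z, ⟨z, rfl⟩, hz⟩
  have hinj : Function.Injective κ.coreLift := by
    intro n n' h
    obtain ⟨x, hx⟩ := hc
    obtain ⟨q, hq, -⟩ := κ.exists_mem_coreLift hx n
    have hq' : q ∈ κ.coreLift n' := h ▸ hq
    exact_mod_cast (Eq.symm hq).trans hq'
  have hcard : κ.liftsMet (range γ) = (⌊M⌋ + 1 - ⌈m⌉).toNat := by
    rw [Collar.liftsMet, hset, ncard_image_of_injective _ hinj, ← Finset.coe_Icc,
      ncard_coe_finset, Int.card_Icc]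
  -- This bound keeps the truncated count correct when no lift of c is met, where the interval of
  -- integers is empty.
  have hfc : ⌈m⌉ ≤ ⌊M⌋ + 1 := by
    rw [Int.ceil_le]
    push_cast
    exact hmM.trans (Int.lt_floor_add_one M).le
  have hcardR : ((κ.liftsMet (range γ) + 1 : ℕ) : ℝ) = (⌊M⌋ + 1 - ⌈m⌉ : ℤ) + 1 := by
    rw [hcard]
    push_cast
    congr 1
    have h := Int.toNat_of_nonneg (show 0 ≤ ⌊M⌋ + 1 - ⌈m⌉ by omega)
    exact_mod_cast h
  -- With this a, the upper level a + (count + 1) is ⌊M⌋ + 1, so both inequalities are strict.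
  refine ⟨⌈m⌉ - 1, ?_⟩
  rintro _ ⟨z, rfl⟩
  obtain ⟨h1, h2⟩ := hle z
  rw [hcardR]
  push_cast
  have h3 := Int.ceil_lt_add_one m
  have h4 := Int.lt_floor_add_one M
  constructor <;> linarith

end Lifts

/-! ### Interpolation and the distance bound -/

section Distance

lemma edist_le_of_adj {V : Type*} (G : SimpleGraph V) (β : ℕ → V) (n : ℕ)
    (h : ∀ j < n, G.Adj (β j) (β (j + 1))) : G.edist (β 0) (β n) ≤ (n : ℕ∞) := by
  induction n with
  | zero => simp
  | succ n ih =>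
    refine G.edist_triangle.trans (b := G.edist (β 0) (β n) + G.edist (β n) (β (n + 1))) ?_
    rw [SimpleGraph.edist_eq_one_iff_adj.2 (h n (by omega))]
    push_cast
    gcongr
    exact ih fun j hj => h j (by omega)

lemma le_norm_coe {r τ : ℝ} (h : r ∈ Icc τ (1 - τ)) : τ ≤ ‖(r : UnitAddCircle)‖ := by
  rw [UnitAddCircle.norm_eq]
  rcases le_or_gt (round r) 0 with h0 | h0
  · have : (round r : ℝ) ≤ 0 := by exact_mod_cast h0
    exact (by linarith [h.1] : τ ≤ r - round r).trans (le_abs_self _)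
  · have : (1 : ℝ) ≤ round r := by exact_mod_cast h0
    exact (by linarith [h.2] : τ ≤ -(r - round r)).trans (neg_le_abs _)

variable {S : Type*} [TopologicalSpace S] [T2Space S] [CompactSpace S]
  [ChartedSpace (EuclideanSpace ℝ (Fin 2)) S]

/-- The distance between two curves that are zero sets of functions in the class dual to `c`. -/
theorem edist_le_of_interpolation (c : EssentialCurve S) (hc : IsConnected (c.1)ᶜ) (κ : Collar c.1)
    (α : EssentialCurve S) {M : ℕ} (hM : 0 < M) {u : S → ℝ} (hu : Continuous u)
    (hu' : ∀ x, u x ∈ Ioo (-M : ℝ) 0) (hα : ∀ x ∈ α.1, κ.height x + (u x : UnitAddCircle) = 0) :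
    (fineCurveGraph S).edist α c ≤ (M : ℕ∞) := by
  have hMR : (0 : ℝ) < M := by exact_mod_cast hM
  set w : ℕ → S → ℝ := fun j x => u x - j / M * (u x + M) with hw
  obtain ⟨x₀, hx₀⟩ : c.1.Nonempty := by
    obtain ⟨γ, -, h, -⟩ := c.2
    exact ⟨γ 1, h.le ⟨1, rfl⟩⟩
  have : Nonempty S := ⟨x₀⟩
  -- By compactness the strict bounds on u keep the step (u + M) / M uniformly away from 0 and 1.
  obtain ⟨τ, hτ, hτ'⟩ : ∃ τ > 0, ∀ x, (u x + M) / M ∈ Icc τ (1 - τ) := by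
    obtain ⟨ym, -, hym⟩ := isCompact_univ.exists_isMinOn univ_nonempty hu.continuousOn
    obtain ⟨yM, -, hyM⟩ := isCompact_univ.exists_isMaxOn univ_nonempty hu.continuousOn
    refine ⟨min ((u ym + M) / M) (-u yM / M), lt_min (div_pos ?_ hMR) (div_pos ?_ hMR),
      fun x => ⟨(min_le_left _ _).trans ?_, ?_⟩⟩
    · linarith [(hu' ym).1]
    · linarith [(hu' yM).2]
    · gcongr
      exact hym (mem_univ x)
    · have h1 := min_le_right ((u ym + M) / M) (-u yM / M)
      have h2 : u x / M ≤ u yM / M := by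
        gcongr
        exact hyM (mem_univ x)
      have h3 : (u x + M) / M = u x / M + 1 := by field_simp
      rw [neg_div] at h1 ⊢
      rw [h3]
      linarith
  have hwc : ∀ j, Continuous (w j) := fun j => by fun_prop
  choose A hA hAw using fun j => exists_essentialCurve_near hc κ (hwc j) (half_pos hτ)
  -- The endpoints of the path are α and c themselves, which lie in the zero sets for j = 0 and j =
  -- M; the other vertices are only close to their zero sets.
  set β : ℕ → EssentialCurve S := fun j =>
    if j = 0 then α else if j = M then c else ⟨A j, hA j⟩ with hβ
  have hβw : ∀ j, ∀ x ∈ (β j).1, ‖κ.height x + (w j x : UnitAddCircle)‖ < τ / 2 := by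
    intro j x hx
    by_cases h0 : j = 0
    · subst h0
      simp only [hβ, if_true] at hx
      have hwx : w 0 x = u x := by simp [hw]
      rw [hwx, hα x hx, norm_zero]
      exact half_pos hτ
    · by_cases h1 : j = M
      · subst h1
        simp only [hβ, h0, if_false, if_true] at hx
        have hwx : w j x = -(j : ℝ) := by
          simp only [hw]
          field_simp
          ring
        rw [hwx, κ.height_eq_zero_iff.2 hx, zero_add,
          (AddCircle.coe_eq_zero_iff 1).2 ⟨-(j : ℤ), by simp⟩, norm_zero]
        exact half_pos hτ
      · simp only [hβ, h0, h1, if_false] at hx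
        exact hAw j x hx
  have hadj : ∀ j < M, (fineCurveGraph S).Adj (β j) (β (j + 1)) := by
    intro j _
    refine Set.disjoint_left.2 fun x hx hx' => ?_
    have h1 := hβw j x hx
    have h2 := hβw (j + 1) x hx'
    have h3 := le_norm_coe (hτ' x)
    -- At a common point both functions would have norm less than τ / 2, while their difference has
    -- norm at least τ.
    have h4 : (((u x + M) / M : ℝ) : UnitAddCircle) = (κ.height x + (w j x : UnitAddCircle)) -
        (κ.height x + (w (j + 1) x : UnitAddCircle)) := by
      rw [add_sub_add_left_eq_sub, ← AddCircle.coe_sub]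
      congr 1
      simp only [hw]
      push_cast
      field_simp
      ring
    rw [h4] at h3
    linarith [norm_sub_le (κ.height x + (w j x : UnitAddCircle))
      (κ.height x + (w (j + 1) x : UnitAddCircle))]
  have h := edist_le_of_adj _ β M hadj
  simpa [hβ, hM.ne'] using h

/-- The distance to `c` of a curve that lifts to the infinite cyclic cover defined by `c`. -/
theorem edist_le_of_isLift (c : EssentialCurve S) (hc : IsConnected (c.1)ᶜ) (κ : Collar c.1)
    (α : EssentialCurve S) {B : Set κ.Cover} (hB : κ.IsLift B α.1) :
    (fineCurveGraph S).edist α c ≤ ((κ.liftsMet B + 1 : ℕ) : ℕ∞) := by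
  have hne : c.1.Nonempty := by
    obtain ⟨γ, -, h, -⟩ := c.2
    exact ⟨γ 1, h.le ⟨1, rfl⟩⟩
  obtain ⟨a, ha⟩ := κ.exists_level_bounds hB.1 hne
  have hBc : IsCompact B := by
    obtain ⟨γ, -, rfl⟩ := hB.1
    exact isCompact_range γ.continuous
  have : CompactSpace B := isCompact_iff_compactSpace.1 hBc
  have he : IsClosedEmbedding fun q : B => κ.proj q :=
    (κ.continuous_proj.comp continuous_subtype_val).isClosedEmbedding
      fun q q' h => Subtype.ext (hB.2.injOn q.2 q'.2 h)
  -- Tietze extension with values in the open interval. On α the height is the level mod 1, so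
  -- adding a − level gives the integer a, that is, 0 in the circle.
  obtain ⟨u, hu, hue⟩ := ContinuousMap.exists_extension_forall_mem_of_isClosedEmbedding
    (⟨fun q : B => a - κ.level q, continuous_const.sub
      (κ.continuous_level.comp continuous_subtype_val)⟩ : C(B, ℝ))
    (t := Ioo (-((κ.liftsMet B + 1 : ℕ) : ℝ)) 0)
    (fun q => by
      have := ha q q.2
      constructor
      · simp only [ContinuousMap.coe_mk]; linarith
      · simp only [ContinuousMap.coe_mk]; linarith)
    (nonempty_Ioo.2 (by simp only [Left.neg_neg_iff]; positivity)) he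
  refine edist_le_of_interpolation c hc κ α (Nat.succ_pos _) u.continuous hu fun x hx => ?_
  obtain ⟨q, hq, rfl⟩ := hB.2.surjOn hx
  have h := congr_fun hue ⟨q, hq⟩
  simp only [Function.comp_apply, ContinuousMap.coe_mk] at h
  rw [h, κ.height_proj, ← AddCircle.coe_add, add_sub_cancel]
  exact (AddCircle.coe_eq_zero_iff 1).2 ⟨a, by simp⟩

end Distance

end FineCurves

theorem lemma5p2 {S : Type*} [TopologicalSpace S] [T2Space S] [CompactSpace S] [ConnectedSpace S]
    [ChartedSpace (EuclideanSpace ℝ (Fin 2)) S]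
    (horient : FineCurves.IsOrientableSurface S) (hgenus : FineCurves.GenusAtLeast S 2)
    (c : FineCurves.EssentialCurve S) (hc : IsConnected (c.1)ᶜ)
    (κ : FineCurves.Collar c.1)
    (α : FineCurves.EssentialCurve S) (hα : FineCurves.IsotopicCurves α.1 c.1) :
    (∃ B : Set κ.Cover, κ.IsLift B α.1) ∧
      ∀ B : Set κ.Cover, κ.IsLift B α.1 →
        (FineCurves.fineCurveGraph S).edist α c ≤ ((κ.liftsMet B + 1 : ℕ) : ℕ∞) := by
  exact ⟨κ.exists_isLift hα, fun B hB => FineCurves.edist_le_of_isLift c hc κ α hB⟩
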